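/- **Setting.** For finite sets of labels with $k+2l\ge 3$, let $\overline{\mathcal M}^\tau_{k,l}$ be the moduli space of stable real genus $0$ curves $(\Sigma,(x_i)_{i\le k},(z_i^+,z_i^-)_{i\le l},\sigma)$: $\Sigma$ is a tree of Riemann spheres, $\sigma$ an anti-holomorphic involution with separating (equivalently, non-empty) fixed locus, the $x_i$ are fixed by $\sigma$ and $\sigma(z_i^+)=z_i^-$. It is a compact smooth manifold of dimension $k+2l-3$, embedded by the cross-ratios of its marked points; if $k=0$, its boundary consists of the curves with no $\sigma$-invariant component, and otherwise it has no boundary. The open codimension $1$ strata off the boundary consist of the curves with exactly two components, both real, with a prescribed distribution of the marked points; $S_i$ is the one where $z_i^\pm$ are the only marked points on one of the components, and $\overline S_i$ is its closure. Strata of codimension at least $2$ consist of curves with at least two nodes. Let $\mathfrak f^{\mathbb R}_{k,l;i}:\overline{\mathcal M}^\tau_{k,l}\to\overline{\mathcal M}^\tau_{k-1,l}$ be the morphism forgetting $x_i$, and $\overline{\mathcal M}^{\tau;\bigstar}_{k,l;i}$ the set of curves for which $x_i$ and $z_1^+$ lie on the same component; on this set, the vertical tangent line of $\mathfrak f^{\mathbb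 R}_{k,l;i}$ is oriented by $\mathfrak o_i^{\mathbb R}$: the point $x_i$ moves counterclockwise on the fixed circle of its component, viewed as the boundary of the disk containing $z_1^+$. For a codimension $1$ stratum $S$, let $k_1,l_1$ be the numbers of real points and of conjugate pairs on the component containing $z_1^\pm$ and $k_2,l_2$ those on the other one, so that $\overline S\approx\overline{\mathcal M}^\tau_{k_1+1,l_1}\times\overline{\mathcal M}^\tau_{k_2+1,l_2}$, the additional real points being the node. If $S\ne S_1$, let $\mathfrak f_{S;1}:\overline S\to\overline{\mathcal M}^\tau_{k_1,l_1}\times\overline{\mathcal M}^\tau_{k_2+1,l_2}$ be the morphism forgetting the node $\mathrm{nd}$ on the first component, with its vertical tangent line oriented by the counterclockwise rotation $\mathfrak o^{\mathbb R}_{\mathrm{nd}}$ of the node. **Regularity.** A bordered hypersurface $\Upsilon\subset\overline{\mathcal M}^\tau_{k,l}$ is *regular* if * $\overline\Upsilon-\Upsilon$ lies in the strata of codimension at least $2$; * for every $i\le k$: $\Upsilon-\partial\Upsilon\subset\overline{\mathcal M}^{\tau;\bigstar}_{k,l;i}$, $\mathfrak f^{\mathbb R}_{k,l;i}(\overline\Upsilon-\Upsilon)$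 lies in the strata of codimension at least $2$, and $\mathfrak f^{\mathbb R}_{k,l;i}(\partial\Upsilon)$ lies in the union of the boundary and these strata; * for every codimension $1$ stratum $S$ off the boundary: $\Upsilon$ and $\partial\Upsilon$ are transverse to $\overline S$; $\Upsilon\cap\overline S=\Upsilon_1\times\overline{\mathcal M}^\tau_{k_2+1,l_2}$ for some $\Upsilon_1\subset\overline{\mathcal M}^{\tau;\bigstar}_{k_1+1,l_1;\mathrm{nd}}$; and, if $S\ne S_1$, $\mathfrak f_{S;1}((\overline\Upsilon-\Upsilon)\cap\overline S)$ lies in the strata of codimension at least $2$ and $\mathfrak f_{S;1}(\partial\Upsilon\cap\overline S)$ in the union of the boundary and these strata. For a co-orientation $\mathfrak o^c_\Upsilon$ (an orientation of the normal line bundle $\mathcal N\Upsilon$) of a regular hypersurface, $\deg^{\mathbb R}_i(\Upsilon,\mathfrak o^c_\Upsilon)$ is the signed number of points in the fiber of $\mathfrak f^{\mathbb R}_{k,l;i}|_\Upsilon$ over a regular value, the sign of a point being $+1$ if the projection of the vertical tangent line with the orientation $\mathfrak o_i^{\mathbb R}$ to $\mathcal N\Upsilon$ preserves the orientations and $-1$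 if it reverses them; $\deg_S(\Upsilon,\mathfrak o_\Upsilon^c)$ is defined in the same way with $\mathfrak f_{S;1}|_{\Upsilon\cap\overline S}$ and $\mathfrak o^{\mathbb R}_{\mathrm{nd}}$. Let $P^\pm\in\overline{\mathcal M}^\tau_{1,2}$ be the three-component curve for which $z_1^+$ and $z_2^\pm$ lie on the same component, and let $\mathfrak o^c_{P^\pm}$ be the complex orientation of $T_{P^\pm}\overline{\mathcal M}^\tau_{1,2}$, viewed as the complex line of smoothings of the node separating the component of $z_1^+$ from the real component (with the conjugate smoothing of the other node). **Lemma.** There exist a smoothly embedded closed path $\Upsilon\subset\overline{\mathcal M}^\tau_{1,2}$ (an embedded compact interval) and a co-orientation $\mathfrak o^c_\Upsilon$ of $\Upsilon$ such that $\Upsilon$ is a regular hypersurface, $\Upsilon\cap\overline S_1=\emptyset$, and $$\partial(\Upsilon,\mathfrak o^c_\Upsilon)=(P^+,\mathfrak o^c_{P^+})\sqcup(P^-,\mathfrak o^c_{P^-}),\qquad \deg^{\mathbb R}_1(\Upsilon,\mathfrak o^c_\Upsilon)=1,\qquad \deg_{S_2}(\Upsilon,\mathfrak o^c_\Upsilon)=-1,$$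 where the co-orientation of an endpoint is given by the outer normal of $\Upsilon$ followed by $\mathfrak o^c_\Upsilon$. -/

import Mathlib

open scoped ContDiff

noncomputable section

namespace RealDM

/-! ### Real stable curves of genus zero -/

/-- The Riemann sphere, with the action of `GL (Fin 2) ℂ` by Möbius transformations. -/
abbrev P1 := OnePoint ℂ

/-- Complex conjugation on the Riemann sphere. -/
def P1.conj (z : P1) : P1 := OnePoint.map (starRingEnd ℂ) z

/-- Labels of the marked points: `inl i` is the real point `x_i`,
`inr (i, true)` is `z_i⁺` and `inr (i, false)` is `z_i⁻`. -/
abbrev Mark (K L : Type) := K ⊕ (L × Bool)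

/-- The exchange of the two points in each conjugate pair. -/
def Mark.conj {K L : Type} : Mark K L → Mark K L
  | Sum.inl i => Sum.inl i
  | Sum.inr (i, b) => Sum.inr (i, !b)

/-- A connected nodal curve of arithmetic genus zero (a tree of Riemann spheres) with an
anti-holomorphic involution whose fixed locus is non-empty.

The components are indexed by `Fin n`, the nodes are the edges of the tree `graph`.
For `v ≠ w`, the point `dir v w` of the component `v` is the node of `v` through which one leaves
`v` on the way to the component `w`; the values `dir v v` play no role.
The involution sends the point `z` of the component `v` to the point `sig v z` of the
component `inv v`.  Its fixed locus contains either a point of an invariant component or a node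
whose two branches are exchanged.  (On a tree of spheres, the fixed locus of an anti-holomorphic
involution is separating if and only if it is not empty.) -/
structure RealTree where
  n : ℕ
  graph : SimpleGraph (Fin n)
  isTree : graph.IsTree
  dir : Fin n → Fin n → P1
  dir_branch : ∀ v u w, graph.Adj u w → u ≠ v → w ≠ v → dir v u = dir v w
  dir_inj : ∀ v u w, graph.Adj v u → graph.Adj v w → dir v u = dir v w → u = w
  inv : Fin n → Fin n
  sig : Fin n → P1 → P1
  inv_inv : ∀ v, inv (inv v) = v
  inv_adj : ∀ v w, graph.Adj v w → graph.Adj (inv v) (inv w)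
  sig_antiholomorphic : ∀ v, ∃ g : GL (Fin 2) ℂ, ∀ z, sig v z = g • P1.conj z
  sig_sig : ∀ v z, sig (inv v) (sig v z) = z
  sig_dir : ∀ v w, graph.Adj v w → sig v (dir v w) = dir (inv v) (inv w)
  fixed : (∃ v z, inv v = v ∧ sig v z = z) ∨ ∃ v w, graph.Adj v w ∧ inv v = w

/-- Marked points on a tree of spheres, distinct from each other and from the nodes, real or
in conjugate pairs, making every component stable. -/
structure Marking (T : RealTree) (K L : Type) where
  comp : Mark K L → Fin T.n
  pos : Mark K L → P1
  pos_inj : ∀ i j, comp i = comp j → pos i = pos j → i = j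
  pos_ne_node : ∀ i w, T.graph.Adj (comp i) w → pos i ≠ T.dir (comp i) w
  stable : ∀ v, 3 ≤ Set.ncard
    ({z | ∃ w, T.graph.Adj v w ∧ T.dir v w = z} ∪ {z | ∃ i, comp i = v ∧ pos i = z})
  comp_conj : ∀ i, comp (Mark.conj i) = T.inv (comp i)
  pos_conj : ∀ i, pos (Mark.conj i) = T.sig (comp i) (pos i)

/-- A stable real curve of genus zero. -/
abbrev Curve (K L : Type) := Σ T : RealTree, Marking T K L

/-- Isomorphisms of marked real curves. -/
def Iso {K L : Type} (C D : Curve K L) : Prop :=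
  ∃ (f : Fin C.1.n ≃ Fin D.1.n) (g : Fin C.1.n → GL (Fin 2) ℂ),
    (∀ v w, C.1.graph.Adj v w ↔ D.1.graph.Adj (f v) (f w)) ∧
    (∀ v w, C.1.graph.Adj v w → D.1.dir (f v) (f w) = g v • C.1.dir v w) ∧
    (∀ v, D.1.inv (f v) = f (C.1.inv v)) ∧
    (∀ v z, D.1.sig (f v) (g v • z) = g (C.1.inv v) • C.1.sig v z) ∧
    (∀ i, D.2.comp i = f (C.2.comp i)) ∧
    (∀ i, D.2.pos i = g (C.2.comp i) • C.2.pos i)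

theorem Iso.refl {K L : Type} (C : Curve K L) : Iso C C :=
  ⟨Equiv.refl _, fun _ => 1, by simp⟩

theorem Iso.symm {K L : Type} {C D : Curve K L} (h : Iso C D) : Iso D C := by
  obtain ⟨f, g, h1, h2, h3, h4, h5, h6⟩ := h
  refine ⟨f.symm, fun v => (g (f.symm v))⁻¹, ?_, ?_, ?_, ?_, ?_, ?_⟩
  · intro v w
    rw [h1]
    simp
  · intro v w hvw
    have := h2 (f.symm v) (f.symm w) (by rw [h1]; simpa using hvw)
    simp only [Equiv.apply_symm_apply] at this
    rw [this, inv_smul_smul]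
  · intro v
    rw [Equiv.eq_symm_apply, ← h3, Equiv.apply_symm_apply]
  · intro v z
    have h := h4 (f.symm v) ((g (f.symm v))⁻¹ • z)
    have e : f.symm (D.1.inv v) = C.1.inv (f.symm v) := by
      rw [Equiv.symm_apply_eq, ← h3, Equiv.apply_symm_apply]
    rw [smul_inv_smul, Equiv.apply_symm_apply] at h
    simp only [h, e, inv_smul_smul]
  · intro i
    rw [h5, Equiv.symm_apply_apply]
  · intro i
    simp only [h5, h6, Equiv.symm_apply_apply, inv_smul_smul]

theorem Iso.trans {K L : Type} {C D F : Curve K L} (h : Iso C D) (h' : Iso D F) : Iso C F := by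
  obtain ⟨f, g, h1, h2, h3, h4, h5, h6⟩ := h
  obtain ⟨f', g', h1', h2', h3', h4', h5', h6'⟩ := h'
  refine ⟨f.trans f', fun v => g' (f v) * g v, ?_, ?_, ?_, ?_, ?_, ?_⟩
  · intro v w
    rw [h1, h1']
    rfl
  · intro v w hvw
    simp only [Equiv.trans_apply]
    rw [h2' _ _ ((h1 v w).1 hvw), h2 v w hvw, mul_smul]
  · intro v
    simp only [Equiv.trans_apply]
    rw [h3', h3]
  · intro v z
    simp only [Equiv.trans_apply]
    rw [mul_smul, h4', h4, h3, mul_smul]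
  · intro i
    rw [h5', h5, Equiv.trans_apply]
  · intro i
    rw [h6', h6, h5, mul_smul]

instance isoSetoid (K L : Type) : Setoid (Curve K L) :=
  ⟨Iso, Iso.refl, Iso.symm, Iso.trans⟩

/-- The moduli space of stable real genus zero curves with real marked points indexed by `K` and
conjugate pairs of marked points indexed by `L`. -/
def Moduli (K L : Type) : Type := Quotient (isoSetoid K L)

/-- The isomorphism class of a marked curve. -/
def Moduli.mk {K L : Type} (T : RealTree) (μ : Marking T K L) : Moduli K L :=
  Quotient.mk (isoSetoid K L) ⟨T, μ⟩

/-! ### The topology and the smooth structure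

The cross-ratios of the marked points embed the moduli space into a product of Riemann spheres
as a compact smooth submanifold (with boundary if `K` is empty).  We compose with the embedding
of the Riemann sphere as the unit sphere in `ℂ × ℝ`, so that the moduli space is identified with
a submanifold of a finite-dimensional real vector space. -/

/-- The position of the marked point `i` as seen from the component `v`: the marked point itself
if it lies on `v`, the node of `v` leading to it otherwise. -/
def Marking.seen {T : RealTree} {K L : Type} (μ : Marking T K L) (v : Fin T.n) (i : Mark K L) :
    P1 :=
  if μ.comp i = v then μ.pos i else T.dir v (μ.comp i)

/-- `c` is the coordinate of the fourth marked point on the component which separates the first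
three of them, in the affine coordinate in which those three are `0`, `1` and `∞`. -/
def Marking.IsCrossRatio {T : RealTree} {K L : Type} (μ : Marking T K L)
    (q : Fin 4 ↪ Mark K L) (c : P1) : Prop :=
  ∃ (v : Fin T.n) (g : GL (Fin 2) ℂ),
    g • μ.seen v (q 0) = ((0 : ℂ) : P1) ∧ g • μ.seen v (q 1) = ((1 : ℂ) : P1) ∧
    g • μ.seen v (q 2) = OnePoint.infty ∧ g • μ.seen v (q 3) = c

/-- The cross-ratio of four distinct marked points, as a function on the moduli space. -/
def Moduli.crossRatio {K L : Type} (m : Moduli K L) (q : Fin 4 ↪ Mark K L) : P1 :=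
  Classical.epsilon fun c =>
    ∃ (T : RealTree) (μ : Marking T K L), Moduli.mk T μ = m ∧ μ.IsCrossRatio q c

/-- The identification of the Riemann sphere with the unit sphere in `ℂ × ℝ`. -/
def sphere : P1 → ℂ × ℝ
  | none => (0, 1)
  | some z => (((2 / (‖z‖ ^ 2 + 1) : ℝ) : ℂ) * z, (‖z‖ ^ 2 - 1) / (‖z‖ ^ 2 + 1))

/-- The ambient vector space. -/
abbrev Ambient (K L : Type) := (Fin 4 ↪ Mark K L) → ℂ × ℝ

/-- The embedding of the moduli space. -/
def emb {K L : Type} (m : Moduli K L) : Ambient K L := fun q => sphere (m.crossRatio q)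

instance (K L : Type) : TopologicalSpace (Moduli K L) :=
  TopologicalSpace.induced emb inferInstance

/-- The tangent space at `p` of a submanifold `A` of the moduli space (possibly with boundary),
as a subspace of the ambient vector space. -/
def tangentSpace {K L : Type} (A : Set (Moduli K L)) (p : Moduli K L) :
    Submodule ℝ (Ambient K L) :=
  Submodule.span ℝ (tangentConeAt ℝ (emb '' A) (emb p))

/-- The set of points of the closure of `A` which do not lie in `A`. -/
def ends {K L : Type} (A : Set (Moduli K L)) : Set (Moduli K L) :=
  {m | emb m ∈ closure (emb '' A) \ emb '' A}

/-! ### Strata -/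

/-- `m` has a representative with exactly `k` nodes. -/
def HasNodes {K L : Type} (m : Moduli K L) (k : ℕ) : Prop :=
  ∃ (T : RealTree) (μ : Marking T K L), Moduli.mk T μ = m ∧ T.n = k + 1

/-- The union of the strata of codimension at least two. -/
def codimTwo (K L : Type) : Set (Moduli K L) := {m | ∃ k, 2 ≤ k ∧ HasNodes m k}

/-- The boundary of the moduli space: curves with no component preserved by the involution. -/
def boundary (K L : Type) : Set (Moduli K L) :=
  {m | ∃ (T : RealTree) (μ : Marking T K L), Moduli.mk T μ = m ∧ ∀ v, T.inv v ≠ v}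

/-- The open codimension one stratum of curves with two real components, one of them carrying
the real points in `A` and the conjugate pairs in `B`, the other one carrying the rest. -/
def stratum {K L : Type} (A : Set K) (B : Set L) : Set (Moduli K L) :=
  {m | ∃ (T : RealTree) (μ : Marking T K L), Moduli.mk T μ = m ∧ T.n = 2 ∧
    (∀ v, T.inv v = v) ∧ ∃ v, (∀ i, μ.comp (Sum.inl i) = v ↔ i ∈ A) ∧
      ∀ j b, μ.comp (Sum.inr (j, b)) = v ↔ j ∈ B}

/-- `A`, `B` describe a codimension one stratum; the first component, carrying `A` and `B`, is the
one with the conjugate pair `o`. -/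
def IsStratumType {K L : Type} (o : L) (A : Set K) (B : Set L) : Prop :=
  o ∈ B ∧ 2 ≤ A.ncard + 2 * B.ncard ∧ 2 ≤ Aᶜ.ncard + 2 * Bᶜ.ncard

/-- The curves on which the real point `i` and `z_o⁺` lie on the same component. -/
def star {K L : Type} (o : L) (i : K) : Set (Moduli K L) :=
  {m | ∃ (T : RealTree) (μ : Marking T K L), Moduli.mk T μ = m ∧
    μ.comp (Sum.inl i) = μ.comp (Sum.inr (o, true))}

/-! ### Forgetful and gluing morphisms -/

/-- The inclusion of the marked points other than the real point `i`. -/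
def Mark.lift {K L : Type} (i : K) : Mark {j : K // j ≠ i} L ↪ Mark K L :=
  Function.Embedding.sumMap (Function.Embedding.subtype _) (Function.Embedding.refl _)

/-- `m'` is the image of `m` under the morphism forgetting the real point `i`: dropping this point
and contracting the components that become unstable does not change the cross-ratios of the
other marked points, which determine the resulting stable curve. -/
def IsForget {K L : Type} (i : K) (m : Moduli K L) (m' : Moduli {j : K // j ≠ i} L) : Prop :=
  ∀ q, m'.crossRatio q = m.crossRatio (q.trans (Mark.lift i))

/-- The curve `(T, μ)` is obtained from `(T₁, μ₁)` and `(T₂, μ₂)` by identifying the real points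
labelled `none` into a node. -/
def IsGluing {K L : Type} {A : Set K} {B : Set L} {T₁ T₂ T : RealTree}
    (μ₁ : Marking T₁ (Option A) B) (μ₂ : Marking T₂ (Option ↥(Aᶜ)) ↥(Bᶜ)) (μ : Marking T K L) :
    Prop :=
  ∃ e : Fin T₁.n ⊕ Fin T₂.n ≃ Fin T.n,
    (∀ v w, T.graph.Adj (e (Sum.inl v)) (e (Sum.inl w)) ↔ T₁.graph.Adj v w) ∧
    (∀ v w, T.graph.Adj (e (Sum.inr v)) (e (Sum.inr w)) ↔ T₂.graph.Adj v w) ∧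
    (∀ v w, T.graph.Adj (e (Sum.inl v)) (e (Sum.inr w)) ↔
      v = μ₁.comp (Sum.inl none) ∧ w = μ₂.comp (Sum.inl none)) ∧
    (∀ v w, T₁.graph.Adj v w → T.dir (e (Sum.inl v)) (e (Sum.inl w)) = T₁.dir v w) ∧
    (∀ v w, T₂.graph.Adj v w → T.dir (e (Sum.inr v)) (e (Sum.inr w)) = T₂.dir v w) ∧
    T.dir (e (Sum.inl (μ₁.comp (Sum.inl none)))) (e (Sum.inr (μ₂.comp (Sum.inl none)))) =
      μ₁.pos (Sum.inl none) ∧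
    T.dir (e (Sum.inr (μ₂.comp (Sum.inl none)))) (e (Sum.inl (μ₁.comp (Sum.inl none)))) =
      μ₂.pos (Sum.inl none) ∧
    (∀ v, T.inv (e (Sum.inl v)) = e (Sum.inl (T₁.inv v))) ∧
    (∀ v, T.inv (e (Sum.inr v)) = e (Sum.inr (T₂.inv v))) ∧
    (∀ v, T.sig (e (Sum.inl v)) = T₁.sig v) ∧
    (∀ v, T.sig (e (Sum.inr v)) = T₂.sig v) ∧
    (∀ i : A, μ.comp (Sum.inl i) = e (Sum.inl (μ₁.comp (Sum.inl (some i)))) ∧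
      μ.pos (Sum.inl i) = μ₁.pos (Sum.inl (some i))) ∧
    (∀ (j : B) (b : Bool), μ.comp (Sum.inr (j, b)) = e (Sum.inl (μ₁.comp (Sum.inr (j, b)))) ∧
      μ.pos (Sum.inr (j, b)) = μ₁.pos (Sum.inr (j, b))) ∧
    (∀ i : ↥(Aᶜ), μ.comp (Sum.inl i) = e (Sum.inr (μ₂.comp (Sum.inl (some i)))) ∧
      μ.pos (Sum.inl i) = μ₂.pos (Sum.inl (some i))) ∧
    (∀ (j : ↥(Bᶜ)) (b : Bool), μ.comp (Sum.inr (j, b)) = e (Sum.inr (μ₂.comp (Sum.inr (j, b)))) ∧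
      μ.pos (Sum.inr (j, b)) = μ₂.pos (Sum.inr (j, b)))

/-- `m` corresponds to `(m₁, m₂)` under the identification of the closed stratum of type `(A, B)`
with a product of two moduli spaces; the label `none` stands for the node. -/
def Glue {K L : Type} (A : Set K) (B : Set L) (m₁ : Moduli (Option A) B)
    (m₂ : Moduli (Option ↥(Aᶜ)) ↥(Bᶜ)) (m : Moduli K L) : Prop :=
  ∃ (T₁ : RealTree) (μ₁ : Marking T₁ (Option A) B)
    (T₂ : RealTree) (μ₂ : Marking T₂ (Option ↥(Aᶜ)) ↥(Bᶜ)) (T : RealTree) (μ : Marking T K L),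
    Moduli.mk T₁ μ₁ = m₁ ∧ Moduli.mk T₂ μ₂ = m₂ ∧ Moduli.mk T μ = m ∧ IsGluing μ₁ μ₂ μ

/-- The target of the morphism on the closed stratum of type `(A, B)` which forgets the node as a
marked point of the first component. -/
abbrev StratumTarget {K L : Type} (A : Set K) (B : Set L) :=
  Moduli {j : Option A // j ≠ none} B × Moduli (Option ↥(Aᶜ)) ↥(Bᶜ)

/-- `y` is the image of `m` under this morphism. -/
def IsForgetNode {K L : Type} (A : Set K) (B : Set L) (m : Moduli K L) (y : StratumTarget A B) :
    Prop :=
  ∃ m₁, Glue A B m₁ y.2 m ∧ IsForget none m₁ y.1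

/-- The union of the strata of codimension at least two in the target. -/
def targetCodimTwo {K L : Type} (A : Set K) (B : Set L) : Set (StratumTarget A B) :=
  {y | ∃ k l, 2 ≤ k + l ∧ HasNodes y.1 k ∧ HasNodes y.2 l}

/-- The boundary of the target. -/
def targetBoundary {K L : Type} (A : Set K) (B : Set L) : Set (StratumTarget A B) :=
  {y | y.1 ∈ boundary _ _ ∨ y.2 ∈ boundary _ _}

/-! ### Regular hypersurfaces

Here `Y` is a bordered hypersurface and `bd` is its boundary. -/

/-- Regularity with respect to the morphism forgetting the real point `i`. -/
def RegularForget {K L : Type} (o : L) (i : K) (Y bd : Set (Moduli K L)) : Prop :=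
  Y \ bd ⊆ star o i ∧
  (∀ u ∈ ends Y, ∃ m', IsForget i u m' ∧ m' ∈ codimTwo _ _) ∧
  ∀ u ∈ bd, ∃ m', IsForget i u m' ∧ m' ∈ boundary _ _ ∪ codimTwo _ _

/-- Regularity with respect to the codimension one stratum of type `(A, B)`.
The last two conditions make no sense, and are not imposed, for the stratum whose first component
carries only the conjugate pair `o`. -/
def RegularStratum {K L : Type} (o : L) (A : Set K) (B : Set L) (Y bd : Set (Moduli K L)) :
    Prop :=
  (∀ u ∈ Y ∩ closure (stratum A B),
    tangentSpace Y u ⊔ tangentSpace (closure (stratum A B)) u = tangentSpace Set.univ u) ∧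
  (∀ u ∈ bd ∩ closure (stratum A B),
    tangentSpace bd u ⊔ tangentSpace (closure (stratum A B)) u = tangentSpace Set.univ u) ∧
  (∃ Y₁ : Set (Moduli (Option A) B), (∀ h : o ∈ B, Y₁ ⊆ star ⟨o, h⟩ none) ∧
    Y ∩ closure (stratum A B) = {m | ∃ m₁ ∈ Y₁, ∃ m₂, Glue A B m₁ m₂ m}) ∧
  (¬ (A = ∅ ∧ B = {o}) →
    (∀ u ∈ ends Y ∩ closure (stratum A B),
      ∃ y, IsForgetNode A B u y ∧ y ∈ targetCodimTwo A B) ∧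
    ∀ u ∈ bd ∩ closure (stratum A B),
      ∃ y, IsForgetNode A B u y ∧ y ∈ targetBoundary A B ∪ targetCodimTwo A B)

/-- Regular hypersurfaces. -/
def Regular {K L : Type} (o : L) (Y bd : Set (Moduli K L)) : Prop :=
  ends Y ⊆ codimTwo K L ∧ (∀ i, RegularForget o i Y bd) ∧
  ∀ A B, IsStratumType o A B → RegularStratum o A B Y bd

/-! ### Co-orientations and degrees -/

/-- A co-orientation of a hypersurface `Y`, that is, an orientation of its normal line bundle,
given by a continuous section of the tangent bundle of the moduli space along `Y` which is nowhere
tangent to `Y`.  Only the sign of this section modulo the tangent bundle of `Y` is used. -/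
structure CoOrientation {K L : Type} (Y : Set (Moduli K L)) where
  normal : Moduli K L → Ambient K L
  continuousOn : ContinuousOn normal Y
  mem_tangent : ∀ p ∈ Y, normal p ∈ tangentSpace Set.univ p
  notMem_tangent : ∀ p ∈ Y, normal p ∉ tangentSpace Y p

/-- Near `θ = 0`, the curve `m θ` is a fixed curve with fixed marked points other than the real
point `i`, which moves as `exp (𝕚 θ)` along the fixed circle of its component, in the coordinate
with `z_o⁺ = 0` and `z_o⁻ = ∞`; that is, it moves in the positive direction of the circle, seen
as the boundary of the unit disk around `z_o⁺`. -/
def IsRotation {K L : Type} (o : L) (i : K) (m : ℝ → Moduli K L) : Prop :=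
  ∃ (T : RealTree) (μ : ℝ → Marking T K L) (v : Fin T.n) (g : GL (Fin 2) ℂ),
    ∀ᶠ θ in nhds (0 : ℝ), m θ = Moduli.mk T (μ θ) ∧
      (μ θ).comp = (μ 0).comp ∧
      (∀ j, j ≠ Sum.inl i → (μ θ).pos j = (μ 0).pos j) ∧
      (μ θ).comp (Sum.inl i) = v ∧ (μ θ).comp (Sum.inr (o, true)) = v ∧
      g • (μ θ).pos (Sum.inr (o, true)) = ((0 : ℂ) : P1) ∧
      g • (μ θ).pos (Sum.inr (o, false)) = OnePoint.infty ∧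
      g • (μ θ).pos (Sum.inl i) = ((Complex.exp (θ * Complex.I) : ℂ) : P1)

section Degrees

variable {K L : Type} [Fintype K] [DecidableEq K] [Fintype L] [DecidableEq L]

/-- `w` is the vertical tangent vector at `u` of the morphism forgetting the real point `i` given
by the positive rotation of this point. -/
def IsVertical (o : L) (i : K) (u : Moduli K L) (w : Ambient K L) : Prop :=
  ∃ m, IsRotation o i m ∧ m 0 = u ∧ HasDerivAt (fun θ => emb (m θ)) w 0

/-- `w` is the vertical tangent vector at `u` of the morphism on the closed stratum of type
`(A, B)` forgetting the node on the first component, given by the positive rotation of this node. -/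
def IsVerticalNode (o : L) (A : Set K) (B : Set L) (u : Moduli K L) (w : Ambient K L) : Prop :=
  ∃ (h : o ∈ B) (m₁ : ℝ → Moduli (Option A) B) (m₂ : Moduli (Option ↥(Aᶜ)) ↥(Bᶜ))
    (m : ℝ → Moduli K L),
    IsRotation ⟨o, h⟩ none m₁ ∧ (∀ᶠ θ in nhds (0 : ℝ), Glue A B (m₁ θ) m₂ (m θ)) ∧ m 0 = u ∧
    HasDerivAt (fun θ => emb (m θ)) w 0

end Degrees

/-- The sign `s = ±1` with which the vector `w` orients the normal line at `u` of the hypersurface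
`Y`, compared with the co-orientation `ν`. -/
def HasSign {K L : Type} {Y : Set (Moduli K L)} (ν : CoOrientation Y) (u : Moduli K L)
    (w : Ambient K L) (s : ℤ) : Prop :=
  ∃ a : ℝ, w - a • ν.normal u ∈ tangentSpace Y u ∧ (0 < a ∧ s = 1 ∨ a < 0 ∧ s = -1)

/-- The degree of the restriction to `Y` (a hypersurface with boundary `bd`) of a morphism with
graph `rel` to a space `Z` with boundary `bdZ`.  The one-dimensional vertical tangent spaces of the
morphism are oriented by the vectors `w` with `vert u w`; a point `u` of `Y` is a regular point of
the restriction if and only if the vertical direction is not tangent to `Y`, and its sign is then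
that of the isomorphism from the vertical line to the normal line of `Y`.  Regular values exist,
and the signed number of preimages of every regular value is `d`. -/
def HasDegree {K L Z : Type} {Y : Set (Moduli K L)} (ν : CoOrientation Y) (bd : Set (Moduli K L))
    (rel : Moduli K L → Z → Prop) (bdZ : Set Z) (vert : Moduli K L → Ambient K L → Prop)
    (d : ℤ) : Prop :=
  let RegularValue : Z → Prop := fun y =>
    y ∉ bdZ ∧ (∀ u ∈ bd ∪ ends Y, ¬ rel u y) ∧
      ∀ u ∈ Y, rel u y → ∀ w, vert u w → w ∉ tangentSpace Y u
  (∃ y, RegularValue y) ∧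
  ∀ y, RegularValue y → {u ∈ Y | rel u y}.Finite ∧
    ∃ s : Moduli K L → ℤ, (∀ u ∈ Y, rel u y → ∃ w, vert u w ∧ HasSign ν u w (s u)) ∧
      ∑ᶠ u ∈ {u ∈ Y | rel u y}, s u = d

section Paths

variable {K L : Type} [Fintype K] [DecidableEq K] [Fintype L] [DecidableEq L]

/-- The degree of `Y` with respect to the morphism forgetting the real point `i`. -/
def HasDegreeForget (o : L) (i : K) {Y : Set (Moduli K L)} (ν : CoOrientation Y)
    (bd : Set (Moduli K L)) (d : ℤ) : Prop :=
  HasDegree ν bd (IsForget i) (boundary _ _) (IsVertical o i) d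

/-- The degree of `Y` with respect to the codimension one stratum of type `(A, B)`. -/
def HasDegreeStratum (o : L) (A : Set K) (B : Set L) {Y : Set (Moduli K L)} (ν : CoOrientation Y)
    (bd : Set (Moduli K L)) (d : ℤ) : Prop :=
  HasDegree ν bd (fun u y => u ∈ closure (stratum A B) ∧ IsForgetNode A B u y)
    (targetBoundary A B) (IsVerticalNode o A B) d

variable (K L) in
/-- A smoothly embedded closed path (compact interval). -/
structure EmbeddedPath where
  path : ℝ → Moduli K L
  smooth : ContDiffOn ℝ ∞ (fun t => emb (path t)) (Set.Icc 0 1)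
  injOn : Set.InjOn (fun t => emb (path t)) (Set.Icc 0 1)
  immersion : ∀ t ∈ Set.Icc (0 : ℝ) 1,
    derivWithin (fun t => emb (path t)) (Set.Icc 0 1) t ≠ 0

/-- The image of the path. -/
def EmbeddedPath.carrier (Y : EmbeddedPath K L) : Set (Moduli K L) := Y.path '' Set.Icc 0 1

/-- The two endpoints. -/
def EmbeddedPath.bd (Y : EmbeddedPath K L) : Set (Moduli K L) := {Y.path 0, Y.path 1}

/-- `n` is the outer normal vector of the path at its endpoint `P`. -/
def EmbeddedPath.IsOuterNormal (Y : EmbeddedPath K L) (P : Moduli K L) (n : Ambient K L) : Prop :=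
  (P = Y.path 0 ∧ n = - derivWithin (fun t => emb (Y.path t)) (Set.Icc 0 1) 0) ∨
  (P = Y.path 1 ∧ n = derivWithin (fun t => emb (Y.path t)) (Set.Icc 0 1) 1)

end Paths

/-! ### The points `P⁺` and `P⁻` of the moduli space of curves with one real point and two pairs -/

/-- The three-component curve on which `z_1⁺` and `z_2⁺` (if `b = true`) or `z_1⁺` and `z_2⁻`
(if `b = false`) lie on the same component. -/
def IsP (b : Bool) (P : Moduli (Fin 1) (Fin 2)) : Prop :=
  ∃ (T : RealTree) (μ : Marking T (Fin 1) (Fin 2)), Moduli.mk T μ = P ∧ T.n = 3 ∧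
    μ.comp (Sum.inr (0, true)) = μ.comp (Sum.inr (1, b))

/-- `m` is the smooth curve with `x_1 = 1`, `z_1⁺ = 0`, `z_1⁻ = ∞`, the point of the second pair
with sign `b` at `ζ`, and the other point of this pair at the reflection of `ζ` in the unit
circle. -/
def IsSmoothing (b : Bool) (ζ : ℂ) (m : Moduli (Fin 1) (Fin 2)) : Prop :=
  ∃ (T : RealTree) (μ : Marking T (Fin 1) (Fin 2)), Moduli.mk T μ = m ∧ T.n = 1 ∧
    μ.pos (Sum.inl 0) = ((1 : ℂ) : P1) ∧
    μ.pos (Sum.inr (0, true)) = ((0 : ℂ) : P1) ∧ μ.pos (Sum.inr (0, false)) = OnePoint.infty ∧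
    μ.pos (Sum.inr (1, b)) = (ζ : P1) ∧
    μ.pos (Sum.inr (1, !b)) = (((starRingEnd ℂ ζ)⁻¹ : ℂ) : P1)

/-- `(d₁, d₂)` is a basis of the tangent space at `P` (one of `P⁺`, `P⁻`, according to `b`),
positive for its complex orientation.  A neighbourhood of `P` consists of the conjugate smoothings
of the two nodes.  In the coordinate `u` with `x_1 = 1` and the nodes at `0` and `∞` on the real
component, and the coordinate `y` with `z_1⁺ = 0`, the node at `∞` and the point of the second pair
at `1` on the component with `z_1⁺`, the smoothing `u = ζ y` with complex parameter `ζ` is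
the curve described by `IsSmoothing b ζ`; the basis is the derivative in the
directions `1` and `𝕚` of this family. -/
def IsComplexFrame (b : Bool) (P : Moduli (Fin 1) (Fin 2))
    (d₁ d₂ : Ambient (Fin 1) (Fin 2)) : Prop :=
  ∃ (δ : ℂ → Moduli (Fin 1) (Fin 2)) (D : ℂ →L[ℝ] Ambient (Fin 1) (Fin 2)),
    δ 0 = P ∧ (∀ᶠ ζ in nhdsWithin (0 : ℂ) {0}ᶜ, IsSmoothing b ζ (δ ζ)) ∧
    HasFDerivAt (fun ζ => emb (δ ζ)) D 0 ∧ LinearIndependent ℝ ![D 1, D Complex.I] ∧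
    d₁ = D 1 ∧ d₂ = D Complex.I

/-- At the endpoint `P` of `Y`, the co-orientation of `P` given by the outer normal of `P` in `Y`
followed by the co-orientation of `Y` is the complex orientation of the tangent space at `P`. -/
def BoundaryAgrees (Y : EmbeddedPath (Fin 1) (Fin 2)) (ν : CoOrientation Y.carrier)
    (b : Bool) (P : Moduli (Fin 1) (Fin 2)) : Prop :=
  ∃ n d₁ d₂, Y.IsOuterNormal P n ∧ IsComplexFrame b P d₁ d₂ ∧
    ∃ a₁ a₂ b₁ b₂ : ℝ, n = a₁ • d₁ + a₂ • d₂ ∧ ν.normal P = b₁ • d₁ + b₂ • d₂ ∧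
      0 < a₁ * b₂ - a₂ * b₁

end RealDM

end

open RealDM

/-! Put $z_1^+$, $z_1^-$, $x_1$ at $0$, $1$, $\infty$. The involution becomes $z\mapsto 1-\bar z$,
so a curve is described by the position $w$ of $z_2^+$, with $z_2^-$ at $1-\bar w$. Every
$w\in\mathbb C$ occurs, while $w=\infty$ on $\overline S_1$. The points $P^+$ and $P^-$ have
coordinates $0$ and $1$, and $\overline S_2$ lies over the line $w=1-\bar w$, that is,
$\operatorname{Re} w=1/2$. The path is the segment $[0,1]$ in this chart, co-oriented by $-i$. It
misses $w=\infty$ and crosses $\overline S_2$ once, transversely, at $w=1/2$.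

After $x_1$ is forgotten, the four points $0,t,1,1-t$ have the cross-ratio $((1-t)/t)^2$, which is
strictly monotone. The segment therefore meets each fiber over a curve off the boundary exactly
once, and its endpoints go to the boundary. Over $S_2$ the target is a point, so each degree is the
sign of a single point.

For the signs, put $z_1^+=0$, $z_1^-=\infty$. If $x_1=e^{i\theta}$ rotates and $z_2^+=s$ is fixed,
then $w=s/(s-e^{i\theta})$ and $dw/d\theta=i\,w(w-1)$ at $\theta=0$. At $w=t$ this is a positive
multiple of $-i$, which gives $+1$. If the node $e^{i\theta}$ rotates and $x_1=s$ is fixed, then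
$w=e^{i\theta}/(e^{i\theta}-s)$ and the derivative is $-i\,w(w-1)$. At $w=1/2$ this is $i/4$, which
gives $-1$. The smoothing with parameter $\zeta$ has $w=\zeta/(\zeta-1)\approx-\zeta$ at $P^+$ and
$w=1/(1-\bar\zeta)\approx 1+\bar\zeta$ at $P^-$. The complex frames are thus $(-1,-i)$ and $(1,-i)$,
that is, the outer normal followed by $-i$ in both cases.

Most of the work relates the definitions to the coordinate. `Marking.crossRatio_mk_iff` and
`Marking.crossRatio_eq_pt` compute cross-ratios on a representative, `HasCoord.crossRatio` expresses
all of them through $w$, and `tangentCone_subset` identifies tangent vectors with vectors in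
$\mathbb C$. Injectivity of `emb` is not needed in general: only the uniqueness of the curve with
$w=1/2$ is used (`HasCoord.eq_of_half`). The bijection with the fibers of the forgetful map comes
from `exists_position_of_notMem_boundary` and `coord_unique_of_isForget`. -/

noncomputable section

namespace RealDM

/-! ### Homogeneous coordinates on the Riemann sphere -/

/-- The point of the Riemann sphere with homogeneous coordinates `p`. -/
def pt (p : ℂ × ℂ) : P1 := if p.2 = 0 then OnePoint.infty else ((p.1 / p.2 : ℂ) : P1)

/-- The determinant of two vectors. -/
def det2 (p q : ℂ × ℂ) : ℂ := p.1 * q.2 - p.2 * q.1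

/-- The cross-ratio in homogeneous coordinates: the coordinate of `d` when `a`, `b`, `c` are
`0`, `1`, `∞`. -/
def cr (a b c d : ℂ × ℂ) : ℂ × ℂ := (det2 d a * det2 b c, det2 d c * det2 b a)

theorem det2_swap (p q : ℂ × ℂ) : det2 p q = - det2 q p := by simp only [det2]; ring

theorem det2_swap_eq_zero {p q : ℂ × ℂ} : det2 p q = 0 ↔ det2 q p = 0 := by
  rw [det2_swap, neg_eq_zero]

theorem exists_pt (z : P1) : ∃ p : ℂ × ℂ, p ≠ 0 ∧ pt p = z := by
  induction z using OnePoint.rec with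
  | infty => exact ⟨(1, 0), by simp, by simp [pt]⟩
  | coe z => exact ⟨(z, 1), by simp, by simp [pt]⟩

theorem pt_coe (z : ℂ) : pt (z, 1) = (z : P1) := by simp [pt]

theorem pt_zero {a : ℂ} (h : a ≠ 0) : pt (0, a) = ((0 : ℂ) : P1) := by simp [pt, h]

theorem pt_infty (a : ℂ) : pt (a, 0) = OnePoint.infty := by simp [pt]

theorem pt_self {a : ℂ} (h : a ≠ 0) : pt (a, a) = ((1 : ℂ) : P1) := by simp [pt, h]

theorem pt_eq_iff {p q : ℂ × ℂ} (hp : p ≠ 0) (hq : q ≠ 0) : pt p = pt q ↔ det2 p q = 0 := by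
  obtain ⟨a, b⟩ := p
  obtain ⟨c, d⟩ := q
  by_cases hb : b = 0 <;> by_cases hd : d = 0
  · simp [pt, det2, hb, hd]
  · have : a ≠ 0 := by rintro rfl; simp [hb] at hp
    simp [pt, det2, hb, hd, this]
  · have : c ≠ 0 := by rintro rfl; simp [hd] at hq
    simp [pt, det2, hb, hd, this]
  · simp only [pt, det2, hb, hd, if_false, OnePoint.coe_eq_coe, div_eq_div_iff hb hd]
    rw [sub_eq_zero, mul_comm b c]

theorem pt_smul_eq {p : ℂ × ℂ} {k : ℂ} (hk : k ≠ 0) : pt (k • p) = pt p := by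
  by_cases h : p.2 = 0 <;> simp [pt, h, hk, mul_div_mul_left]

theorem smul_pt (g : GL (Fin 2) ℂ) {p : ℂ × ℂ} (hp : p ≠ 0) :
    g • pt p = pt (g 0 0 * p.1 + g 0 1 * p.2, g 1 0 * p.1 + g 1 1 * p.2) := by
  obtain ⟨a, b⟩ := p
  by_cases hb : b = 0
  · have ha : a ≠ 0 := by rintro rfl; simp [hb] at hp
    simp only [hb, pt_infty, OnePoint.smul_infty_eq_ite, mul_zero, add_zero]
    by_cases h : g 1 0 = 0
    · simp [pt, h]
    · simp [pt, h, ha, mul_div_mul_right]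
  · have e : g 1 0 * (a / b) + g 1 1 = (g 1 0 * a + g 1 1 * b) / b := by field_simp
    have e' : g 0 0 * (a / b) + g 0 1 = (g 0 0 * a + g 0 1 * b) / b := by field_simp
    simp only [pt, hb, if_false, OnePoint.smul_some_eq_ite, e, e', div_eq_zero_iff, or_false]
    split_ifs with h
    · rfl
    · rw [div_div_div_cancel_right₀ hb]

theorem exists_gl_of_det_ne_zero {a b c d : ℂ} (h : a * d - b * c ≠ 0) :
    ∃ g : GL (Fin 2) ℂ, ∀ p : ℂ × ℂ, p ≠ 0 → g • pt p = pt (a * p.1 + b * p.2, c * p.1 + d * p.2) := by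
  refine ⟨Matrix.GeneralLinearGroup.mkOfDetNeZero !![a, b; c, d]
    (by rwa [Matrix.det_fin_two_of]), fun p hp => ?_⟩
  rw [smul_pt _ hp]
  simp [Matrix.GeneralLinearGroup.mkOfDetNeZero]

/-- The expression `cr a b c d` is linear in `d`, and the determinant of this linear map is the
product of the three pairwise determinants of `a`, `b`, `c`. -/
theorem exists_gl_cr {a b c : ℂ × ℂ} (hab : det2 b a ≠ 0) (hbc : det2 b c ≠ 0)
    (hac : det2 a c ≠ 0) : ∃ g : GL (Fin 2) ℂ, ∀ d : ℂ × ℂ, d ≠ 0 → g • pt d = pt (cr a b c d) := by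
  obtain ⟨g, hg⟩ := exists_gl_of_det_ne_zero (a := a.2 * det2 b c) (b := - a.1 * det2 b c)
    (c := c.2 * det2 b a) (d := - c.1 * det2 b a) (by
      have : a.2 * det2 b c * (- c.1 * det2 b a) - (- a.1 * det2 b c) * (c.2 * det2 b a) =
        det2 b c * det2 b a * det2 a c := by simp only [det2]; ring
      rw [this]; exact mul_ne_zero (mul_ne_zero hbc hab) hac)
  refine ⟨g, fun d hd => ?_⟩
  rw [hg d hd]
  congr 1
  ext <;> simp only [cr, det2] <;> ring

/-- Three distinct points can be moved to `0`, `1`, `∞`. -/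
theorem exists_gl_zero_one_infty {a b c : P1} (hab : a ≠ b) (hac : a ≠ c) (hbc : b ≠ c) :
    ∃ g : GL (Fin 2) ℂ, g • a = ((0 : ℂ) : P1) ∧ g • b = ((1 : ℂ) : P1) ∧ g • c = OnePoint.infty := by
  obtain ⟨p, hp, rfl⟩ := exists_pt a
  obtain ⟨q, hq, rfl⟩ := exists_pt b
  obtain ⟨r, hr, rfl⟩ := exists_pt c
  rw [Ne, pt_eq_iff (by assumption) (by assumption)] at hab hac hbc
  have hba : det2 q p ≠ 0 := fun h => hab (det2_swap_eq_zero.1 h)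
  obtain ⟨g, hg⟩ := exists_gl_cr hba hbc hac
  refine ⟨g, ?_, ?_, ?_⟩
  · rw [hg p hp, show cr p q r p = (0, det2 p r * det2 q p) by simp [cr, det2, mul_comm]]
    exact pt_zero (mul_ne_zero hac hba)
  · rw [hg q hq, show cr p q r q = (det2 q p * det2 q r, det2 q p * det2 q r) by
      simp [cr, mul_comm]]
    exact pt_self (mul_ne_zero hba hbc)
  · rw [hg r hr, show cr p q r r = (det2 r p * det2 q r, 0) by simp [cr, det2, mul_comm]]
    exact pt_infty _

theorem smul_eq_self_of_zero_one_infty {g : GL (Fin 2) ℂ}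
    (h0 : g • ((0 : ℂ) : P1) = ((0 : ℂ) : P1)) (h1 : g • ((1 : ℂ) : P1) = ((1 : ℂ) : P1))
    (h2 : g • (OnePoint.infty : P1) = OnePoint.infty) (z : P1) : g • z = z := by
  have hd := g.det_ne_zero
  rw [Matrix.det_fin_two] at hd
  rw [OnePoint.smul_infty_eq_self_iff] at h2
  have h11 : g 1 1 ≠ 0 := by rintro h; simp [h, h2] at hd
  rw [OnePoint.smul_some_eq_ite] at h0 h1
  simp only [h2, mul_zero, zero_add, h11, if_false, OnePoint.coe_eq_coe, div_eq_zero_iff,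
    or_false, mul_one] at h0 h1
  rw [h0, add_zero, div_eq_one_iff_eq h11] at h1
  obtain ⟨p, hp, rfl⟩ := exists_pt z
  rw [smul_pt _ hp, h2, h0, h1]
  rw [zero_mul, add_zero, zero_mul, zero_add]
  exact pt_smul_eq (p := p) h11

/-- Möbius transformations which agree at three points are equal. -/
theorem smul_eq_smul_of_three {g h : GL (Fin 2) ℂ} {a b c : P1} (hab : a ≠ b) (hac : a ≠ c)
    (hbc : b ≠ c) (ha : g • a = h • a) (hb : g • b = h • b) (hc : g • c = h • c) (z : P1) :
    g • z = h • z := by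
  obtain ⟨k, k0, k1, k2⟩ := exists_gl_zero_one_infty hab hac hbc
  rw [← eq_inv_smul_iff] at k0 k1 k2
  -- Conjugating $h^{-1}g$ by $k$ moves its three fixed points to $0$, $1$, $\infty$, where
  -- triviality can be read off the matrix.
  have key : ∀ {u v : P1}, u = k⁻¹ • v → g • u = h • u → (k * (h⁻¹ * g) * k⁻¹) • v = v := by
    rintro u v rfl e
    rw [mul_smul, mul_smul, mul_smul, e, inv_smul_smul, smul_inv_smul]
  have := smul_eq_self_of_zero_one_infty (key k0 ha) (key k1 hb) (key k2 hc) (k • z)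
  rw [mul_smul, inv_smul_smul, mul_smul, smul_left_cancel_iff, mul_smul, inv_smul_eq_iff] at this
  exact this

/-! ### Anti-holomorphic automorphisms of the sphere -/

theorem P1.conj_smul (g : GL (Fin 2) ℂ) (z : P1) :
    P1.conj (g • z) = (g.map (starRingEnd ℂ)) • P1.conj z := OnePoint.map_smul _ g z

@[simp] theorem P1.conj_conj (z : P1) : P1.conj (P1.conj z) = z := by
  induction z using OnePoint.rec with
  | infty => rfl
  | coe z => simp [P1.conj]

@[simp] theorem P1.conj_infty : P1.conj OnePoint.infty = OnePoint.infty := rfl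

@[simp] theorem P1.conj_coe (z : ℂ) : P1.conj (z : P1) = ((starRingEnd ℂ z : ℂ) : P1) := rfl

theorem P1.conj_injective : Function.Injective P1.conj :=
  Function.LeftInverse.injective P1.conj_conj

/-- Anti-holomorphic automorphisms of the sphere. -/
def IsAnti (s : P1 → P1) : Prop := ∃ g : GL (Fin 2) ℂ, ∀ z, s z = g • P1.conj z

theorem IsAnti.smul {s : P1 → P1} (h : IsAnti s) (g k : GL (Fin 2) ℂ) :
    IsAnti fun z => g • s (k • z) := by
  obtain ⟨a, ha⟩ := h
  exact ⟨g * a * k.map (starRingEnd ℂ), fun z => by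
    simp only [ha, P1.conj_smul, mul_smul]⟩

/-- Both maps are Möbius transformations after conjugation, so three-point rigidity applies. Every
identification of an involution with an explicit reflection below rests on this. -/
theorem IsAnti.eq_of_three {s t : P1 → P1} (hs : IsAnti s) (ht : IsAnti t) {a b c : P1}
    (hab : a ≠ b) (hac : a ≠ c) (hbc : b ≠ c) (ha : s a = t a) (hb : s b = t b) (hc : s c = t c)
    (z : P1) : s z = t z := by
  obtain ⟨g, hg⟩ := hs
  obtain ⟨h, hh⟩ := ht
  rw [hg, hh] at *
  exact smul_eq_smul_of_three (P1.conj_injective.ne hab) (P1.conj_injective.ne hac)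
    (P1.conj_injective.ne hbc) ha hb hc _

/-- The reflection `z ↦ a / conj z`. -/
theorem exists_anti_div {a : ℂ} (ha : a ≠ 0) :
    ∃ g : GL (Fin 2) ℂ, ∀ p : ℂ × ℂ, p ≠ 0 →
      g • P1.conj (pt p) = pt (a * starRingEnd ℂ p.2, starRingEnd ℂ p.1) := by
  obtain ⟨g, hg⟩ := exists_gl_of_det_ne_zero (a := 0) (b := a) (c := 1) (d := 0) (by simpa)
  refine ⟨g, fun p hp => ?_⟩
  have : P1.conj (pt p) = pt (starRingEnd ℂ p.1, starRingEnd ℂ p.2) := by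
    by_cases h : p.2 = 0 <;> simp [pt, h]
  rw [this, hg]
  · simp
  · intro h
    rw [Prod.mk_eq_zero, map_eq_zero, map_eq_zero] at h
    exact hp (Prod.ext h.1 h.2)

/-- The reflection `z ↦ 1 - conj z`. -/
theorem exists_anti_one_sub :
    ∃ g : GL (Fin 2) ℂ, g • P1.conj OnePoint.infty = OnePoint.infty ∧
      ∀ z : ℂ, g • P1.conj z = ((1 - starRingEnd ℂ z : ℂ) : P1) := by
  obtain ⟨g, hg⟩ := exists_gl_of_det_ne_zero (a := -1) (b := 1) (c := 0) (d := 1) (by simp)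
  refine ⟨g, ?_, fun z => ?_⟩
  · have := hg (1, 0) (by simp)
    simpa [pt] using this
  · rw [P1.conj_coe, ← pt_coe, hg _ (by simp)]
    simp [pt]
    ring

/-! ### The round sphere in homogeneous coordinates -/

/-- The point of the round sphere with homogeneous coordinates `p`. -/
def roundSphere (p : ℂ × ℂ) : ℂ × ℝ :=
  (((2 / (Complex.normSq p.1 + Complex.normSq p.2) : ℝ) : ℂ) * (p.1 * starRingEnd ℂ p.2),
    (Complex.normSq p.1 - Complex.normSq p.2) / (Complex.normSq p.1 + Complex.normSq p.2))

theorem sphere_infty : sphere OnePoint.infty = (0, 1) := rfl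

theorem sphere_coe (z : ℂ) : sphere (z : P1) =
    (((2 / (‖z‖ ^ 2 + 1) : ℝ) : ℂ) * z, (‖z‖ ^ 2 - 1) / (‖z‖ ^ 2 + 1)) := rfl

/-- Homogeneous coordinates remove the case distinction at $\infty$, so that smoothness in
parameters can be checked by a single formula. -/
theorem sphere_pt {p : ℂ × ℂ} (hp : p ≠ 0) : sphere (pt p) = roundSphere p := by
  obtain ⟨a, b⟩ := p
  by_cases hb : b = 0
  · have ha : a ≠ 0 := by rintro rfl; simp [hb] at hp
    have : Complex.normSq a ≠ 0 := by simpa using ha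
    simp [hb, pt_infty, sphere_infty, roundSphere, this]
  · have hb' : Complex.normSq b ≠ 0 := by simpa using hb
    have hpos : 0 < Complex.normSq b := Complex.normSq_pos.2 hb
    have hs : Complex.normSq a + Complex.normSq b ≠ 0 := by
      have := Complex.normSq_nonneg a; positivity
    simp only [pt, hb, if_false, sphere_coe, roundSphere, ← Complex.normSq_eq_norm_sq, Complex.normSq_div]
    ext1
    · have e : a / b = a * starRingEnd ℂ b / (Complex.normSq b : ℝ) := by
        rw [Complex.normSq_eq_conj_mul_self, mul_comm (starRingEnd ℂ b), mul_div_mul_right]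
        simpa using hb
      have hs' : (Complex.normSq a + Complex.normSq b : ℂ) ≠ 0 := by exact_mod_cast hs
      have hb'' : (Complex.normSq b : ℂ) ≠ 0 := by exact_mod_cast hb'
      simp only [e]
      push_cast
      field_simp
    · simp only
      field_simp

theorem sphere_snd_eq_one_iff (z : P1) : (sphere z).2 = 1 ↔ z = OnePoint.infty := by
  induction z using OnePoint.rec with
  | infty => simp [sphere_infty]
  | coe z =>
    simp only [sphere_coe, OnePoint.coe_ne_infty, iff_false]
    have : ‖z‖ ^ 2 + 1 ≠ 0 := by positivity
    rw [div_eq_one_iff_eq this]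
    intro h
    linarith

theorem stereographic_sphere (z : ℂ) :
    (sphere (z : P1)).1 / ((1 - (sphere (z : P1)).2 : ℝ) : ℂ) = z := by
  have h : ‖z‖ ^ 2 + 1 ≠ 0 := by positivity
  have h' : ((‖z‖ : ℂ) ^ 2 + 1) ≠ 0 := by exact_mod_cast h
  have e : (1 - (‖z‖ ^ 2 - 1) / (‖z‖ ^ 2 + 1) : ℝ) = 2 / (‖z‖ ^ 2 + 1) := by
    field_simp; ring
  rw [sphere_coe]
  simp only [e]
  push_cast
  field_simp

theorem sphere_injective : Function.Injective sphere := by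
  intro z w h
  by_cases hz : z = OnePoint.infty
  · rw [hz] at h ⊢
    rw [eq_comm, ← sphere_snd_eq_one_iff, ← h, sphere_infty]
  · have hw : w ≠ OnePoint.infty := by
      rwa [Ne, ← sphere_snd_eq_one_iff, ← h, sphere_snd_eq_one_iff]
    obtain ⟨z, rfl⟩ := OnePoint.ne_infty_iff_exists.1 hz
    obtain ⟨w, rfl⟩ := OnePoint.ne_infty_iff_exists.1 hw
    rw [← stereographic_sphere z, h, stereographic_sphere]

theorem contDiffOn_roundSphere : ContDiffOn ℝ ∞ roundSphere {0}ᶜ := by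
  have hn : ContDiff ℝ ∞ Complex.normSq := by
    have : (Complex.normSq : ℂ → ℝ) = fun z => ‖z‖ ^ 2 := by
      ext z; exact Complex.normSq_eq_norm_sq z
    rw [this]
    exact contDiff_norm_sq ℝ
  have hne : ∀ p ∈ ({0}ᶜ : Set (ℂ × ℂ)), Complex.normSq p.1 + Complex.normSq p.2 ≠ 0 := by
    rintro ⟨a, b⟩ hp h
    have h1 := Complex.normSq_nonneg a
    have h2 := Complex.normSq_nonneg b
    simp only at h
    have ha : a = 0 := Complex.normSq_eq_zero.1 (by linarith)
    have hb : b = 0 := Complex.normSq_eq_zero.1 (by linarith)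
    simp [ha, hb] at hp
  have h1 : ContDiff ℝ ∞ fun p : ℂ × ℂ => Complex.normSq p.1 := hn.comp contDiff_fst
  have h2 : ContDiff ℝ ∞ fun p : ℂ × ℂ => Complex.normSq p.2 := hn.comp contDiff_snd
  refine ContDiffOn.prodMk (ContDiffOn.mul ?_ ?_) ?_
  · exact Complex.ofRealCLM.contDiff.comp_contDiffOn
      (contDiffOn_const.div (h1.add h2).contDiffOn hne)
  · exact (contDiff_fst.mul (Complex.conjCLE.contDiff.comp contDiff_snd)).contDiffOn
  · exact (h1.sub h2).contDiffOn.div (h1.add h2).contDiffOn hne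

/-! ### Branches of a tree of spheres -/

namespace RealTree

variable (T : RealTree)

/-- `u` and `w` are joined by a walk which avoids `v`. -/
def Avoid (v u w : Fin T.n) : Prop :=
  Relation.ReflTransGen (fun a b => T.graph.Adj a b ∧ a ≠ v ∧ b ≠ v) u w

variable {T}

/-- The axiom `dir_branch` only compares adjacent components; it propagates along walks avoiding
`v`, so `dir v` is constant on the branches at `v`. -/
theorem Avoid.dir_eq {v u w : Fin T.n} (h : T.Avoid v u w) : T.dir v u = T.dir v w := by
  induction h with
  | refl => rfl
  | tail _ h ih => exact ih.trans (T.dir_branch _ _ _ h.1 h.2.1 h.2.2)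

theorem exists_adj_avoid {v u : Fin T.n} (h : u ≠ v) : ∃ w, T.graph.Adj v w ∧ T.Avoid v w u := by
  have hr : Relation.ReflTransGen T.graph.Adj v u :=
    (SimpleGraph.reachable_iff_reflTransGen _ _).1 (T.isTree.1.preconnected v u)
  have key : u = v ∨ ∃ w, T.graph.Adj v w ∧ T.Avoid v w u := by
    clear h
    induction hr with
    | refl => exact Or.inl rfl
    | @tail b c _ hbc ih =>
      by_cases hc : c = v
      · exact Or.inl hc
      by_cases hb : b = v
      · subst hb
        exact Or.inr ⟨c, hbc, .refl⟩
      obtain ⟨w, hw, hwb⟩ := ih.resolve_left hb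
      exact Or.inr ⟨w, hw, hwb.tail ⟨hbc, hb, hc⟩⟩
  exact key.resolve_left h

theorem exists_adj_dir {v u : Fin T.n} (h : u ≠ v) :
    ∃ w, T.graph.Adj v w ∧ T.dir v u = T.dir v w := by
  obtain ⟨w, hw, ha⟩ := exists_adj_avoid h
  exact ⟨w, hw, ha.dir_eq.symm⟩

theorem avoid_of_dir_eq {v w u : Fin T.n} (hw : T.graph.Adj v w) (hu : u ≠ v)
    (h : T.dir v u = T.dir v w) : T.Avoid v w u := by
  obtain ⟨w', hw', ha⟩ := exists_adj_avoid hu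
  rwa [T.dir_inj v w w' hw hw' (h.symm.trans ha.dir_eq.symm)]

/-- A walk from a neighbor of `v` to `u` stays in a branch at `v` that does not contain `v'`. Hence
it avoids `v'`, and from `v'` the whole branch lies in the direction of `v`. -/
theorem dir_of_dir_ne {v v' u : Fin T.n} (hv : v ≠ v') (hu : u ≠ v) (h : T.dir v u ≠ T.dir v v') :
    u ≠ v' ∧ T.dir v' u = T.dir v' v := by
  refine ⟨fun e => h (e ▸ rfl), ?_⟩
  obtain ⟨w, hw, ha⟩ := exists_adj_avoid hu
  have hdw : T.dir v w ≠ T.dir v v' := ha.dir_eq ▸ h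
  have key : T.Avoid v' w u := by
    clear h hu
    induction ha with
    | refl => exact .refl
    | @tail b c hb hbc ih =>
      have e1 : T.dir v w = T.dir v b := Avoid.dir_eq hb
      have e2 : T.dir v w = T.dir v c := e1.trans (T.dir_branch _ _ _ hbc.1 hbc.2.1 hbc.2.2)
      exact ih.tail ⟨hbc.1, fun e => hdw (e1.trans (e ▸ rfl)), fun e => hdw (e2.trans (e ▸ rfl))⟩
  rw [← key.dir_eq]
  exact (T.dir_branch _ _ _ hw hv fun e => hdw (e ▸ rfl)).symm

/-- A walk from `w` to `u` avoiding `v` leaves `w` for the last time through a neighbor other than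
`v`, and distinct neighbors correspond to distinct nodes. -/
theorem dir_ne_of_dir_eq {v w u : Fin T.n} (hw : T.graph.Adj v w) (hv : u ≠ v) (hu : u ≠ w)
    (h : T.dir v u = T.dir v w) : T.dir w u ≠ T.dir w v := by
  have ha := avoid_of_dir_eq hw hv h
  have key : u = w ∨ ∃ a, T.graph.Adj w a ∧ a ≠ v ∧ T.Avoid w a u := by
    clear hv hu h
    induction ha with
    | refl => exact Or.inl rfl
    | @tail b c _ hbc ih =>
      by_cases hc : c = w
      · exact Or.inl hc
      by_cases hb : b = w
      · subst hb
        exact Or.inr ⟨c, hbc.1, hbc.2.2, .refl⟩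
      obtain ⟨a, h1, h2, h3⟩ := ih.resolve_left hb
      exact Or.inr ⟨a, h1, h2, h3.tail ⟨hbc.1, hb, hc⟩⟩
  obtain ⟨a, h1, h2, h3⟩ := key.resolve_left hu
  intro e
  exact h2 (T.dir_inj w a v h1 hw.symm (h3.dir_eq.trans e))

theorem dir_ne_of_adj {v u w : Fin T.n} (hu : T.graph.Adj v u) (hw : T.graph.Adj v w)
    (h : u ≠ w) : T.dir v u ≠ T.dir v w := fun e => h (T.dir_inj _ _ _ hu hw e)

/-- The components beyond the node of `v` leading to `w`. -/
def branch (v w : Fin T.n) : Set (Fin T.n) := {u | u ≠ v ∧ T.dir v u = T.dir v w}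

/-- The size of a branch is the measure for the inductions that walk outward in the tree: the next
branch is contained in the previous one and loses `w`. -/
theorem branch_ncard_lt {v w u : Fin T.n} (hw : T.graph.Adj v w) (hu : T.graph.Adj w u)
    (huv : u ≠ v) : (branch w u).ncard < (branch v w).ncard := by
  refine Set.ncard_lt_ncard ⟨?_, fun h => ?_⟩ (Set.toFinite _)
  · rintro x ⟨hx, hd⟩
    exact dir_of_dir_ne hw.ne' hx (hd ▸ dir_ne_of_adj hu hw.symm huv)
  · exact (h (show w ∈ branch v w from ⟨hw.ne', rfl⟩)).1 rfl

theorem inv_injective : Function.Injective T.inv :=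
  Function.LeftInverse.injective T.inv_inv

theorem sig_dir_of_ne {v u : Fin T.n} (h : u ≠ v) :
    T.sig v (T.dir v u) = T.dir (T.inv v) (T.inv u) := by
  obtain ⟨w, hw, ha⟩ := exists_adj_avoid h
  have : T.Avoid (T.inv v) (T.inv w) (T.inv u) :=
    Relation.ReflTransGen.lift T.inv (fun a b hab => ⟨T.inv_adj _ _ hab.1,
      inv_injective.ne hab.2.1, inv_injective.ne hab.2.2⟩) _ _ ha
  rw [← this.dir_eq, ← ha.dir_eq, T.sig_dir _ _ hw]

/-- A set of components which is closed under adjacency contains all of them. -/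
theorem forall_of_adj {P : Fin T.n → Prop} {v : Fin T.n} (hv : P v)
    (h : ∀ a b, P a → T.graph.Adj a b → P b) (u : Fin T.n) : P u := by
  have hr : Relation.ReflTransGen T.graph.Adj v u :=
    (SimpleGraph.reachable_iff_reflTransGen _ _).1 (T.isTree.1.preconnected v u)
  induction hr with
  | refl => exact hv
  | tail _ hbc ih => exact h _ _ ih hbc

end RealTree

/-! ### Marked points seen from a component -/

namespace Marking

open RealTree

variable {T : RealTree} {K L : Type} (μ : Marking T K L)

theorem seen_of_comp_eq {v : Fin T.n} {i : Mark K L} (h : μ.comp i = v) : μ.seen v i = μ.pos i :=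
  if_pos h

theorem seen_of_comp_ne {v : Fin T.n} {i : Mark K L} (h : μ.comp i ≠ v) :
    μ.seen v i = T.dir v (μ.comp i) := if_neg h

/-- The basic dichotomy for two components: a marked point is seen from `v` in the direction of
`v'`, or from `v'` in the direction of `v`. -/
theorem seen_of_seen_ne {v v' : Fin T.n} {i : Mark K L} (hv : v ≠ v')
    (h : μ.seen v i ≠ T.dir v v') : μ.seen v' i = T.dir v' v := by
  by_cases hc : μ.comp i = v
  · rw [μ.seen_of_comp_ne (hc ▸ hv), hc]
  · rw [μ.seen_of_comp_ne hc] at h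
    obtain ⟨h1, h2⟩ := dir_of_dir_ne hv hc h
    rw [μ.seen_of_comp_ne h1, h2]

theorem comp_ne_of_seen_eq_dir {v w : Fin T.n} {i : Mark K L} (hw : T.graph.Adj v w)
    (h : μ.seen v i = T.dir v w) : μ.comp i ≠ v := by
  rintro rfl
  rw [μ.seen_of_comp_eq rfl] at h
  exact μ.pos_ne_node i w hw h

theorem seen_ne_of_seen_eq {v w : Fin T.n} {i : Mark K L} (hw : T.graph.Adj v w)
    (h : μ.seen v i = T.dir v w) : μ.seen w i ≠ T.dir w v := by
  have hc := μ.comp_ne_of_seen_eq_dir hw h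
  rw [μ.seen_of_comp_ne hc] at h
  intro e
  have hc' := μ.comp_ne_of_seen_eq_dir hw.symm e
  rw [μ.seen_of_comp_ne hc'] at e
  exact dir_ne_of_dir_eq hw hc hc' h e

theorem exists_adj_of_comp_ne {v : Fin T.n} {i : Mark K L} (h : μ.comp i ≠ v) :
    ∃ w, T.graph.Adj v w ∧ μ.seen v i = T.dir v w := by
  rw [μ.seen_of_comp_ne h]
  exact exists_adj_dir h

theorem exists_adj_of_seen_eq {v : Fin T.n} {i j : Mark K L} (hij : i ≠ j)
    (h : μ.seen v i = μ.seen v j) : ∃ w, T.graph.Adj v w ∧ μ.seen v i = T.dir v w := by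
  by_cases hi : μ.comp i = v
  · by_cases hj : μ.comp j = v
    · rw [μ.seen_of_comp_eq hi, μ.seen_of_comp_eq hj] at h
      exact absurd (μ.pos_inj i j (hi.trans hj.symm) h) hij
    · rw [h]
      exact μ.exists_adj_of_comp_ne hj
  · exact μ.exists_adj_of_comp_ne hi

/-- A marked point on `v` is seen from `v` at a different position than any other one. -/
theorem seen_ne_of_comp_eq {v : Fin T.n} {i j : Mark K L} (h : μ.comp i = v) (hij : i ≠ j) :
    μ.seen v i ≠ μ.seen v j := by
  intro e
  obtain ⟨w, hw, hiw⟩ := μ.exists_adj_of_seen_eq hij e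
  exact μ.comp_ne_of_seen_eq_dir hw hiw h

/-- Every component has three distinct special points. -/
theorem exists_three_special (v : Fin T.n) : ∃ a b c : P1, a ≠ b ∧ a ≠ c ∧ b ≠ c ∧
    ∀ z, z = a ∨ z = b ∨ z = c →
      (∃ w, T.graph.Adj v w ∧ T.dir v w = z) ∨ ∃ i, μ.comp i = v ∧ μ.pos i = z := by
  have h := μ.stable v
  have hf := Set.finite_of_ncard_pos (lt_of_lt_of_le (by norm_num) h)
  obtain ⟨a, b, c, ha, hb, hc, hab, hac, hbc⟩ := (Set.two_lt_ncard_iff hf).1 h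
  refine ⟨a, b, c, hab, hac, hbc, ?_⟩
  rintro z (rfl | rfl | rfl) <;> assumption

/-- Beyond every node there are at least two marked points. -/
theorem exists_two_marks {v w : Fin T.n} (hw : T.graph.Adj v w) :
    ∃ i j, i ≠ j ∧ μ.seen v i = T.dir v w ∧ μ.seen v j = T.dir v w := by
  induction hN : (branch v w).ncard using Nat.strong_induction_on generalizing v w with
  | _ N ih =>
  subst hN
  -- If the tree continues past `w`, marked points beyond the next node will do. If `w` is a leaf,
  -- its only node is the one to `v`, and stability leaves two marked points on `w` itself.
  by_cases hu : ∃ u, T.graph.Adj w u ∧ u ≠ v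
  · obtain ⟨u, hu, huv⟩ := hu
    obtain ⟨i, j, hij, hi, hj⟩ := ih _ (branch_ncard_lt hw hu huv) hu rfl
    have hd := dir_ne_of_adj hu hw.symm huv
    exact ⟨i, j, hij, μ.seen_of_seen_ne hw.ne' (hi ▸ hd), μ.seen_of_seen_ne hw.ne' (hj ▸ hd)⟩
  · push Not at hu
    obtain ⟨a, b, c, hab, hac, hbc, hs⟩ := μ.exists_three_special w
    have key : ∀ z, z = a ∨ z = b ∨ z = c → z ≠ T.dir w v → ∃ i, μ.comp i = w ∧ μ.pos i = z := by
      intro z hz hne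
      refine (hs z hz).resolve_left ?_
      rintro ⟨u, hu', rfl⟩
      exact hne (by rw [hu u hu'])
    have two : ∀ z z', z ≠ z' → (∃ i, μ.comp i = w ∧ μ.pos i = z) →
        (∃ i, μ.comp i = w ∧ μ.pos i = z') →
        ∃ i j, i ≠ j ∧ μ.seen v i = T.dir v w ∧ μ.seen v j = T.dir v w := by
      rintro z z' hz ⟨i, hi, rfl⟩ ⟨j, hj, rfl⟩
      refine ⟨i, j, fun e => hz (e ▸ rfl), ?_, ?_⟩
      · rw [μ.seen_of_comp_ne (hi ▸ hw.ne'), hi]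
      · rw [μ.seen_of_comp_ne (hj ▸ hw.ne'), hj]
    by_cases ha : a = T.dir w v
    · exact two b c hbc (key b (by simp) (ha ▸ hab.symm)) (key c (by simp) (ha ▸ hac.symm))
    by_cases hb : b = T.dir w v
    · exact two a c hac (key a (by simp) ha) (key c (by simp) (hb ▸ hbc.symm))
    exact two a b hab (key a (by simp) ha) (key b (by simp) hb)

/-- A marked point seen alone in its direction lies on the component. -/
theorem comp_eq_of_seen_ne {v : Fin T.n} {i : Mark K L}
    (h : ∀ j, j ≠ i → μ.seen v j ≠ μ.seen v i) : μ.comp i = v := by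
  by_contra hc
  obtain ⟨w, hw, hi⟩ := μ.exists_adj_of_comp_ne hc
  obtain ⟨j, k, hjk, hj, hk⟩ := μ.exists_two_marks hw
  by_cases e : j = i
  · exact h k (fun e' => hjk (e.trans e'.symm)) (hk.trans hi.symm)
  · exact h j e (hj.trans hi.symm)

/-- A branch with only two marked points consists of a single component. -/
theorem eq_of_adj_of_two_marks {v w : Fin T.n} (hw : T.graph.Adj v w) {a b : Mark K L}
    (h : ∀ i, μ.seen v i = T.dir v w → i = a ∨ i = b) {u : Fin T.n} (hu : T.graph.Adj w u) :
    u = v := by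
  by_contra huv
  -- A further node of `w` would have both marked points `a` and `b` beyond it. Then `w` would carry
  -- no marked point and only two nodes, against stability.
  have beyond : ∀ x, T.graph.Adj w x → x ≠ v →
      μ.seen w a = T.dir w x ∧ μ.seen w b = T.dir w x := by
    intro x hx hxv
    obtain ⟨i, j, hij, hi, hj⟩ := μ.exists_two_marks hx
    have hd := dir_ne_of_adj hx hw.symm hxv
    have hi' := h i (μ.seen_of_seen_ne hw.ne' (hi ▸ hd))
    have hj' := h j (μ.seen_of_seen_ne hw.ne' (hj ▸ hd))
    rcases hi' with rfl | rfl <;> rcases hj' with rfl | rfl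
    · exact absurd rfl hij
    · exact ⟨hi, hj⟩
    · exact ⟨hj, hi⟩
    · exact absurd rfl hij
  obtain ⟨p, q, r, hpq, hpr, hqr, hs⟩ := μ.exists_three_special w
  have key : ∀ z, z = p ∨ z = q ∨ z = r → z = T.dir w v ∨ z = T.dir w u := by
    intro z hz
    rcases hs z hz with ⟨x, hx, rfl⟩ | ⟨i, hi, rfl⟩
    · by_cases hxv : x = v
      · exact Or.inl (hxv ▸ rfl)
      · exact Or.inr ((beyond x hx hxv).1.symm.trans (beyond u hu huv).1)
    · have : μ.seen v i = T.dir v w := by rw [μ.seen_of_comp_ne (hi ▸ hw.ne'), hi]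
      rcases h i this with rfl | rfl
      · exact absurd hi (μ.comp_ne_of_seen_eq_dir hu (beyond u hu huv).1)
      · exact absurd hi (μ.comp_ne_of_seen_eq_dir hu (beyond u hu huv).2)
  have := key p (by simp)
  have := key q (by simp)
  have := key r (by simp)
  grind

/-- The component `v` separates the marked points `i`, `j`, `k`. -/
def Separates (v : Fin T.n) (i j k : Mark K L) : Prop :=
  μ.seen v i ≠ μ.seen v j ∧ μ.seen v i ≠ μ.seen v k ∧ μ.seen v j ≠ μ.seen v k

variable {μ} in
-- By the dichotomy for `v` and `v'`, two of the three marked points would be seen at the same node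
-- from one of the two components.
theorem Separates.unique {v v' : Fin T.n} {i j k : Mark K L} (h : μ.Separates v i j k)
    (h' : μ.Separates v' i j k) : v = v' := by
  by_contra hv
  obtain ⟨h1, h2, h3⟩ := h
  obtain ⟨h1', h2', h3'⟩ := h'
  have key : ∀ a, μ.seen v a = T.dir v v' ∨ μ.seen v' a = T.dir v' v := fun a =>
    or_iff_not_imp_left.2 (μ.seen_of_seen_ne hv)
  have := key i
  have := key j
  have := key k
  grind

/-- Step into the branch containing `j` and `k`. Either they are seen apart from `w`, while `i` lies
behind, or they share a strictly smaller branch. -/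
theorem exists_separates_of_branch {i j k : Mark K L} (hjk : j ≠ k) {v w : Fin T.n}
    (hw : T.graph.Adj v w) (hi : μ.seen v i ≠ T.dir v w) (hj : μ.seen v j = T.dir v w)
    (hk : μ.seen v k = T.dir v w) : ∃ v, μ.Separates v i j k := by
  induction hN : (branch v w).ncard using Nat.strong_induction_on generalizing v w with
  | _ N ih =>
  subst hN
  have hi' := μ.seen_of_seen_ne hw.ne hi
  have hj' := μ.seen_ne_of_seen_eq hw hj
  have hk' := μ.seen_ne_of_seen_eq hw hk
  by_cases e : μ.seen w j = μ.seen w k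
  · obtain ⟨u, hu, hju⟩ := μ.exists_adj_of_seen_eq hjk e
    have huv : u ≠ v := by rintro rfl; exact hj' hju
    refine ih _ (branch_ncard_lt hw hu huv) hu ?_ hju (e ▸ hju) rfl
    rw [hi']
    exact dir_ne_of_adj hw.symm hu huv.symm
  · exact ⟨w, hi' ▸ hj'.symm, hi' ▸ hk'.symm, e⟩

theorem exists_separates {i j k : Mark K L} (hij : i ≠ j) (hik : i ≠ k) (hjk : j ≠ k) :
    ∃ v, μ.Separates v i j k := by
  have key : ∀ a, i ≠ a → μ.seen (μ.comp i) i ≠ μ.seen (μ.comp i) a := fun a ha =>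
    μ.seen_ne_of_comp_eq rfl ha
  by_cases e : μ.seen (μ.comp i) j = μ.seen (μ.comp i) k
  · obtain ⟨w, hw, hjw⟩ := μ.exists_adj_of_seen_eq hjk e
    exact μ.exists_separates_of_branch hjk hw (hjw ▸ key j hij) hjw (e ▸ hjw)
  · exact ⟨_, key j hij, key k hik, e⟩

/-! ### Compatibility of seen positions with the involution -/

theorem seen_conj (v : Fin T.n) (i : Mark K L) :
    μ.seen (T.inv v) (Mark.conj i) = T.sig v (μ.seen v i) := by
  by_cases h : μ.comp i = v
  · rw [μ.seen_of_comp_eq h, μ.seen_of_comp_eq (by rw [μ.comp_conj, h]), μ.pos_conj, h]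
  · have : μ.comp (Mark.conj i) ≠ T.inv v := by
      rw [μ.comp_conj]
      exact inv_injective.ne h
    rw [μ.seen_of_comp_ne h, μ.seen_of_comp_ne this, sig_dir_of_ne h, μ.comp_conj]

theorem sig_injective (v : Fin T.n) : Function.Injective (T.sig v) :=
  Function.LeftInverse.injective (T.sig_sig v)

variable {μ} in
theorem Separates.conj {v : Fin T.n} {i j k : Mark K L} (h : μ.Separates v i j k) :
    μ.Separates (T.inv v) (Mark.conj i) (Mark.conj j) (Mark.conj k) := by
  simp only [Separates, seen_conj]
  exact ⟨(sig_injective v).ne h.1, (sig_injective v).ne h.2.1, (sig_injective v).ne h.2.2⟩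

end Marking

/-! ### Isomorphisms and cross-ratios -/

section Iso

variable {K L : Type} {C D : Curve K L}

theorem iso_dir {f : Fin C.1.n ≃ Fin D.1.n} {g : Fin C.1.n → GL (Fin 2) ℂ}
    (h1 : ∀ v w, C.1.graph.Adj v w ↔ D.1.graph.Adj (f v) (f w))
    (h2 : ∀ v w, C.1.graph.Adj v w → D.1.dir (f v) (f w) = g v • C.1.dir v w)
    {v u : Fin C.1.n} (h : u ≠ v) : D.1.dir (f v) (f u) = g v • C.1.dir v u := by
  obtain ⟨w, hw, ha⟩ := RealTree.exists_adj_avoid h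
  have : D.1.Avoid (f v) (f w) (f u) :=
    Relation.ReflTransGen.lift f (fun a b hab => ⟨(h1 _ _).1 hab.1,
      f.injective.ne hab.2.1, f.injective.ne hab.2.2⟩) _ _ ha
  rw [← this.dir_eq, ← ha.dir_eq, h2 _ _ hw]

theorem Iso.seen (h : Iso C D) : ∃ (f : Fin C.1.n ≃ Fin D.1.n) (g : Fin C.1.n → GL (Fin 2) ℂ),
    ∀ v i, D.2.seen (f v) i = g v • C.2.seen v i := by
  obtain ⟨f, g, h1, h2, -, -, h5, h6⟩ := h
  refine ⟨f, g, fun v i => ?_⟩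
  by_cases hc : C.2.comp i = v
  · rw [C.2.seen_of_comp_eq hc, D.2.seen_of_comp_eq (by rw [h5, hc]), h6, hc]
  · rw [C.2.seen_of_comp_ne hc, D.2.seen_of_comp_ne (by rw [h5]; exact f.injective.ne hc), h5,
      iso_dir h1 h2 hc]

theorem Iso.isCrossRatio (h : Iso C D) {q : Fin 4 ↪ Mark K L} {c : P1}
    (hc : C.2.IsCrossRatio q c) : D.2.IsCrossRatio q c := by
  obtain ⟨f, g, hs⟩ := h.seen
  obtain ⟨v, k, h0, h1, h2, h3⟩ := hc
  refine ⟨f v, k * (g v)⁻¹, ?_⟩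
  simp only [hs, mul_smul, inv_smul_smul]
  exact ⟨h0, h1, h2, h3⟩

end Iso

namespace Marking

variable {T : RealTree} {K L : Type} (μ : Marking T K L)

theorem Separates.of_smul {v : Fin T.n} {i j k : Mark K L} {g : GL (Fin 2) ℂ}
    (h0 : g • μ.seen v i = ((0 : ℂ) : P1)) (h1 : g • μ.seen v j = ((1 : ℂ) : P1))
    (h2 : g • μ.seen v k = OnePoint.infty) : μ.Separates v i j k := by
  refine ⟨fun e => ?_, fun e => ?_, fun e => ?_⟩
  · rw [e, h1] at h0
    exact one_ne_zero (OnePoint.coe_injective h0)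
  · rw [e, h2] at h0
    exact OnePoint.infty_ne_coe _ h0
  · rw [e, h2] at h1
    exact OnePoint.infty_ne_coe _ h1

theorem Separates.exists_smul {v : Fin T.n} {i j k : Mark K L} (h : μ.Separates v i j k) :
    ∃ g : GL (Fin 2) ℂ, g • μ.seen v i = ((0 : ℂ) : P1) ∧ g • μ.seen v j = ((1 : ℂ) : P1) ∧
      g • μ.seen v k = OnePoint.infty := exists_gl_zero_one_infty h.1 h.2.1 h.2.2

theorem IsCrossRatio.unique {q : Fin 4 ↪ Mark K L} {c c' : P1} (h : μ.IsCrossRatio q c)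
    (h' : μ.IsCrossRatio q c') : c = c' := by
  obtain ⟨v, g, h0, h1, h2, h3⟩ := h
  obtain ⟨v', g', h0', h1', h2', h3'⟩ := h'
  have hs := Separates.of_smul μ h0 h1 h2
  obtain rfl := hs.unique (Separates.of_smul μ h0' h1' h2')
  rw [← h3, ← h3']
  exact smul_eq_smul_of_three hs.1 hs.2.1 hs.2.2 (h0.trans h0'.symm) (h1.trans h1'.symm)
    (h2.trans h2'.symm) _

theorem exists_isCrossRatio (q : Fin 4 ↪ Mark K L) : ∃ c, μ.IsCrossRatio q c := by
  obtain ⟨v, hv⟩ := μ.exists_separates (i := q 0) (j := q 1) (k := q 2)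
    (q.injective.ne (by decide)) (q.injective.ne (by decide)) (q.injective.ne (by decide))
  obtain ⟨g, h0, h1, h2⟩ := hv.exists_smul
  exact ⟨_, v, g, h0, h1, h2, rfl⟩

/-- The choice in `Moduli.crossRatio` is harmless: an admissible value exists, is invariant under
isomorphism, and is unique because the separating component and the normalizing transformation's
values are unique. -/
theorem crossRatio_mk_iff {q : Fin 4 ↪ Mark K L} {c : P1} :
    (Moduli.mk T μ).crossRatio q = c ↔ μ.IsCrossRatio q c := by
  have key : ∀ c', (∃ (T' : RealTree) (μ' : Marking T' K L), Moduli.mk T' μ' = Moduli.mk T μ ∧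
      μ'.IsCrossRatio q c') → μ.IsCrossRatio q c' := by
    rintro c' ⟨T', μ', h, hc⟩
    exact Iso.isCrossRatio (Quotient.exact h) hc
  have hex : ∃ c, ∃ (T' : RealTree) (μ' : Marking T' K L), Moduli.mk T' μ' = Moduli.mk T μ ∧
      μ'.IsCrossRatio q c := by
    obtain ⟨c, hc⟩ := μ.exists_isCrossRatio q
    exact ⟨c, T, μ, rfl, hc⟩
  have hmem := key _ (Classical.epsilon_spec hex)
  exact ⟨fun h => h ▸ hmem, fun h => IsCrossRatio.unique μ hmem h⟩

/-- The cross-ratio of four marked points as seen from a component which separates the first three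
of them. -/
theorem crossRatio_eq_pt_of_det {q : Fin 4 ↪ Mark K L} {v : Fin T.n} {g : GL (Fin 2) ℂ}
    {p : Fin 4 → ℂ × ℂ} (hp : ∀ k, p k ≠ 0) (hg : ∀ k, g • μ.seen v (q k) = pt (p k))
    (h01 : det2 (p 1) (p 0) ≠ 0) (h02 : det2 (p 0) (p 2) ≠ 0) (h12 : det2 (p 1) (p 2) ≠ 0) :
    (Moduli.mk T μ).crossRatio q = pt (cr (p 0) (p 1) (p 2) (p 3)) := by
  rw [crossRatio_mk_iff]
  obtain ⟨k, hk⟩ := exists_gl_cr h01 h12 h02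
  refine ⟨v, k * g, ?_, ?_, ?_, ?_⟩ <;> rw [mul_smul, hg, hk _ (hp _)]
  · rw [show cr (p 0) (p 1) (p 2) (p 0) = (0, det2 (p 0) (p 2) * det2 (p 1) (p 0)) by
      simp [cr, det2, mul_comm]]
    exact pt_zero (mul_ne_zero h02 h01)
  · rw [show cr (p 0) (p 1) (p 2) (p 1) = (det2 (p 1) (p 0) * det2 (p 1) (p 2),
      det2 (p 1) (p 0) * det2 (p 1) (p 2)) by simp [cr, mul_comm]]
    exact pt_self (mul_ne_zero h01 h12)
  · rw [show cr (p 0) (p 1) (p 2) (p 2) = (det2 (p 2) (p 0) * det2 (p 1) (p 2), 0) by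
      simp [cr, det2, mul_comm]]
    exact pt_infty _

/-- The cross-ratio of four marked points is determined by their positions as seen from any
component on which no three of them coincide. -/
theorem crossRatio_eq_pt {q : Fin 4 ↪ Mark K L} {v : Fin T.n} {g : GL (Fin 2) ℂ}
    {p : Fin 4 → ℂ × ℂ} (hp : ∀ k, p k ≠ 0) (hg : ∀ k, g • μ.seen v (q k) = pt (p k))
    (h3 : ∀ i j k : Fin 4, i ≠ j → i ≠ k → j ≠ k → det2 (p i) (p j) = 0 → det2 (p i) (p k) ≠ 0) :
    (Moduli.mk T μ).crossRatio q = pt (cr (p 0) (p 1) (p 2) (p 3)) := by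
  have hseen : ∀ k l, μ.seen v (q k) = μ.seen v (q l) ↔ det2 (p k) (p l) = 0 := by
    intro k l
    rw [← pt_eq_iff (hp k) (hp l), ← hg, ← hg, smul_left_cancel_iff]
  by_cases hsep : μ.Separates v (q 0) (q 1) (q 2)
  · have h01 : det2 (p 1) (p 0) ≠ 0 := fun e => hsep.1 ((hseen _ _).2 e).symm
    have h02 : det2 (p 0) (p 2) ≠ 0 := fun e => hsep.2.1 ((hseen _ _).2 e)
    have h12 : det2 (p 1) (p 2) ≠ 0 := fun e => hsep.2.2 ((hseen _ _).2 e)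
    exact μ.crossRatio_eq_pt_of_det hp hg h01 h02 h12
  · rw [crossRatio_mk_iff]
    obtain ⟨v', hv'⟩ := μ.exists_separates (i := q 0) (j := q 1) (k := q 2)
      (q.injective.ne (by decide)) (q.injective.ne (by decide)) (q.injective.ne (by decide))
    obtain ⟨g', h0, h1, h2⟩ := hv'.exists_smul
    have hvv : v ≠ v' := by rintro rfl; exact hsep hv'
    -- At most one of the first three points is seen from the separating component `v'` towards `v`;
    -- so at least two of them coincide as seen from `v`, and by hypothesis only two. The third one
    -- and the fourth point are then both seen from `v'` towards `v`, so the cross-ratio is $0$, $1$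
    -- or $\infty$, as the formula predicts.
    have key : ∀ a, μ.seen v a = T.dir v v' ∨ μ.seen v' a = T.dir v' v := fun a =>
      or_iff_not_imp_left.2 (μ.seen_of_seen_ne hvv)
    obtain ⟨n0, n1, n2⟩ := hv'
    have k0 := key (q 0)
    have k1 := key (q 1)
    have k2 := key (q 2)
    have k3 := key (q 3)
    refine ⟨v', g', h0, h1, h2, ?_⟩
    have three : ∀ i j k : Fin 4, i ≠ j → i ≠ k → j ≠ k → μ.seen v (q i) = μ.seen v (q j) →
        μ.seen v (q i) ≠ μ.seen v (q k) := by
      intro i j k hij hik hjk e e'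
      exact h3 i j k hij hik hjk ((hseen _ _).1 e) ((hseen _ _).1 e')
    have cases : (μ.seen v (q 0) = μ.seen v (q 1) ∧ μ.seen v' (q 3) = μ.seen v' (q 2)) ∨
        (μ.seen v (q 0) = μ.seen v (q 2) ∧ μ.seen v' (q 3) = μ.seen v' (q 1)) ∨
        (μ.seen v (q 1) = μ.seen v (q 2) ∧ μ.seen v' (q 3) = μ.seen v' (q 0)) := by
      have t1 := three 0 1 2 (by decide) (by decide) (by decide)
      have t2 := three 0 1 3 (by decide) (by decide) (by decide)
      have t3 := three 0 2 3 (by decide) (by decide) (by decide)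
      have t4 := three 1 2 3 (by decide) (by decide) (by decide)
      grind
    have d3 : ∀ i j k : Fin 4, i ≠ j → i ≠ k → j ≠ k → det2 (p i) (p j) = 0 →
        det2 (p k) (p i) ≠ 0 ∧ det2 (p i) (p k) ≠ 0 ∧ det2 (p j) (p k) ≠ 0 ∧
        det2 (p k) (p j) ≠ 0 := by
      intro i j k hij hik hjk e
      have n1 := h3 i j k hij hik hjk e
      have n2 := h3 j i k hij.symm hjk hik (det2_swap_eq_zero.1 e)
      exact ⟨fun h => n1 (det2_swap_eq_zero.1 h), n1, n2, fun h => n2 (det2_swap_eq_zero.1 h)⟩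
    rcases cases with ⟨e, e'⟩ | ⟨e, e'⟩ | ⟨e, e'⟩ <;> rw [hseen] at e <;> rw [e']
    · rw [h2, show cr (p 0) (p 1) (p 2) (p 3) = (det2 (p 3) (p 0) * det2 (p 1) (p 2), 0) by
        simp [cr, det2_swap_eq_zero.1 e], pt_infty]
    · obtain ⟨a1, a2, a3, a4⟩ := d3 0 2 3 (by decide) (by decide) (by decide) e
      obtain ⟨b1, b2, b3, b4⟩ := d3 0 2 1 (by decide) (by decide) (by decide) e
      rw [h1, ← pt_self one_ne_zero, pt_eq_iff (by simp)]
      · have : ∀ a b c d : ℂ × ℂ, det2 (1, 1) (cr a b c d) = - det2 a c * det2 d b := by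
          intro a b c d; simp only [det2, cr]; ring
        rw [this, e]
        simp
      · simp [cr, a1, b4]
    · obtain ⟨a1, a2, a3, a4⟩ := d3 1 2 3 (by decide) (by decide) (by decide) e
      obtain ⟨b1, b2, b3, b4⟩ := d3 1 2 0 (by decide) (by decide) (by decide) e
      rw [h0, show cr (p 0) (p 1) (p 2) (p 3) = (0, det2 (p 3) (p 2) * det2 (p 1) (p 0)) by
        simp [cr, e], pt_zero (mul_ne_zero a4 b2)]

end Marking

theorem Moduli.exists_mk {K L : Type} (m : Moduli K L) :
    ∃ (T : RealTree) (μ : Marking T K L), Moduli.mk T μ = m := by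
  obtain ⟨⟨T, μ⟩, h⟩ := Quotient.exists_rep m
  exact ⟨T, μ, h⟩

theorem RealTree.isAnti_sig (T : RealTree) (v : Fin T.n) : IsAnti (T.sig v) :=
  T.sig_antiholomorphic v

/-- An isomorphism of marked curves automatically commutes with the involutions. -/
theorem iso_of_marked {K L : Type} {C D : Curve K L} (f : Fin C.1.n ≃ Fin D.1.n)
    (g : Fin C.1.n → GL (Fin 2) ℂ) (h1 : ∀ v w, C.1.graph.Adj v w ↔ D.1.graph.Adj (f v) (f w))
    (h2 : ∀ v w, C.1.graph.Adj v w → D.1.dir (f v) (f w) = g v • C.1.dir v w)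
    (h3 : ∀ v, D.1.inv (f v) = f (C.1.inv v))
    (h5 : ∀ i, D.2.comp i = f (C.2.comp i))
    (h6 : ∀ i, D.2.pos i = g (C.2.comp i) • C.2.pos i) : Iso C D := by
  refine ⟨f, g, h1, h2, h3, fun v => ?_, h5, h6⟩
  -- Both sides are anti-holomorphic and agree at nodes and marked points, of which there are three
  -- on each component by stability.
  obtain ⟨a, b, c, hab, hac, hbc, hs⟩ := C.2.exists_three_special v
  have key : ∀ z, z = a ∨ z = b ∨ z = c →
      D.1.sig (f v) (g v • z) = g (C.1.inv v) • C.1.sig v z := by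
    intro z hz
    rcases hs z hz with ⟨w, hw, rfl⟩ | ⟨i, rfl, rfl⟩
    · rw [← h2 v w hw, D.1.sig_dir _ _ ((h1 _ _).1 hw), h3, h3, C.1.sig_dir _ _ hw,
        h2 _ _ (C.1.inv_adj _ _ hw)]
    · rw [← h6, ← h5, ← D.2.pos_conj, ← C.2.pos_conj, h6, C.2.comp_conj]
  have e1 := (D.1.isAnti_sig (f v)).smul 1 (g v)
  have e2 := (C.1.isAnti_sig v).smul (g (C.1.inv v)) 1
  simp only [one_smul] at e1 e2
  exact e1.eq_of_three e2 hab hac hbc (key a (by simp)) (key b (by simp)) (key c (by simp))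

/-! ### A chart of the moduli space with one real point and two conjugate pairs

The coordinate is the position `w` of `z_2⁺` when `z_1⁺`, `z_1⁻`, `x_1` are at `0`, `1`, `∞`.
In this normalization, the involution is `z ↦ 1 - conj z`. -/

/-- The marked points `z_1⁺`, `z_1⁻`, `x_1`, `z_2⁺` if `b = true`, and `z_1⁺`, `z_1⁻`, `x_1`,
`z_2⁻` if `b = false`. -/
def chartMarks (b : Bool) : Fin 4 ↪ Mark (Fin 1) (Fin 2) :=
  ⟨![Sum.inr (0, true), Sum.inr (0, false), Sum.inl 0, Sum.inr (1, b)], by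
    revert b; decide⟩

@[simp] theorem chartMarks_zero (b : Bool) : chartMarks b 0 = Sum.inr (0, true) := rfl
@[simp] theorem chartMarks_one (b : Bool) : chartMarks b 1 = Sum.inr (0, false) := rfl
@[simp] theorem chartMarks_two (b : Bool) : chartMarks b 2 = Sum.inl 0 := rfl
@[simp] theorem chartMarks_three (b : Bool) : chartMarks b 3 = Sum.inr (1, b) := rfl

/-- Homogeneous coordinates of the marked points in the normalized position with coordinate `w`. -/
def position {K : Type} (w : ℂ) : Mark K (Fin 2) → ℂ × ℂ
  | Sum.inl _ => (1, 0)
  | Sum.inr (j, b) =>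
    (if j = 0 then (if b then 0 else 1) else (if b then w else 1 - starRingEnd ℂ w), 1)

theorem position_ne_zero {K : Type} (w : ℂ) (i : Mark K (Fin 2)) : position w i ≠ 0 := by
  rcases i with i | ⟨j, b⟩ <;> simp [position]

/-- No three marked points coincide in the normalized position. -/
theorem det2_position_ne_zero {K : Type} [Subsingleton K] (w : ℂ) {i j k : Mark K (Fin 2)}
    (hij : i ≠ j) (hik : i ≠ k) (hjk : j ≠ k) (h : det2 (position w i) (position w j) = 0) :
    det2 (position w i) (position w k) ≠ 0 := by
  have h10 : w = 1 → starRingEnd ℂ w = 1 := by rintro rfl; simp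
  have h00 : w = 0 → starRingEnd ℂ w = 0 := by rintro rfl; simp
  rcases i with i | ⟨i, b⟩ <;> rcases j with j | ⟨j, c⟩ <;> rcases k with k | ⟨k, d⟩
  · exact absurd (congrArg Sum.inl (Subsingleton.elim i j)) hij
  · exact absurd (congrArg Sum.inl (Subsingleton.elim i j)) hij
  · exact absurd (congrArg Sum.inl (Subsingleton.elim i k)) hik
  · simp [det2, position] at h
  · exact absurd (congrArg Sum.inl (Subsingleton.elim j k)) hjk
  · simp [det2, position] at h
  · simp [det2, position]
  · intro h'
    simp only [det2, position, mul_one, one_mul, sub_eq_zero] at h h'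
    fin_cases i <;> fin_cases j <;> fin_cases k <;> cases b <;> cases c <;> cases d <;>
      simp at hij hik hjk h h' <;> grind

/-- The vanishing of both homogeneous coordinates would force three of the four points to coincide.
Coincidence of just two is allowed, which is what lets one chart contain nodal curves. -/
theorem cr_ne_zero {p : Fin 4 → ℂ × ℂ}
    (h3 : ∀ i j k : Fin 4, i ≠ j → i ≠ k → j ≠ k → det2 (p i) (p j) = 0 → det2 (p i) (p k) ≠ 0) :
    cr (p 0) (p 1) (p 2) (p 3) ≠ 0 := by
  intro h
  rw [cr, Prod.mk_eq_zero, mul_eq_zero, mul_eq_zero] at h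
  obtain ⟨h1 | h1, h2 | h2⟩ := h
  · exact h3 3 0 2 (by decide) (by decide) (by decide) h1 h2
  · exact h3 0 1 3 (by decide) (by decide) (by decide) (det2_swap_eq_zero.1 h2)
      (det2_swap_eq_zero.1 h1)
  · exact h3 2 1 3 (by decide) (by decide) (by decide) (det2_swap_eq_zero.1 h1)
      (det2_swap_eq_zero.1 h2)
  · exact h3 1 2 0 (by decide) (by decide) (by decide) h1 h2

/-- The cross-ratios in the normalized position with coordinate `w`. -/
def chartCr {K : Type} (w : ℂ) (q : Fin 4 ↪ Mark K (Fin 2)) : ℂ × ℂ :=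
  cr (position w (q 0)) (position w (q 1)) (position w (q 2)) (position w (q 3))

theorem chartCr_ne_zero {K : Type} [Subsingleton K] (w : ℂ) (q : Fin 4 ↪ Mark K (Fin 2)) :
    chartCr w q ≠ 0 :=
  cr_ne_zero (p := fun k => position w (q k)) fun _ _ _ hij hik hjk =>
    det2_position_ne_zero w (q.injective.ne hij) (q.injective.ne hik) (q.injective.ne hjk)

theorem crossRatio_of_position {K : Type} [Subsingleton K] {T : RealTree}
    (μ : Marking T K (Fin 2)) {v : Fin T.n} {g : GL (Fin 2) ℂ} {w : ℂ}
    (h : ∀ i, g • μ.seen v i = pt (position w i)) (q : Fin 4 ↪ Mark K (Fin 2)) :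
    (Moduli.mk T μ).crossRatio q = pt (chartCr w q) :=
  μ.crossRatio_eq_pt (p := fun k => position w (q k)) (fun _ => position_ne_zero _ _)
    (fun _ => h _) fun _ _ _ hij hik hjk =>
      det2_position_ne_zero w (q.injective.ne hij) (q.injective.ne hik) (q.injective.ne hjk)

/-- The component separating $z_1^+$, $z_1^-$, $x_1$ is real, since the involution permutes these
three points and the separating component is unique. The position of $z_2^-$ then follows from that
of $z_2^+$ by symmetry. -/
theorem exists_position {T : RealTree} (μ : Marking T (Fin 1) (Fin 2)) {w : ℂ}
    (h : (Moduli.mk T μ).crossRatio (chartMarks true) = (w : P1)) :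
    ∃ (v : Fin T.n) (g : GL (Fin 2) ℂ), T.inv v = v ∧
      ∀ i, g • μ.seen v i = pt (position w i) := by
  obtain ⟨v, g, h0, h1, h2, h3⟩ := μ.crossRatio_mk_iff.1 h
  simp only [chartMarks_zero, chartMarks_one, chartMarks_two, chartMarks_three] at h0 h1 h2 h3
  have hs := Marking.Separates.of_smul μ h0 h1 h2
  have hc := hs.conj
  have hv : T.inv v = v := Marking.Separates.unique (i := Sum.inr (0, true))
    (j := Sum.inr (0, false)) (k := Sum.inl 0) ⟨hc.1.symm, hc.2.2, hc.2.1⟩ hs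
  refine ⟨v, g, hv, ?_⟩
  have sc : ∀ i, μ.seen v (Mark.conj i) = T.sig v (μ.seen v i) := by
    intro i
    have := μ.seen_conj v i
    rwa [hv] at this
  -- In the normalized coordinate the involution exchanges $0$ and $1$ and fixes $\infty$, hence it
  -- is $z\mapsto 1-\bar z$.
  obtain ⟨k, k1, k2⟩ := exists_anti_one_sub
  have hA := (T.isAnti_sig v).smul g g⁻¹
  have hB : IsAnti fun z => k • P1.conj z := ⟨k, fun _ => rfl⟩
  have key : ∀ z, g • T.sig v (g⁻¹ • z) = k • P1.conj z := by
    refine hA.eq_of_three hB (a := ((0 : ℂ) : P1)) (b := ((1 : ℂ) : P1)) (c := OnePoint.infty)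
      ?_ (OnePoint.coe_ne_infty _) (OnePoint.coe_ne_infty _) ?_ ?_ ?_
    · simp
    · rw [← h0, inv_smul_smul, ← sc, h0, k2]
      simpa [Mark.conj] using h1
    · rw [← h1, inv_smul_smul, ← sc, h1, k2]
      simpa [Mark.conj] using h0
    · rw [← h2, inv_smul_smul, ← sc, h2, k1]
      simpa [Mark.conj] using h2
  rintro (i | ⟨j, b⟩)
  · rw [Subsingleton.elim i 0, h2]
    exact (pt_infty _).symm
  · fin_cases j <;> cases b
    · simpa [position, pt] using h1
    · simpa [position, pt] using h0
    · have h4 : g • μ.seen v (Sum.inr (1, false)) = ((1 - starRingEnd ℂ w : ℂ) : P1) := by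
        have e := sc (Sum.inr (1, true))
        have e' := key w
        rw [← h3, inv_smul_smul, ← e, h3, k2] at e'
        simpa [Mark.conj] using e'
      simpa [position, pt] using h4
    · simpa [position, pt] using h3

/-- The embedding in terms of the coordinate. -/
def chart (w : ℂ) : Ambient (Fin 1) (Fin 2) := fun q => roundSphere (chartCr w q)

/-- The curve `m` lies in the domain of the chart and has coordinate `w`. -/
def HasCoord (m : Moduli (Fin 1) (Fin 2)) (w : ℂ) : Prop :=
  m.crossRatio (chartMarks true) = (w : P1)

theorem HasCoord.crossRatio {m : Moduli (Fin 1) (Fin 2)} {w : ℂ} (h : HasCoord m w)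
    (q : Fin 4 ↪ Mark (Fin 1) (Fin 2)) : m.crossRatio q = pt (chartCr w q) := by
  obtain ⟨T, μ, rfl⟩ := m.exists_mk
  obtain ⟨v, g, -, hg⟩ := exists_position μ h
  exact crossRatio_of_position μ hg q

theorem HasCoord.emb_eq {m : Moduli (Fin 1) (Fin 2)} {w : ℂ} (h : HasCoord m w) :
    emb m = chart w := by
  ext1 q
  rw [emb, h.crossRatio q, sphere_pt (chartCr_ne_zero w q), chart]

theorem chartCr_chartMarks (w : ℂ) (b : Bool) :
    pt (chartCr w (chartMarks b)) = ((if b then w else 1 - starRingEnd ℂ w : ℂ) : P1) := by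
  have : chartCr w (chartMarks b) =
      (-1 : ℂ) • ((if b then w else 1 - starRingEnd ℂ w : ℂ), (1 : ℂ)) := by
    cases b <;> simp [chartCr, cr, position, det2]
  rw [this, pt_smul_eq (by simp), pt_coe]

theorem HasCoord.crossRatio_false {m : Moduli (Fin 1) (Fin 2)} {w : ℂ} (h : HasCoord m w) :
    m.crossRatio (chartMarks false) = ((1 - starRingEnd ℂ w : ℂ) : P1) := by
  rw [h.crossRatio, chartCr_chartMarks]
  simp

/-- The homogeneous cross-ratios are polynomial in $w$ and $\bar w$ and have no common zero, even at
the nodal curves. -/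
theorem contDiff_chart : ContDiff ℝ ∞ chart := by
  refine contDiff_pi.2 fun q => ?_
  have hpos : ∀ i : Mark (Fin 1) (Fin 2), ContDiff ℝ ∞ fun w : ℂ => position w i := by
    rintro (i | ⟨j, b⟩)
    · exact contDiff_const
    · have h1 : ContDiff ℝ ∞ fun w : ℂ => 1 - starRingEnd ℂ w :=
        contDiff_const.sub Complex.conjCLE.contDiff
      refine ContDiff.prodMk ?_ contDiff_const
      fin_cases j <;> cases b <;> simp
      · exact contDiff_const
      · exact contDiff_const
      · exact h1
      · exact contDiff_id
  have hdet : ∀ i j : Mark (Fin 1) (Fin 2),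
      ContDiff ℝ ∞ fun w : ℂ => det2 (position w i) (position w j) := fun i j =>
    ((hpos i).fst.mul (hpos j).snd).sub ((hpos i).snd.mul (hpos j).fst)
  have hcr : ContDiff ℝ ∞ fun w : ℂ => chartCr w q :=
    ((hdet _ _).mul (hdet _ _)).prodMk ((hdet _ _).mul (hdet _ _))
  exact contDiffOn_roundSphere.comp_contDiff hcr fun w => chartCr_ne_zero w q

/-- The derivative of the chart. -/
def dchart (w : ℂ) : ℂ →L[ℝ] Ambient (Fin 1) (Fin 2) := fderiv ℝ chart w

theorem hasFDerivAt_chart (w : ℂ) : HasFDerivAt chart (dchart w) w :=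
  ((contDiff_chart.differentiable (by simp)) w).hasFDerivAt

theorem continuous_dchart : Continuous dchart := contDiff_chart.continuous_fderiv (by simp)

/-- The coordinate as a function on the ambient space. -/
def coord (e : Ambient (Fin 1) (Fin 2)) : ℂ :=
  (e (chartMarks true)).1 / ((1 - (e (chartMarks true)).2 : ℝ) : ℂ)

theorem chart_chartMarks (w : ℂ) : chart w (chartMarks true) = sphere (w : P1) := by
  rw [chart, ← sphere_pt (chartCr_ne_zero w _), chartCr_chartMarks]
  simp

theorem coord_chart (w : ℂ) : coord (chart w) = w := by
  rw [coord, chart_chartMarks, stereographic_sphere]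

theorem chart_injective : Function.Injective chart :=
  Function.LeftInverse.injective coord_chart

theorem chart_snd_ne_one (w : ℂ) : (chart w (chartMarks true)).2 ≠ 1 := by
  rw [chart_chartMarks, Ne, sphere_snd_eq_one_iff]
  exact OnePoint.coe_ne_infty _

theorem hasCoord_coord {m : Moduli (Fin 1) (Fin 2)} (h : (emb m (chartMarks true)).2 ≠ 1) :
    HasCoord m (coord (emb m)) := by
  have : m.crossRatio (chartMarks true) ≠ OnePoint.infty := by
    rwa [Ne, ← sphere_snd_eq_one_iff]
  obtain ⟨w, hw⟩ := OnePoint.ne_infty_iff_exists.1 this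
  have hc : HasCoord m w := hw.symm
  rwa [hc.emb_eq, coord_chart]

theorem differentiableAt_coord (w : ℂ) : DifferentiableAt ℝ coord (chart w) := by
  have h1 : DifferentiableAt ℝ (fun e : Ambient (Fin 1) (Fin 2) => e (chartMarks true))
      (chart w) := differentiableAt_apply _ _
  refine DifferentiableAt.mul h1.fst (DifferentiableAt.inv ?_ ?_)
  · exact Complex.ofRealCLM.differentiableAt.comp _
      ((differentiableAt_const (1 : ℝ)).sub h1.snd)
  · exact_mod_cast sub_ne_zero.2 (chart_snd_ne_one w).symm

/-- Differentiating `coord ∘ chart = id` gives a left inverse of the derivative, hence the immersion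
property. -/
theorem fderiv_coord_dchart (w z : ℂ) : fderiv ℝ coord (chart w) (dchart w z) = z := by
  have h := (differentiableAt_coord w).hasFDerivAt.comp w (hasFDerivAt_chart w)
  have h' : coord ∘ chart = id := funext coord_chart
  rw [h'] at h
  have := h.unique (hasFDerivAt_id w)
  exact congrArg (fun L : ℂ →L[ℝ] ℂ => L z) this

theorem dchart_injective (w : ℂ) : Function.Injective (dchart w) :=
  Function.LeftInverse.injective (fderiv_coord_dchart w)

/-! ### Tangent spaces -/

/-- On the open set where the coordinate is finite, `chart ∘ coord` restricts to the identity on the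
image of the moduli space. Derivatives within a set are unique on its tangent cone, so the
derivative of this retraction fixes tangent vectors. -/
theorem tangentCone_subset {A : Set (Moduli (Fin 1) (Fin 2))} {p : Moduli (Fin 1) (Fin 2)} {w : ℂ}
    (hp : HasCoord p w) {y : Ambient (Fin 1) (Fin 2)}
    (hy : y ∈ tangentConeAt ℝ (emb '' A) (emb p)) :
    y = dchart w (fderiv ℝ coord (chart w) y) := by
  rw [hp.emb_eq] at hy
  set U : Set (Ambient (Fin 1) (Fin 2)) := {e | (e (chartMarks true)).2 ≠ 1} with hU
  have hopen : IsOpen U :=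
    isOpen_ne_fun (continuous_snd.comp (continuous_apply _)) continuous_const
  rw [← tangentConeAt_inter_nhds (hopen.mem_nhds (chart_snd_ne_one w))] at hy
  have h1 : HasFDerivWithinAt id (ContinuousLinearMap.id ℝ (Ambient (Fin 1) (Fin 2)))
      (emb '' A ∩ U) (chart w) := hasFDerivWithinAt_id _ _
  have h2 : HasFDerivAt (chart ∘ coord) ((dchart w).comp (fderiv ℝ coord (chart w))) (chart w) := by
    refine HasFDerivAt.comp _ ?_ (differentiableAt_coord w).hasFDerivAt
    rw [coord_chart]
    exact hasFDerivAt_chart w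
  have h3 : HasFDerivWithinAt id ((dchart w).comp (fderiv ℝ coord (chart w)))
      (emb '' A ∩ U) (chart w) := by
    refine h2.hasFDerivWithinAt.congr ?_ ?_
    · rintro _ ⟨⟨m, -, rfl⟩, hm⟩
      exact (hasCoord_coord hm).emb_eq
    · simp [coord_chart]
  exact h1.unique_on h3 hy

theorem tangentSpace_le_range {A : Set (Moduli (Fin 1) (Fin 2))} {p : Moduli (Fin 1) (Fin 2)}
    {w : ℂ} (hp : HasCoord p w) :
    tangentSpace A p ≤ LinearMap.range (dchart w : ℂ →ₗ[ℝ] Ambient (Fin 1) (Fin 2)) := by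
  refine Submodule.span_le.2 fun y hy => ?_
  exact ⟨_, (tangentCone_subset hp hy).symm⟩

/-- If the coordinates of the points of `A` are real, so are those of its tangent vectors. -/
theorem im_eq_zero_of_mem_tangentSpace {A : Set (Moduli (Fin 1) (Fin 2))}
    {p : Moduli (Fin 1) (Fin 2)} {w : ℂ} (hp : HasCoord p w) (hw : w.im = 0)
    (hA : ∀ m ∈ A, ∃ t : ℝ, HasCoord m t) {z : ℂ} (hz : dchart w z ∈ tangentSpace A p) :
    z.im = 0 := by
  have key : tangentSpace A p ≤ LinearMap.ker
      ((Complex.imCLM.comp (fderiv ℝ coord (chart w)) : _ →L[ℝ] ℝ) :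
        Ambient (Fin 1) (Fin 2) →ₗ[ℝ] ℝ) := by
    refine Submodule.span_le.2 fun y hy => ?_
    rw [hp.emb_eq] at hy
    have h1 : HasFDerivWithinAt (fun e => (coord e).im)
        (Complex.imCLM.comp (fderiv ℝ coord (chart w))) (emb '' A) (chart w) :=
      (Complex.imCLM.hasFDerivAt.comp _ (differentiableAt_coord w).hasFDerivAt).hasFDerivWithinAt
    -- The imaginary part of the coordinate vanishes on `A`, so $0$ is also a derivative of it
    -- within `A`, and the two derivatives agree on the tangent cone.
    have h2 : HasFDerivWithinAt (fun e => (coord e).im) (0 : _ →L[ℝ] ℝ) (emb '' A) (chart w) := by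
      refine (hasFDerivWithinAt_const (0 : ℝ) _ _).congr ?_ ?_
      · rintro _ ⟨m, hm, rfl⟩
        obtain ⟨t, ht⟩ := hA m hm
        simp only [ht.emb_eq, coord_chart, Complex.ofReal_im]
      · simp only [coord_chart, hw]
    exact h1.unique_on h2 hy
  have := key hz
  rw [LinearMap.mem_ker] at this
  simpa [fderiv_coord_dchart] using this

theorem mem_tangentSpace_of_curve {A : Set (Moduli (Fin 1) (Fin 2))}
    {γ : ℝ → Moduli (Fin 1) (Fin 2)} {s : Set ℝ} {t : ℝ} {y : Ambient (Fin 1) (Fin 2)}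
    (hγ : HasDerivWithinAt (fun r => emb (γ r)) y s t)
    (hs : AccPt t (Filter.principal s)) (hA : ∀ r ∈ s, γ r ∈ A) : y ∈ tangentSpace A (γ t) := by
  have h1 : (1 : ℝ) ∈ tangentConeAt ℝ s t := by
    rw [tangentConeAt_eq_univ hs]; trivial
  have h2 := hγ.hasFDerivWithinAt.mapsTo_tangent_cone h1
  have h3 : (fun r => emb (γ r)) '' s ⊆ emb '' A := by
    rintro _ ⟨r, hr, rfl⟩
    exact ⟨_, hA r hr, rfl⟩
  have h4 := tangentConeAt_mono h3 h2
  refine Submodule.subset_span ?_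
  simpa using h4

theorem tangentSpace_mono {K L : Type} {A A' : Set (Moduli K L)} (h : A ⊆ A') (p : Moduli K L) :
    tangentSpace A p ≤ tangentSpace A' p :=
  Submodule.span_mono (tangentConeAt_mono (Set.image_mono h))

/-! ### Families of curves -/

/-- Reduces the velocity of a family of curves to the quotient rule for its coordinate $N/D$;
finiteness at $0$ forces $D\neq0$ nearby. -/
theorem hasDerivAt_emb_of_coord {m : ℝ → Moduli (Fin 1) (Fin 2)} {N D : ℝ → ℂ} {N' D' w : ℂ}
    (hm : ∀ᶠ θ in nhds 0, (m θ).crossRatio (chartMarks true) = pt (N θ, D θ))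
    (hN : HasDerivAt N N' 0) (hD : HasDerivAt D D' 0) (hw : HasCoord (m 0) w) :
    D 0 ≠ 0 ∧ w = N 0 / D 0 ∧
    HasDerivAt (fun θ => emb (m θ)) (dchart w ((N' * D 0 - N 0 * D') / D 0 ^ 2)) 0 := by
  have h0 : pt (N 0, D 0) = (w : P1) := (hm.self_of_nhds).symm.trans hw
  have hD0 : D 0 ≠ 0 := by
    intro h
    rw [h, pt_infty] at h0
    exact OnePoint.infty_ne_coe _ h0
  have hw0 : w = N 0 / D 0 := by
    rw [pt, if_neg hD0] at h0
    exact (OnePoint.coe_injective h0).symm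
  refine ⟨hD0, hw0, ?_⟩
  have hq := hN.div hD hD0
  have hc : HasDerivAt (chart ∘ fun θ => N θ / D θ)
      (dchart w ((N' * D 0 - N 0 * D') / D 0 ^ 2)) 0 := by
    refine HasFDerivAt.comp_hasDerivAt (0 : ℝ) ?_ hq
    rw [← hw0]
    exact hasFDerivAt_chart w
  refine hc.congr_of_eventuallyEq ?_
  filter_upwards [hm, hD.continuousAt.eventually_ne hD0] with θ h1 h2
  have : HasCoord (m θ) (N θ / D θ) := by
    rw [HasCoord, h1, pt, if_neg h2]
  exact this.emb_eq

theorem hasDerivAt_exp_I : HasDerivAt (fun θ : ℝ => Complex.exp (θ * Complex.I)) Complex.I 0 := by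
  have h := ((hasDerivAt_id (0 : ℝ)).ofReal_comp.mul_const Complex.I).cexp
  simpa using h

/-- The positive rotation of the real point, in the chart. -/
theorem IsRotation.hasDerivAt_emb {m : ℝ → Moduli (Fin 1) (Fin 2)} {w : ℂ}
    (hm : IsRotation 0 0 m) (hw : HasCoord (m 0) w) :
    HasDerivAt (fun θ => emb (m θ)) (dchart w (Complex.I * (w * (w - 1)))) 0 := by
  obtain ⟨T, μ, v, g, h⟩ := hm
  obtain ⟨s, hs, hse⟩ := exists_pt (g • (μ 0).seen v (Sum.inr (1, true)))
  -- With $z_1^+=0$, $z_1^-=\infty$ and $x_1=e^{i\theta}$, the point $z_2^+$, or the node leading to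
  -- it, stays at `s`. The coordinate is $s/(s-e^{i\theta})$, kept homogeneous since `s` may be
  -- $\infty$.
  have hcr : ∀ᶠ θ : ℝ in nhds 0, (m θ).crossRatio (chartMarks true) =
      pt (s.1, s.1 - s.2 * Complex.exp (θ * Complex.I)) := by
    filter_upwards [h] with θ hθ
    obtain ⟨e, hc, hp, hx, hz, h1, h2, h3⟩ := hθ
    have hinv : T.inv v = v := by
      have := (μ θ).comp_conj (Sum.inl 0)
      rw [Mark.conj, hx] at this
      exact this.symm
    have hz' : (μ θ).comp (Sum.inr (0, false)) = v := by
      have := (μ θ).comp_conj (Sum.inr (0, true))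
      rwa [Mark.conj, hz, hinv] at this
    have h4 : (μ θ).seen v (Sum.inr (1, true)) = (μ 0).seen v (Sum.inr (1, true)) := by
      unfold Marking.seen
      rw [hc, hp _ (by simp)]
    rw [e, (μ θ).crossRatio_eq_pt_of_det (v := v) (g := g)
      (p := ![(0, 1), (1, 0), (Complex.exp (θ * Complex.I), 1), s])]
    · congr 1
      ext <;> simp [cr, det2]
    · intro k
      fin_cases k <;> simp [hs]
    · intro k
      fin_cases k
      · simpa [(μ θ).seen_of_comp_eq hz, pt] using h1
      · simpa [(μ θ).seen_of_comp_eq hz', pt] using h2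
      · simpa [(μ θ).seen_of_comp_eq hx, pt] using h3
      · simpa [h4] using hse.symm
    · simp [det2]
    · simp [det2]
    · simp [det2]
  obtain ⟨hD, hw0, hd⟩ := hasDerivAt_emb_of_coord hcr (hasDerivAt_const _ _)
    ((hasDerivAt_const (0 : ℝ) s.1).sub (hasDerivAt_exp_I.const_mul s.2)) hw
  convert hd using 2
  simp only [Complex.ofReal_zero, zero_mul, Complex.exp_zero, mul_one] at hD hw0 ⊢
  rw [hw0]
  field_simp
  ring

/-! ### Gluing -/

/-- The positions of the marked points of a glued curve, as seen from the components of the first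
curve. -/
theorem IsGluing.seen {K L : Type} {A : Set K} {B : Set L} {T₁ T₂ T : RealTree}
    {μ₁ : Marking T₁ (Option A) B} {μ₂ : Marking T₂ (Option ↥(Aᶜ)) ↥(Bᶜ)} {μ : Marking T K L}
    (h : IsGluing μ₁ μ₂ μ) : ∃ f : Fin T₁.n → Fin T.n, ∀ v,
      (∀ i : A, μ.seen (f v) (Sum.inl i) = μ₁.seen v (Sum.inl (some i))) ∧
      (∀ (j : B) b, μ.seen (f v) (Sum.inr (j, b)) = μ₁.seen v (Sum.inr (j, b))) ∧
      ∀ (j : ↥(Bᶜ)) b, μ.seen (f v) (Sum.inr (j, b)) = μ₁.seen v (Sum.inl none) := by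
  obtain ⟨e, e1, e2, e3, e4, -, e6, -, -, -, -, -, m1, m2, -, m4⟩ := h
  have dir1 : ∀ v u, u ≠ v → T.dir (e (Sum.inl v)) (e (Sum.inl u)) = T₁.dir v u := by
    intro v u huv
    obtain ⟨w, hw, ha⟩ := RealTree.exists_adj_avoid huv
    have : T.Avoid (e (Sum.inl v)) (e (Sum.inl w)) (e (Sum.inl u)) :=
      Relation.ReflTransGen.lift (fun x => e (Sum.inl x)) (fun a b hab =>
        ⟨(e1 _ _).2 hab.1, fun h => hab.2.1 (Sum.inl_injective (e.injective h)),
          fun h => hab.2.2 (Sum.inl_injective (e.injective h))⟩) _ _ ha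
    rw [← this.dir_eq, ← ha.dir_eq, e4 _ _ hw]
  -- The second curve is connected and attached at one point, so each component of the first curve
  -- sees all of it where it sees the label `none`.
  have dir2 : ∀ v u, T.dir (e (Sum.inl v)) (e (Sum.inr u)) = μ₁.seen v (Sum.inl none) := by
    intro v u
    have hne : ∀ x, e (Sum.inr x) ≠ e (Sum.inl v) := fun x h => by simpa using e.injective h
    have hr : Relation.ReflTransGen T₂.graph.Adj (μ₂.comp (Sum.inl none)) u :=
      (SimpleGraph.reachable_iff_reflTransGen _ _).1 (T₂.isTree.1.preconnected _ _)
    have ha : T.Avoid (e (Sum.inl v)) (e (Sum.inr (μ₂.comp (Sum.inl none)))) (e (Sum.inr u)) :=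
      Relation.ReflTransGen.lift (fun x => e (Sum.inr x)) (fun a b hab =>
        ⟨(e2 _ _).2 hab, hne a, hne b⟩) _ _ hr
    rw [← ha.dir_eq]
    by_cases hv : μ₁.comp (Sum.inl none) = v
    · rw [μ₁.seen_of_comp_eq hv, ← e6, hv]
    · rw [μ₁.seen_of_comp_ne hv, ← dir1 _ _ hv]
      exact (T.dir_branch _ _ _ ((e3 _ _).2 ⟨rfl, rfl⟩)
        (fun h => hv (Sum.inl_injective (e.injective h))) (hne _)).symm
  have seen1 : ∀ v i i', μ.comp i = e (Sum.inl (μ₁.comp i')) ∧ μ.pos i = μ₁.pos i' →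
      μ.seen (e (Sum.inl v)) i = μ₁.seen v i' := by
    rintro v i i' ⟨h1, h2⟩
    by_cases hv : μ₁.comp i' = v
    · rw [μ₁.seen_of_comp_eq hv, μ.seen_of_comp_eq (by rw [h1, hv]), h2]
    · rw [μ₁.seen_of_comp_ne hv, μ.seen_of_comp_ne, h1, dir1 _ _ hv]
      rw [h1]
      exact fun h => hv (Sum.inl_injective (e.injective h))
  refine ⟨fun v => e (Sum.inl v), fun v => ⟨fun i => seen1 _ _ _ (m1 i),
    fun j b => seen1 _ _ _ (m2 j b), fun j b => ?_⟩⟩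
  rw [μ.seen_of_comp_ne, (m4 j b).1, dir2]
  rw [(m4 j b).1]
  exact fun h => by simpa using e.injective h

/-- The marked points `z_1⁺`, `z_1⁻`, `x_1` and the node on the first component of a curve in the
second stratum. -/
def nodeMarks : Fin 4 ↪ Mark (Option (Set.univ : Set (Fin 1))) ({0} : Set (Fin 2)) :=
  ⟨![Sum.inr (⟨0, rfl⟩, true), Sum.inr (⟨0, rfl⟩, false), Sum.inl (some ⟨0, trivial⟩),
    Sum.inl none], by
      intro i j h
      fin_cases i <;> fin_cases j <;> simp at h ⊢⟩

@[simp] theorem nodeMarks_zero : nodeMarks 0 = Sum.inr (⟨0, rfl⟩, true) := rfl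
@[simp] theorem nodeMarks_one : nodeMarks 1 = Sum.inr (⟨0, rfl⟩, false) := rfl
@[simp] theorem nodeMarks_two : nodeMarks 2 = Sum.inl (some ⟨0, trivial⟩) := rfl
@[simp] theorem nodeMarks_three : nodeMarks 3 = Sum.inl none := rfl

/-- The first curve sees $z_2^+$ at the node, so the coordinate of the glued curve is a cross-ratio
of the first curve alone. -/
theorem Glue.crossRatio {m₁ : Moduli (Option (Set.univ : Set (Fin 1))) ({0} : Set (Fin 2))}
    {m₂ : Moduli (Option ↥((Set.univ : Set (Fin 1))ᶜ)) ↥(({0} : Set (Fin 2))ᶜ)}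
    {m : Moduli (Fin 1) (Fin 2)} (h : Glue Set.univ {0} m₁ m₂ m) :
    m.crossRatio (chartMarks true) = m₁.crossRatio nodeMarks := by
  obtain ⟨T₁, μ₁, T₂, μ₂, T, μ, rfl, -, rfl, hg⟩ := h
  obtain ⟨f, hf⟩ := hg.seen
  obtain ⟨v, g, h0, h1, h2, h3⟩ := (μ₁.crossRatio_mk_iff (q := nodeMarks)).1 rfl
  rw [Marking.crossRatio_mk_iff]
  obtain ⟨f1, f2, f3⟩ := hf v
  refine ⟨f v, g, ?_, ?_, ?_, ?_⟩
  · rw [← h0]; exact congrArg _ (f2 ⟨0, rfl⟩ true)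
  · rw [← h1]; exact congrArg _ (f2 ⟨0, rfl⟩ false)
  · rw [← h2]; exact congrArg _ (f1 ⟨0, trivial⟩)
  · rw [← h3]; exact congrArg _ (f3 ⟨1, by simp⟩ true)

/-- The positive rotation of the node, in the chart. -/
theorem hasDerivAt_emb_of_rotation_node
    {m₁ : ℝ → Moduli (Option (Set.univ : Set (Fin 1))) ({0} : Set (Fin 2))}
    {m₂ : Moduli (Option ↥((Set.univ : Set (Fin 1))ᶜ)) ↥(({0} : Set (Fin 2))ᶜ)}
    {m : ℝ → Moduli (Fin 1) (Fin 2)} {o : ({0} : Set (Fin 2))} {w : ℂ} (hm₁ : IsRotation o none m₁)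
    (hg : ∀ᶠ θ in nhds (0 : ℝ), Glue Set.univ {0} (m₁ θ) m₂ (m θ)) (hw : HasCoord (m 0) w) :
    HasDerivAt (fun θ => emb (m θ)) (dchart w (-Complex.I * (w * (w - 1)))) 0 := by
  obtain rfl : o = ⟨0, rfl⟩ := Subsingleton.elim _ _
  obtain ⟨T, μ, v, g, h⟩ := hm₁
  obtain ⟨s, hs, hse⟩ := exists_pt (g • (μ 0).seen v (Sum.inl (some ⟨0, trivial⟩)))
  -- Now $x_1$ stays at `s` and the node, where $z_2^+$ is seen, is at $e^{i\theta}$. Exchanging the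
  -- fixed and the moving point reverses the sign of the derivative.
  have hcr : ∀ᶠ θ : ℝ in nhds 0, (m θ).crossRatio (chartMarks true) =
      pt (s.2 * Complex.exp (θ * Complex.I), s.2 * Complex.exp (θ * Complex.I) - s.1) := by
    filter_upwards [h, hg] with θ hθ hgl
    obtain ⟨e, hc, hp, hx, hz, h1, h2, h3⟩ := hθ
    have hinv : T.inv v = v := by
      have := (μ θ).comp_conj (Sum.inl none)
      rw [Mark.conj, hx] at this
      exact this.symm
    have hz' : (μ θ).comp (Sum.inr (⟨0, rfl⟩, false)) = v := by
      have := (μ θ).comp_conj (Sum.inr (⟨0, rfl⟩, true))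
      rwa [Mark.conj, hz, hinv] at this
    have h4 : (μ θ).seen v (Sum.inl (some ⟨0, trivial⟩)) =
        (μ 0).seen v (Sum.inl (some ⟨0, trivial⟩)) := by
      unfold Marking.seen
      rw [hc, hp _ (by simp)]
    -- The points $z_1^\pm$ lie on this component, so $x_1$ is seen neither at $0$ nor at $\infty$:
    -- both homogeneous coordinates of `s` are nonzero.
    have hn1 := (μ θ).seen_ne_of_comp_eq hz (j := Sum.inl (some ⟨0, trivial⟩)) (by simp)
    have hn2 := (μ θ).seen_ne_of_comp_eq hz' (j := Sum.inl (some ⟨0, trivial⟩)) (by simp)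
    rw [(μ θ).seen_of_comp_eq hz, h4, ← (MulAction.injective g).ne_iff, h1, ← hse] at hn1
    rw [(μ θ).seen_of_comp_eq hz', h4, ← (MulAction.injective g).ne_iff, h2, ← hse] at hn2
    have hs1 : s.1 ≠ 0 := by
      intro h
      refine hn1 ?_
      have : s.2 ≠ 0 := fun h' => hs (Prod.ext h h')
      rw [← pt_zero this, ← h]
    have hs2 : s.2 ≠ 0 := by
      intro h
      exact hn2 (by rw [← pt_infty s.1, ← h])
    rw [hgl.crossRatio, e, (μ θ).crossRatio_eq_pt_of_det (v := v) (g := g)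
      (p := ![(0, 1), (1, 0), s, (Complex.exp (θ * Complex.I), 1)])]
    · congr 1
      ext <;> simp [cr, det2, mul_comm]
    · intro k
      fin_cases k <;> simp [hs]
    · intro k
      fin_cases k
      · simpa [(μ θ).seen_of_comp_eq hz, pt] using h1
      · simpa [(μ θ).seen_of_comp_eq hz', pt] using h2
      · simpa [h4] using hse.symm
      · simpa [(μ θ).seen_of_comp_eq hx, pt] using h3
    · simp [det2]
    · simp [det2, hs1]
    · simp [det2, hs2]
  obtain ⟨hD, hw0, hd⟩ := hasDerivAt_emb_of_coord hcr (hasDerivAt_exp_I.const_mul s.2)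
    ((hasDerivAt_exp_I.const_mul s.2).sub (hasDerivAt_const (0 : ℝ) s.1)) hw
  convert hd using 2
  simp only [Complex.ofReal_zero, zero_mul, Complex.exp_zero, mul_one] at hD hw0 ⊢
  rw [hw0]
  field_simp
  ring

/-! ### Smoothings -/

/-- If $z_2^+$ is at $\xi$ and $z_1^+,z_1^-,x_1$ are at $0,\infty,1$, then $w=\xi/(\xi-1)$. For `b =
false` one has $\xi=1/\bar\zeta$, so $w$ is anti-holomorphic in the smoothing parameter. -/
theorem IsSmoothing.hasCoord {b : Bool} {ζ : ℂ} {m : Moduli (Fin 1) (Fin 2)}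
    (h : IsSmoothing b ζ m) (h0 : ζ ≠ 0) (h1 : ζ ≠ 1) :
    HasCoord m (if b then ζ / (ζ - 1) else (1 - starRingEnd ℂ ζ)⁻¹) := by
  obtain ⟨T, μ, rfl, hn, hx, hz, hz', hy, hy'⟩ := h
  have hsub : ∀ a b : Fin T.n, a = b := by rw [hn]; exact fun a b => Subsingleton.elim a b
  have hs : ∀ i, μ.seen (μ.comp (Sum.inl 0)) i = μ.pos i := fun i => μ.seen_of_comp_eq (hsub _ _)
  have key : ∀ ξ : ℂ, μ.pos (Sum.inr (1, true)) = (ξ : P1) →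
      (Moduli.mk T μ).crossRatio (chartMarks true) = pt (ξ, ξ - 1) := by
    intro ξ hξ
    rw [μ.crossRatio_eq_pt_of_det (v := μ.comp (Sum.inl 0)) (g := 1)
      (p := ![(0, 1), (1, 0), (1, 1), (ξ, 1)])]
    · congr 1
      ext <;> simp [cr, det2]
    · intro k
      fin_cases k <;> simp
    · intro k
      fin_cases k
      · simpa [hs, pt] using hz
      · simpa [hs, pt] using hz'
      · simpa [hs, pt] using hx
      · simpa [hs, pt] using hξ
    · simp [det2]
    · simp [det2]
    · simp [det2]
  cases b
  · have hc0 : starRingEnd ℂ ζ ≠ 0 := by simpa using h0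
    have hc1 : 1 - starRingEnd ℂ ζ ≠ 0 := by
      rw [sub_ne_zero]
      intro h
      apply h1
      rw [← Complex.conj_conj ζ, ← h, map_one]
    have e : (starRingEnd ℂ ζ)⁻¹ - 1 = (1 - starRingEnd ℂ ζ) / starRingEnd ℂ ζ := by field_simp
    rw [HasCoord, key _ hy', pt, if_neg]
    · simp only [Bool.false_eq_true, if_false]
      congr 1
      rw [e]
      field_simp
    · rw [e]
      exact div_ne_zero hc1 hc0
  · rw [HasCoord, key _ hy, pt, if_neg (sub_ne_zero.2 h1)]
    simp

/-! ### Explicit curves -/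

/-- The reflection in the unit circle. -/
def reflect (z : P1) : P1 := (exists_anti_div (one_ne_zero (α := ℂ))).choose • P1.conj z

theorem reflect_pt {p : ℂ × ℂ} (hp : p ≠ 0) :
    reflect (pt p) = pt (starRingEnd ℂ p.2, starRingEnd ℂ p.1) := by
  have := (exists_anti_div (one_ne_zero (α := ℂ))).choose_spec p hp
  rwa [one_mul] at this

theorem reflect_reflect (z : P1) : reflect (reflect z) = z := by
  obtain ⟨p, hp, rfl⟩ := exists_pt z
  rw [reflect_pt hp, reflect_pt]
  · simp
  · intro h
    rw [Prod.mk_eq_zero, map_eq_zero, map_eq_zero] at h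
    exact hp (Prod.ext h.2 h.1)

theorem conj_mul_self_of_norm {a : ℂ} (h : ‖a‖ = 1) : starRingEnd ℂ a * a = 1 := by
  rw [mul_comm, Complex.mul_conj, Complex.normSq_eq_norm_sq, h]
  simp

theorem reflect_unit {a : ℂ} (h : ‖a‖ = 1) : reflect (pt (a, 1)) = pt (a, 1) := by
  have ha : a ≠ 0 := by rintro rfl; simp at h
  rw [reflect_pt (by simp), pt_eq_iff (by simp) (by simp)]
  simp [det2, conj_mul_self_of_norm h]

/-- The sphere with the reflection in the unit circle. -/
def sphereTree : RealTree where
  n := 1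
  graph := SimpleGraph.starGraph 0
  isTree := SimpleGraph.isTree_starGraph 0
  dir _ _ := OnePoint.infty
  dir_branch _ _ _ _ _ _ := rfl
  dir_inj _ _ _ _ _ _ := Subsingleton.elim _ _
  inv v := v
  sig _ := reflect
  inv_inv _ := rfl
  inv_adj _ _ h := h
  sig_antiholomorphic _ := ⟨_, fun _ => rfl⟩
  sig_sig _ := reflect_reflect
  sig_dir v w h := absurd (Subsingleton.elim v w) h.ne
  fixed := Or.inl ⟨0, pt (1, 1), rfl, reflect_unit (by simp)⟩

theorem sphereTree_not_adj (v w : Fin sphereTree.n) : ¬ sphereTree.graph.Adj v w :=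
  fun h => h.ne (Subsingleton.elim (α := Fin 1) v w)

/-- The homogeneous coordinates of the real points `x i` on the unit circle and of the pairs formed
by `z j` and its reflection. -/
def circleVec {K L : Type} (x : K → ℂ) (z : L → ℂ) : Mark K L → ℂ × ℂ
  | Sum.inl i => (x i, 1)
  | Sum.inr (j, true) => (z j, 1)
  | Sum.inr (j, false) => (1, starRingEnd ℂ (z j))

/-- The points given by `x` and `z` are distinct, with `x` on the unit circle. -/
structure CircleData {K L : Type} (x : K → ℂ) (z : L → ℂ) : Prop where
  norm_x : ∀ i, ‖x i‖ = 1
  inj_x : Function.Injective x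
  inj_z : Function.Injective z
  mul_conj_ne : ∀ j k, z j * starRingEnd ℂ (z k) ≠ 1
  card : 3 ≤ Nat.card (Mark K L)

theorem circleVec_ne_zero {K L : Type} (x : K → ℂ) (z : L → ℂ) (i : Mark K L) :
    circleVec x z i ≠ 0 := by
  rcases i with i | ⟨j, _ | _⟩ <;> simp [circleVec]

/-- The condition $z_j\bar z_k\ne1$ keeps every $z_j$ away from every reflected $z_k$; for $j=k$ it
also keeps $z_j$ off the unit circle, hence away from the real points. -/
theorem CircleData.det2_ne_zero {K L : Type} {x : K → ℂ} {z : L → ℂ} (h : CircleData x z)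
    {i j : Mark K L} (hij : i ≠ j) : det2 (circleVec x z i) (circleVec x z j) ≠ 0 := by
  have hx0 : ∀ i, x i ≠ 0 := fun i e => by simpa [e] using h.norm_x i
  have hxx : ∀ i, starRingEnd ℂ (x i) * x i = 1 := fun i => conj_mul_self_of_norm (h.norm_x i)
  have hxz : ∀ i j, x i ≠ z j := by
    intro i j e
    refine h.mul_conj_ne j j ?_
    rw [← e, mul_comm, hxx]
  have hxz' : ∀ i j, x i * starRingEnd ℂ (z j) ≠ 1 := by
    intro i j e
    rw [← hxx i, mul_comm] at e
    exact hxz i j ((starRingEnd ℂ).injective (mul_right_cancel₀ (hx0 i) e).symm)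
  have swap : ∀ {a b : ℂ × ℂ}, det2 a b ≠ 0 → det2 b a ≠ 0 := fun h e =>
    h (det2_swap_eq_zero.1 e)
  have n1 : ∀ i j, i ≠ j → det2 (x i, 1) (x j, 1) ≠ 0 := by
    intro i j hij
    simpa [det2, sub_eq_zero] using h.inj_x.ne hij
  have n2 : ∀ i j, det2 (x i, 1) (z j, 1) ≠ 0 := by
    intro i j
    simpa [det2, sub_eq_zero] using hxz i j
  have n3 : ∀ i j, det2 (x i, 1) (1, starRingEnd ℂ (z j)) ≠ 0 := by
    intro i j
    simpa [det2, sub_eq_zero] using hxz' i j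
  have n4 : ∀ i j, i ≠ j → det2 (z i, 1) (z j, 1) ≠ 0 := by
    intro i j hij
    simpa [det2, sub_eq_zero] using h.inj_z.ne hij
  have n5 : ∀ i j, det2 (z i, 1) (1, starRingEnd ℂ (z j)) ≠ 0 := by
    intro i j
    simpa [det2, sub_eq_zero] using h.mul_conj_ne i j
  have n6 : ∀ i j, i ≠ j → det2 (1, starRingEnd ℂ (z i)) (1, starRingEnd ℂ (z j)) ≠ 0 := by
    intro i j hij
    have := (starRingEnd ℂ).injective.ne (h.inj_z.ne hij.symm)
    simpa [det2, sub_eq_zero] using this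
  rcases i with i | ⟨i, _ | _⟩ <;> rcases j with j | ⟨j, _ | _⟩
  · exact n1 _ _ (fun e => hij (e ▸ rfl))
  · exact n3 _ _
  · exact n2 _ _
  · exact swap (n3 _ _)
  · exact n6 _ _ (fun e => hij (e ▸ rfl))
  · exact swap (n5 _ _)
  · exact swap (n2 _ _)
  · exact n5 _ _
  · exact n4 _ _ (fun e => hij (e ▸ rfl))

theorem reflect_circleVec {K L : Type} {x : K → ℂ} {z : L → ℂ} (h : CircleData x z)
    (i : Mark K L) : pt (circleVec x z (Mark.conj i)) = reflect (pt (circleVec x z i)) := by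
  rcases i with i | ⟨j, _ | _⟩
  · exact (reflect_unit (h.norm_x i)).symm
  · rw [reflect_pt (circleVec_ne_zero _ _ _)]
    simp [Mark.conj, circleVec]
  · rw [reflect_pt (circleVec_ne_zero _ _ _)]
    simp [Mark.conj, circleVec]

/-- The smooth curve given by `x` and `z`. -/
def circleMarking {K L : Type} {x : K → ℂ} {z : L → ℂ} (h : CircleData x z) :
    Marking sphereTree K L where
  comp _ := (0 : Fin 1)
  pos i := pt (circleVec x z i)
  pos_inj i j _ e := by
    by_contra hij
    exact h.det2_ne_zero hij
      ((pt_eq_iff (circleVec_ne_zero _ _ _) (circleVec_ne_zero _ _ _)).1 e)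
  pos_ne_node i w hw := absurd hw (sphereTree_not_adj _ _)
  stable v := by
    have hinj : Function.Injective fun i => pt (circleVec x z i) := by
      intro i j e
      by_contra hij
      exact h.det2_ne_zero hij
        ((pt_eq_iff (circleVec_ne_zero _ _ _) (circleVec_ne_zero _ _ _)).1 e)
    have hr : 3 ≤ (Set.range fun i => pt (circleVec x z i)).ncard := by
      rw [← Set.image_univ, Set.ncard_image_of_injective _ hinj, Set.ncard_univ]
      exact h.card
    refine hr.trans (le_of_eq (congrArg Set.ncard (Set.Subset.antisymm ?_ ?_)))
    · rintro _ ⟨i, rfl⟩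
      exact Or.inr ⟨i, Subsingleton.elim (α := Fin 1) _ _, rfl⟩
    · rintro p (⟨w, hw, -⟩ | ⟨i, -, rfl⟩)
      · exact absurd hw (sphereTree_not_adj _ _)
      · exact ⟨i, rfl⟩
  comp_conj _ := rfl
  pos_conj := reflect_circleVec h

theorem three_le_ncard {S : Set P1} (hS : S.Finite) {a b c : P1} (ha : a ∈ S) (hb : b ∈ S)
    (hc : c ∈ S) (hab : a ≠ b) (hac : a ≠ c) (hbc : b ≠ c) : 3 ≤ S.ncard :=
  (Set.two_lt_ncard_iff hS).2 ⟨a, b, c, ha, hb, hc, hab, hac, hbc⟩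

theorem finite_special {n : ℕ} {M : Type} [Finite M] (P : Fin n → Prop) (d : Fin n → P1)
    (Q : M → Prop) (p : M → P1) :
    ({z | ∃ w, P w ∧ d w = z} ∪ {z | ∃ i, Q i ∧ p i = z}).Finite := by
  refine Set.Finite.union ?_ ?_
  · refine (Set.finite_range d).subset ?_
    rintro _ ⟨w, -, rfl⟩
    exact ⟨w, rfl⟩
  · refine (Set.finite_range p).subset ?_
    rintro _ ⟨w, -, rfl⟩
    exact ⟨w, rfl⟩

/-- Two real spheres, joined at the point `a` of the first one and `1` of the second one. -/
def twoTree (a : ℂ) (ha : ‖a‖ = 1) : RealTree where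
  n := 2
  graph := SimpleGraph.starGraph 0
  isTree := SimpleGraph.isTree_starGraph 0
  dir v _ := if v = 0 then pt (a, 1) else pt (1, 1)
  dir_branch _ _ _ _ _ _ := rfl
  dir_inj v u w hu hw _ := by
    have := hu.ne
    have := hw.ne
    omega
  inv v := v
  sig _ := reflect
  inv_inv _ := rfl
  inv_adj _ _ h := h
  sig_antiholomorphic _ := ⟨_, fun _ => rfl⟩
  sig_sig _ := reflect_reflect
  sig_dir v w h := by
    split_ifs
    · exact reflect_unit ha
    · exact reflect_unit (by simp)
  fixed := Or.inl ⟨0, pt (1, 1), rfl, reflect_unit (by simp)⟩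

/-- The real point at `ξ` and the first pair at `0`, `∞` on the first sphere, the second pair at
`0`, `∞` on the second sphere. -/
def twoMarking {a ξ : ℂ} (ha : ‖a‖ = 1) (hξ : ‖ξ‖ = 1) (h : a ≠ ξ) :
    Marking (twoTree a ha) (Fin 1) (Fin 2) where
  comp
    | Sum.inl _ => (0 : Fin 2)
    | Sum.inr (j, _) => j
  pos
    | Sum.inl _ => pt (ξ, 1)
    | Sum.inr (_, true) => pt (0, 1)
    | Sum.inr (_, false) => pt (1, 0)
  pos_inj := by
    have h0 : ξ ≠ 0 := by rintro rfl; simp at hξ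
    rintro (i | ⟨i, _ | _⟩) (j | ⟨j, _ | _⟩) hc hp
    · rw [Subsingleton.elim i j]
    all_goals first
      | (simp [pt, h0, h0.symm] at hp; done)
      | (simp at hc; rw [hc])
  pos_ne_node := by
    have h0 : a ≠ 0 := by rintro rfl; simp at ha
    rintro (i | ⟨i, _ | _⟩) w hw e
    · simp [twoTree, pt, h.symm] at e
    · fin_cases i <;> simp [twoTree, pt] at e
    · fin_cases i <;> simp [twoTree, pt, h0.symm] at e
  stable v := by
    have h0 : ξ ≠ 0 := by rintro rfl; simp at hξ
    have hf := finite_special (fun w => (twoTree a ha).graph.Adj v w) ((twoTree a ha).dir v)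
      (fun i : Mark (Fin 1) (Fin 2) => (match i with
        | Sum.inl _ => (0 : Fin 2)
        | Sum.inr (j, _) => j) = v)
      (fun i => match i with
        | Sum.inl _ => pt (ξ, 1)
        | Sum.inr (_, true) => pt (0, 1)
        | Sum.inr (_, false) => pt (1, 0))
    change Fin 2 at v
    have hadj : (twoTree a ha).graph.Adj v (v + 1 : Fin 2) := by
      simp only [twoTree, SimpleGraph.starGraph_adj]
      omega
    refine three_le_ncard hf (a := (twoTree a ha).dir v (v + 1 : Fin 2)) (b := pt (0, 1)) (c := pt (1, 0))
      (Or.inl ⟨(v + 1 : Fin 2), hadj, rfl⟩) (Or.inr ⟨Sum.inr (v, true), rfl, rfl⟩)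
      (Or.inr ⟨Sum.inr (v, false), rfl, rfl⟩) ?_ ?_ ?_
    · have h0 : a ≠ 0 := by rintro rfl; simp at ha
      fin_cases v <;> simp [twoTree, pt, h0]
    · fin_cases v <;> simp [twoTree, pt]
    · simp [pt]
  comp_conj := by rintro (i | ⟨j, b⟩) <;> rfl
  pos_conj := by
    rintro (i | ⟨j, _ | _⟩)
    · exact (reflect_unit hξ).symm
    · exact (by rw [reflect_pt (by simp)]; simp : pt (0, 1) = reflect (pt (1, 0)))
    · exact (by rw [reflect_pt (by simp)]; simp : pt (1, 0) = reflect (pt (0, 1)))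

/-- A real sphere joined at `0` and `∞` to two conjugate spheres. -/
def threeTree : RealTree where
  n := 3
  graph := SimpleGraph.starGraph 1
  isTree := SimpleGraph.isTree_starGraph 1
  dir v w := if v = 1 then (if w = 0 then pt (0, 1) else pt (1, 0)) else pt (1, 0)
  dir_branch v u w h hu hw := by
    simp only [SimpleGraph.starGraph_adj] at h
    split_ifs <;> first | rfl | omega
  dir_inj v u w hu hw e := by
    simp only [SimpleGraph.starGraph_adj] at hu hw
    split_ifs at e <;> first | omega | (simp [pt] at e)
  inv := Fin.rev
  sig v := if v = 1 then reflect else P1.conj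
  inv_inv := Fin.rev_rev
  inv_adj v w h := by
    simp only [SimpleGraph.starGraph_adj] at h ⊢
    revert v w
    decide
  sig_antiholomorphic v := by
    split_ifs
    · exact ⟨_, fun _ => rfl⟩
    · exact ⟨1, fun z => (one_smul _ _).symm⟩
  sig_sig v z := by
    fin_cases v
    · simp
    · simpa [Fin.rev] using reflect_reflect z
    · simp
  sig_dir v w h := by
    have e1 : reflect (pt (0, 1)) = pt (1, 0) := by rw [reflect_pt (by simp)]; simp
    have e2 : reflect (pt (1, 0)) = pt (0, 1) := by rw [reflect_pt (by simp)]; simp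
    have e3 : P1.conj (pt (1, 0)) = pt (1, 0) := by simp [pt]
    simp only [SimpleGraph.starGraph_adj] at h
    fin_cases v <;> fin_cases w <;> simp [Fin.rev, e1, e2, e3] at h ⊢
  fixed := Or.inl ⟨1, pt (1, 1), rfl, by simpa using reflect_unit (a := 1) (by simp)⟩

/-- Whether the point with index `j` and sign `c` lies on the same component as `z_1⁺`, when the
point of the second pair with sign `b` does. -/
def side (b : Bool) (j : Fin 2) (c : Bool) : Bool := if j = 0 then c else c == b

/-- The components of the marked points of `threeMarking`. -/
def threeComp (b : Bool) : Mark (Fin 1) (Fin 2) → Fin 3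
  | Sum.inl _ => 1
  | Sum.inr (j, c) => if side b j c then 0 else 2

theorem threeComp_ne (b : Bool) (i : Fin 1) (j : Fin 2) (c : Bool) :
    threeComp b (Sum.inl i) ≠ threeComp b (Sum.inr (j, c)) := by
  revert b i j c; decide

theorem threeComp_injective {b : Bool} {j : Fin 2} {c d : Bool}
    (h : threeComp b (Sum.inr (j, c)) = threeComp b (Sum.inr (j, d))) : c = d := by
  revert b j c d; decide

/-- The marking with the real point on the real component, and `z_1⁺` and the point of the second
pair with sign `b` on another one. -/
def threeMarking (b : Bool) : Marking threeTree (Fin 1) (Fin 2) where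
  comp := threeComp b
  pos
    | Sum.inl _ => pt (1, 1)
    | Sum.inr (j, _) => if j = 0 then pt (0, 1) else pt (1, 1)
  pos_inj := by
    rintro (i | ⟨i, c⟩) (j | ⟨j, d⟩) hc hp
    · rw [Subsingleton.elim i j]
    · exact absurd hc (threeComp_ne _ _ _ _)
    · exact absurd hc.symm (threeComp_ne _ _ _ _)
    · have hij : i = j := by
        fin_cases i <;> fin_cases j <;> simp [pt] at hp ⊢
      subst hij
      rw [threeComp_injective hc]
  pos_ne_node := by
    rintro (i | ⟨i, c⟩) w hw e
    · simp only [threeTree] at e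
      split_ifs at e <;> simp [pt] at e
    · have hne : threeComp b (Sum.inr (i, c)) ≠ 1 := by
        simp only [threeComp]; split_ifs <;> decide
      simp only [threeTree, hne, if_false] at e
      split_ifs at e <;> simp [pt] at e
  stable v := by
    have hf := finite_special (fun w => threeTree.graph.Adj v w) (threeTree.dir v)
      (fun i : Mark (Fin 1) (Fin 2) => threeComp b i = v)
      (fun i => match i with
        | Sum.inl _ => pt (1, 1)
        | Sum.inr (j, _) => if j = 0 then pt (0, 1) else pt (1, 1))
    have n1 : pt (1, 0) ≠ pt (0, 1) := by simp [pt]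
    have n2 : pt (1, 0) ≠ pt (1, 1) := by simp [pt]
    have n3 : pt (0, 1) ≠ pt (1, 1) := by simp [pt]
    refine three_le_ncard hf (a := pt (1, 0)) (b := pt (0, 1)) (c := pt (1, 1)) ?_ ?_ ?_ n1 n2 n3
    · change Fin 3 at v
      fin_cases v
      · exact Or.inl ⟨(1 : Fin 3), by simp [threeTree], by simp [threeTree]⟩
      · exact Or.inl ⟨(2 : Fin 3), by simp [threeTree], by simp [threeTree]⟩
      · exact Or.inl ⟨(1 : Fin 3), by simp [threeTree], by simp [threeTree]⟩
    · change Fin 3 at v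
      fin_cases v
      · exact Or.inr ⟨Sum.inr (0, true), rfl, rfl⟩
      · exact Or.inl ⟨(0 : Fin 3), by simp [threeTree], by simp [threeTree]⟩
      · exact Or.inr ⟨Sum.inr (0, false), rfl, rfl⟩
    · change Fin 3 at v
      fin_cases v
      · exact Or.inr ⟨Sum.inr (1, b), by cases b <;> rfl, rfl⟩
      · exact Or.inr ⟨Sum.inl 0, rfl, rfl⟩
      · exact Or.inr ⟨Sum.inr (1, !b), by cases b <;> rfl, rfl⟩
  comp_conj := by
    rintro (i | ⟨j, c⟩)
    · rfl
    · change threeComp b (Sum.inr (j, !c)) = Fin.rev (threeComp b (Sum.inr (j, c)))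
      revert j b c; decide
  pos_conj := by
    have e1 : P1.conj (pt (0, 1)) = pt (0, 1) := by simp [pt]
    have e2 : P1.conj (pt (1, 1)) = pt (1, 1) := by simp [pt]
    rintro (i | ⟨j, c⟩)
    · exact (reflect_unit (a := 1) (by simp)).symm
    · have hne : threeComp b (Sum.inr (j, c)) ≠ 1 := by
        simp only [threeComp]; split_ifs <;> decide
      simp only [threeTree, hne, if_false, Mark.conj]
      split_ifs
      · exact e1.symm
      · exact e2.symm

/-- Two conjugate spheres. -/
def conjTree : RealTree where
  n := 2
  graph := SimpleGraph.starGraph 0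
  isTree := SimpleGraph.isTree_starGraph 0
  dir _ _ := pt (1, 0)
  dir_branch _ _ _ _ _ _ := rfl
  dir_inj v u w hu hw _ := by
    have := hu.ne
    have := hw.ne
    omega
  inv := Fin.rev
  sig _ := P1.conj
  inv_inv := Fin.rev_rev
  inv_adj v w h := by
    simp only [SimpleGraph.starGraph_adj] at h ⊢
    revert v w
    decide
  sig_antiholomorphic _ := ⟨1, fun z => (one_smul _ _).symm⟩
  sig_sig _ := P1.conj_conj
  sig_dir v w h := by simp [pt]
  fixed := Or.inr ⟨0, 1, by simp, rfl⟩

/-- The components of the marked points of `conjMarking`. -/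
def conjComp {K : Type} [IsEmpty K] (b : Bool) : Mark K (Fin 2) → Fin 2
  | Sum.inl i => isEmptyElim i
  | Sum.inr (j, c) => if side b j c then 0 else 1

theorem conjComp_injective {K : Type} [IsEmpty K] {b : Bool} {j : Fin 2} {c d : Bool}
    (h : conjComp b (Sum.inr (j, c) : Mark K (Fin 2)) =
      conjComp b (Sum.inr (j, d) : Mark K (Fin 2))) : c = d := by
  change (if side b j c then (0 : Fin 2) else 1) = if side b j d then 0 else 1 at h
  revert b j c d; decide

/-- The marking with `z_1⁺` and the point of the second pair with sign `b` on one sphere and their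
conjugates on the other one. -/
def conjMarking (K : Type) [IsEmpty K] (b : Bool) : Marking conjTree K (Fin 2) where
  comp := conjComp b
  pos
    | Sum.inl i => isEmptyElim i
    | Sum.inr (j, _) => if j = 0 then pt (0, 1) else pt (1, 1)
  pos_inj := by
    rintro (i | ⟨i, c⟩) (j | ⟨j, d⟩) hc hp
    · exact isEmptyElim i
    · exact isEmptyElim i
    · exact isEmptyElim j
    · have hij : i = j := by
        fin_cases i <;> fin_cases j <;> simp [pt] at hp ⊢
      subst hij
      rw [conjComp_injective hc]
  pos_ne_node := by
    rintro (i | ⟨i, c⟩) w hw e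
    · exact isEmptyElim i
    · simp only [conjTree] at e
      split_ifs at e <;> simp [pt] at e
  stable v := by
    have hf := finite_special (fun w => conjTree.graph.Adj v w) (conjTree.dir v)
      (fun i : Mark K (Fin 2) => conjComp b i = v)
      (fun i => match i with
        | Sum.inl i => isEmptyElim i
        | Sum.inr (j, _) => if j = 0 then pt (0, 1) else pt (1, 1))
    have n1 : pt (1, 0) ≠ pt (0, 1) := by simp [pt]
    have n2 : pt (1, 0) ≠ pt (1, 1) := by simp [pt]
    have n3 : pt (0, 1) ≠ pt (1, 1) := by simp [pt]
    refine three_le_ncard hf (a := pt (1, 0)) (b := pt (0, 1)) (c := pt (1, 1)) ?_ ?_ ?_ n1 n2 n3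
    · change Fin 2 at v
      exact Or.inl ⟨(v + 1 : Fin 2), by simp only [conjTree, SimpleGraph.starGraph_adj]; omega, rfl⟩
    · change Fin 2 at v
      fin_cases v
      · exact Or.inr ⟨Sum.inr (0, true), rfl, rfl⟩
      · exact Or.inr ⟨Sum.inr (0, false), rfl, rfl⟩
    · change Fin 2 at v
      fin_cases v
      · exact Or.inr ⟨Sum.inr (1, b), by cases b <;> rfl, rfl⟩
      · exact Or.inr ⟨Sum.inr (1, !b), by cases b <;> rfl, rfl⟩
  comp_conj := by
    rintro (i | ⟨j, c⟩)
    · exact isEmptyElim i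
    · change (if side b j (!c) then (0 : Fin 2) else 1) = Fin.rev (if side b j c then 0 else 1)
      revert j b c; decide
  pos_conj := by
    have e1 : P1.conj (pt (0, 1)) = pt (0, 1) := by simp [pt]
    have e2 : P1.conj (pt (1, 1)) = pt (1, 1) := by simp [pt]
    rintro (i | ⟨j, c⟩)
    · exact isEmptyElim i
    · simp only [conjTree, Mark.conj]
      split_ifs
      · exact e1.symm
      · exact e2.symm

/-! ### Coordinates of the explicit curves -/

theorem isP_three (b : Bool) : IsP b (Moduli.mk threeTree (threeMarking b)) :=
  ⟨threeTree, threeMarking b, rfl, rfl, by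
    change threeComp b (Sum.inr (0, true)) = threeComp b (Sum.inr (1, b))
    revert b; decide⟩

/-- From the real component, $z_1^+$ and $z_1^-$ are seen at the nodes $0$ and $\infty$, and $z_2^+$
is seen at one or the other. -/
theorem hasCoord_three (b : Bool) :
    HasCoord (Moduli.mk threeTree (threeMarking b)) (if b then 0 else 1) := by
  have hx : (threeMarking b).seen (1 : Fin 3) (Sum.inl 0) = pt (1, 1) :=
    Marking.seen_of_comp_eq _ rfl
  have hz : ∀ j c, (threeMarking b).seen (1 : Fin 3) (Sum.inr (j, c)) =
      if side b j c then pt (0, 1) else pt (1, 0) := by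
    intro j c
    have hne : threeComp b (Sum.inr (j, c)) ≠ 1 := (threeComp_ne b 0 j c).symm
    refine (Marking.seen_of_comp_ne (threeMarking b) (v := (1 : Fin 3)) (i := Sum.inr (j, c)) hne).trans ?_
    change (if (1 : Fin 3) = 1 then (if threeComp b (Sum.inr (j, c)) = 0 then pt (0, 1)
      else pt (1, 0)) else pt (1, 0)) = _
    cases h : side b j c <;> simp [threeComp, h]
  rw [HasCoord, (threeMarking b).crossRatio_eq_pt_of_det (v := (1 : Fin 3)) (g := 1)
    (p := ![(0, 1), (1, 0), (1, 1), if b then (0, 1) else (1, 0)])]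
  · cases b <;> simp [cr, det2, pt]
  · intro k
    fin_cases k <;> cases b <;> simp
  · intro k
    rw [one_smul]
    fin_cases k
    · exact hz 0 true
    · exact hz 0 false
    · exact hx
    · refine (hz 1 true).trans ?_
      cases b <;> simp [side]
  · simp [det2]
  · simp [det2]
  · simp [det2]

theorem circleData_smooth {ξ ζ : ℂ} (hξ : ‖ξ‖ = 1) (h0 : ζ ≠ 0) (h1 : ‖ζ‖ ≠ 1) {K : Type}
    [Finite K] [Subsingleton K] : CircleData (fun _ : K => ξ) (![0, ζ] : Fin 2 → ℂ) where
  norm_x _ := hξ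
  inj_x := Function.injective_of_subsingleton _
  inj_z := by
    intro i j
    fin_cases i <;> fin_cases j <;> simp [h0, h0.symm]
  mul_conj_ne := by
    intro i j
    fin_cases i <;> fin_cases j <;> simp
    rw [Complex.mul_conj, Complex.normSq_eq_norm_sq]
    intro h
    have h' : ‖ζ‖ ^ 2 = 1 := by exact_mod_cast h
    exact h1 ((pow_eq_one_iff_of_nonneg (norm_nonneg _) (by norm_num)).1 h')
  card := by
    have : Nat.card (Mark K (Fin 2)) = Nat.card K + 4 := by
      rw [Nat.card_sum, Nat.card_prod]
      simp
    exact this ▸ by omega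

theorem isSmoothing_smooth {ζ : ℂ} (h0 : ζ ≠ 0) (h1 : ‖ζ‖ ≠ 1) :
    IsSmoothing true ζ (Moduli.mk sphereTree
      (circleMarking (circleData_smooth (K := Fin 1) (norm_one (α := ℂ)) h0 h1))) := by
  have hc : starRingEnd ℂ ζ ≠ 0 := by simpa using h0
  refine ⟨_, _, rfl, rfl, ?_, ?_, ?_, ?_, ?_⟩ <;>
    simp [circleMarking, circleVec, pt, hc]

theorem exists_isSmoothing (b : Bool) {ζ : ℂ} (h0 : ζ ≠ 0) (h1 : ‖ζ‖ ≠ 1) :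
    ∃ m, IsSmoothing b ζ m := by
  cases b
  · have h0' : (starRingEnd ℂ ζ)⁻¹ ≠ 0 := by simpa using h0
    have h1' : ‖(starRingEnd ℂ ζ)⁻¹‖ ≠ 1 := by
      rw [norm_inv, RCLike.norm_conj]
      simpa using h1
    obtain ⟨T, μ, -, hn, hx, hz, hz', hy, hy'⟩ := isSmoothing_smooth h0' h1'
    refine ⟨_, T, μ, rfl, hn, hx, hz, hz', ?_, hy⟩
    simpa using hy'
  · exact ⟨_, isSmoothing_smooth h0 h1⟩

/-! ### Rotating families and nodal curves in the second stratum -/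

theorem norm_exp_I (θ : ℝ) : ‖Complex.exp (θ * Complex.I)‖ = 1 :=
  Complex.norm_exp_ofReal_mul_I θ

theorem exists_rotation_smooth {ζ : ℂ} (h0 : ζ ≠ 0) (h1 : ‖ζ‖ ≠ 1) :
    ∃ m, IsRotation 0 0 m ∧ HasCoord (m 0) (ζ / (ζ - 1)) := by
  have hζ1 : ζ ≠ 1 := by rintro rfl; simp at h1
  refine ⟨fun θ => Moduli.mk sphereTree
    (circleMarking (circleData_smooth (K := Fin 1) (norm_exp_I θ) h0 h1)), ?_, ?_⟩
  · refine ⟨sphereTree, fun θ => circleMarking (circleData_smooth (norm_exp_I θ) h0 h1),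
      (0 : Fin 1), 1, Filter.Eventually.of_forall fun θ => ⟨rfl, rfl, ?_, rfl, rfl, ?_, ?_, ?_⟩⟩
    · rintro (j | ⟨j, _ | _⟩) hj
      · exact absurd (congrArg Sum.inl (Subsingleton.elim j 0)) hj
      · rfl
      · rfl
    · simp [circleMarking, circleVec, pt]
    · simp [circleMarking, circleVec, pt]
    · simp [circleMarking, circleVec, pt]
  · have h := (isSmoothing_smooth h0 h1).hasCoord h0 hζ1
    rw [if_pos rfl] at h
    convert h using 4
    simp

/-- The curve with two real components given by `twoMarking`. -/
def twoCurve {a ξ : ℂ} (ha : ‖a‖ = 1) (hξ : ‖ξ‖ = 1) (h : a ≠ ξ) : Moduli (Fin 1) (Fin 2) :=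
  Moduli.mk (twoTree a ha) (twoMarking ha hξ h)

theorem hasCoord_two {a ξ : ℂ} (ha : ‖a‖ = 1) (hξ : ‖ξ‖ = 1) (h : a ≠ ξ) :
    HasCoord (twoCurve ha hξ h) (a / (a - ξ)) := by
  have hξ0 : ξ ≠ 0 := by rintro rfl; simp at hξ
  rw [HasCoord, twoCurve, (twoMarking ha hξ h).crossRatio_eq_pt_of_det (v := (0 : Fin 2)) (g := 1)
    (p := ![(0, 1), (1, 0), (ξ, 1), (a, 1)])]
  · simp [cr, det2, pt, sub_ne_zero.2 h]
  · intro k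
    fin_cases k <;> simp
  · intro k
    rw [one_smul]
    fin_cases k
    · exact Marking.seen_of_comp_eq _ rfl
    · exact Marking.seen_of_comp_eq _ rfl
    · exact Marking.seen_of_comp_eq _ rfl
    · exact (Marking.seen_of_comp_ne _ (by
        change (1 : Fin 2) ≠ 0
        decide)).trans rfl
  · simp [det2]
  · simpa [det2] using hξ0
  · simp [det2]

theorem twoCurve_mem_stratum {a ξ : ℂ} (ha : ‖a‖ = 1) (hξ : ‖ξ‖ = 1) (h : a ≠ ξ) :
    twoCurve ha hξ h ∈ stratum Set.univ {0} := by
  refine ⟨_, _, rfl, rfl, fun _ => rfl, (0 : Fin 2), fun i => ?_, fun j b => ?_⟩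
  · exact ⟨fun _ => trivial, fun _ => rfl⟩
  · exact Iff.rfl

theorem neg_one_ne_exp : ∀ᶠ θ : ℝ in nhds 0, (-1 : ℂ) ≠ Complex.exp (θ * Complex.I) := by
  have : ContinuousAt (fun θ : ℝ => Complex.exp (θ * Complex.I)) 0 :=
    hasDerivAt_exp_I.continuousAt
  refine (this.eventually_ne (y := -1) ?_).mono fun θ h => h.symm
  simp
  norm_num

theorem norm_neg_one' : ‖(-1 : ℂ)‖ = 1 := by simp

theorem exists_rotation_two : ∃ m, IsRotation 0 0 m ∧ HasCoord (m 0) (1 / 2) := by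
  have h0 : (-1 : ℂ) ≠ Complex.exp ((0 : ℝ) * Complex.I) := neg_one_ne_exp.self_of_nhds
  classical
  -- The marking makes sense only while $x_1=e^{i\theta}$ differs from the node $-1$. The value
  -- elsewhere is immaterial, as a rotation is a condition near $\theta=0$.
  let μ : ℝ → Marking (twoTree (-1) norm_neg_one') (Fin 1) (Fin 2) := fun θ =>
    if h : (-1 : ℂ) ≠ Complex.exp (θ * Complex.I) then twoMarking norm_neg_one' (norm_exp_I θ) h
    else twoMarking norm_neg_one' (norm_exp_I 0) h0
  have hμ : ∀ θ : ℝ, ∀ h : (-1 : ℂ) ≠ Complex.exp (θ * Complex.I),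
      μ θ = twoMarking norm_neg_one' (norm_exp_I θ) h := fun θ h => dif_pos h
  refine ⟨fun θ => Moduli.mk _ (μ θ), ⟨_, μ, (0 : Fin 2), 1, ?_⟩, ?_⟩
  · filter_upwards [neg_one_ne_exp] with θ hθ
    rw [hμ θ hθ, hμ 0 h0]
    refine ⟨rfl, rfl, ?_, rfl, rfl, ?_, ?_, ?_⟩
    · rintro (j | ⟨j, _ | _⟩) hj
      · exact absurd (congrArg Sum.inl (Subsingleton.elim j 0)) hj
      · rfl
      · rfl
    · simp [twoMarking, pt]
    · simp [twoMarking, pt]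
    · simp [twoMarking, pt]
  · have := hasCoord_two norm_neg_one' (norm_exp_I 0) h0
    have e : (-1 : ℂ) / (-1 - Complex.exp ((0 : ℝ) * Complex.I)) = 1 / 2 := by
      simp
      norm_num
    rw [e] at this
    simp only [hμ 0 h0]
    exact this

/-! ### Gluing of the explicit curves -/

theorem circleData_first {a ξ : ℂ} (ha : ‖a‖ = 1) (hξ : ‖ξ‖ = 1) (h : a ≠ ξ) :
    CircleData (fun i : Option (Set.univ : Set (Fin 1)) => i.elim a fun _ => ξ)
      (fun _ : ({0} : Set (Fin 2)) => 0) where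
  norm_x := by rintro (_ | i) <;> simp [ha, hξ]
  inj_x := by
    rintro (_ | i) (_ | j) e
    · rfl
    · exact absurd e h
    · exact absurd e.symm h
    · rw [Subsingleton.elim i j]
  inj_z := Function.injective_of_subsingleton _
  mul_conj_ne := by simp
  card := by
    rw [Nat.card_sum, Nat.card_prod]
    simp

theorem circleData_second : CircleData (fun _ : Option ↥((Set.univ : Set (Fin 1))ᶜ) => (1 : ℂ))
    (fun _ : ↥(({0} : Set (Fin 2))ᶜ) => 0) where
  norm_x := by simp
  inj_x := by
    have : IsEmpty ↥((Set.univ : Set (Fin 1))ᶜ) := ⟨fun x => x.2 trivial⟩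
    exact Function.injective_of_subsingleton _
  inj_z := by
    rintro ⟨i, hi⟩ ⟨j, hj⟩ -
    simp at hi hj
    ext
    simp only
    omega
  mul_conj_ne := by simp
  card := by
    have h1 : Nat.card ↥((Set.univ : Set (Fin 1))ᶜ) = 0 := by simp
    have h2 : Nat.card ↥(({0} : Set (Fin 2))ᶜ) = 1 := by
      rw [Nat.card_coe_set_eq, Set.ncard_compl, Nat.card_fin, Set.ncard_singleton]
    rw [Nat.card_sum, Nat.card_prod, h2, Finite.card_option, h1]
    simp

theorem glue_two {a ξ : ℂ} (ha : ‖a‖ = 1) (hξ : ‖ξ‖ = 1) (h : a ≠ ξ) :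
    Glue Set.univ {0} (Moduli.mk sphereTree (circleMarking (circleData_first ha hξ h)))
      (Moduli.mk sphereTree (circleMarking circleData_second)) (twoCurve ha hξ h) := by
  refine ⟨_, _, _, _, _, _, rfl, rfl, rfl, (finSumFinEquiv : Fin 1 ⊕ Fin 1 ≃ Fin 2), ?_, ?_, ?_,
    ?_, ?_, rfl, rfl, fun _ => rfl, fun _ => rfl, fun _ => rfl, fun _ => rfl, ?_, ?_, ?_, ?_⟩
  · intro v w
    rw [Subsingleton.elim (α := Fin 1) v w]
    exact ⟨fun h => absurd rfl h.ne, fun h => absurd rfl h.ne⟩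
  · intro v w
    rw [Subsingleton.elim (α := Fin 1) v w]
    exact ⟨fun h => absurd rfl h.ne, fun h => absurd rfl h.ne⟩
  · intro v w
    rw [Subsingleton.elim (α := Fin 1) v (0 : Fin 1), Subsingleton.elim (α := Fin 1) w (0 : Fin 1)]
    refine ⟨fun _ => ⟨rfl, rfl⟩, fun _ => ?_⟩
    change (SimpleGraph.starGraph (0 : Fin 2)).Adj 0 1
    simp
  · exact fun v w h => absurd h (sphereTree_not_adj v w)
  · exact fun v w h => absurd h (sphereTree_not_adj v w)
  · exact fun i => ⟨rfl, rfl⟩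
  · rintro ⟨j, rfl⟩ b
    refine ⟨rfl, ?_⟩
    cases b <;> simp [twoMarking, circleMarking, circleVec]
  · exact fun i => absurd trivial i.2
  · rintro ⟨j, hj⟩ b
    have hj' : j ≠ 0 := hj
    obtain rfl : j = 1 := by omega
    refine ⟨rfl, ?_⟩
    cases b <;> simp [twoMarking, circleMarking, circleVec]

theorem exists_rotation_node :
    ∃ (m₁ : ℝ → Moduli (Option (Set.univ : Set (Fin 1))) ({0} : Set (Fin 2)))
    (m : ℝ → Moduli (Fin 1) (Fin 2)), IsRotation ⟨0, rfl⟩ none m₁ ∧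
    (∀ᶠ θ in nhds (0 : ℝ), Glue Set.univ {0} (m₁ θ)
      (Moduli.mk sphereTree (circleMarking circleData_second)) (m θ)) ∧
    (∀ θ, m θ ∈ stratum Set.univ {0}) ∧ HasCoord (m 0) (1 / 2) := by
  have h0 : Complex.exp ((0 : ℝ) * Complex.I) ≠ -1 := neg_one_ne_exp.self_of_nhds.symm
  classical
  let μ : ℝ → Marking sphereTree (Option (Set.univ : Set (Fin 1))) ({0} : Set (Fin 2)) := fun θ =>
    if h : Complex.exp (θ * Complex.I) ≠ -1 then
      circleMarking (circleData_first (norm_exp_I θ) norm_neg_one' h)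
    else circleMarking (circleData_first (norm_exp_I 0) norm_neg_one' h0)
  have hμ : ∀ θ : ℝ, ∀ h : Complex.exp (θ * Complex.I) ≠ -1,
      μ θ = circleMarking (circleData_first (norm_exp_I θ) norm_neg_one' h) :=
    fun θ h => dif_pos h
  let m : ℝ → Moduli (Fin 1) (Fin 2) := fun θ =>
    if h : Complex.exp (θ * Complex.I) ≠ -1 then twoCurve (norm_exp_I θ) norm_neg_one' h
    else twoCurve (norm_exp_I 0) norm_neg_one' h0
  have hm : ∀ θ : ℝ, ∀ h : Complex.exp (θ * Complex.I) ≠ -1,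
      m θ = twoCurve (norm_exp_I θ) norm_neg_one' h := fun θ h => dif_pos h
  refine ⟨fun θ => Moduli.mk _ (μ θ), m, ⟨_, μ, (0 : Fin 1), 1, ?_⟩, ?_, ?_, ?_⟩
  · filter_upwards [neg_one_ne_exp] with θ hθ
    rw [hμ θ hθ.symm, hμ 0 h0]
    refine ⟨rfl, rfl, ?_, rfl, rfl, ?_, ?_, ?_⟩
    · rintro ((_ | j) | ⟨j, _ | _⟩) hj
      · exact absurd rfl hj
      · rfl
      · rfl
      · rfl
    · simp [circleMarking, circleVec, pt]
    · simp [circleMarking, circleVec, pt]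
    · simp [circleMarking, circleVec, pt]
  · filter_upwards [neg_one_ne_exp] with θ hθ
    rw [hμ θ hθ.symm, hm θ hθ.symm]
    exact glue_two _ _ _
  · intro θ
    by_cases h : Complex.exp (θ * Complex.I) ≠ -1
    · rw [hm θ h]
      exact twoCurve_mem_stratum _ _ _
    · simp only [m, dif_neg h]
      exact twoCurve_mem_stratum _ _ _
  · rw [hm 0 h0]
    convert hasCoord_two (norm_exp_I 0) norm_neg_one' h0 using 1
    simp
    norm_num

/-! ### Classification of curves -/

/-- The curve `C` has components indexed by `Fin k` with adjacency relation `A`, all of them real,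
and, in suitable coordinates on its components, its marked points are at `P` on the components `c`
and its nodes on the component `a` are at `Q a`. -/
def NormalForm {K L : Type} {k : ℕ} (A : Fin k → Fin k → Prop) (c : Mark K L → Fin k)
    (P : Mark K L → P1) (Q : Fin k → P1) (C : Curve K L) : Prop :=
  ∃ (e : Fin k ≃ Fin C.1.n) (g : Fin k → GL (Fin 2) ℂ),
    (∀ a b, C.1.graph.Adj (e a) (e b) ↔ A a b) ∧ (∀ a, C.1.inv (e a) = e a) ∧
    (∀ i, C.2.comp i = e (c i)) ∧ (∀ i, g (c i) • C.2.pos i = P i) ∧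
    ∀ a b, A a b → g a • C.1.dir (e a) (e b) = Q a

theorem NormalForm.iso {K L : Type} {k : ℕ} {A : Fin k → Fin k → Prop} {c : Mark K L → Fin k}
    {P : Mark K L → P1} {Q : Fin k → P1} {C D : Curve K L} (hC : NormalForm A c P Q C)
    (hD : NormalForm A c P Q D) : Iso C D := by
  obtain ⟨e, g, h1, h2, h3, h4, h5⟩ := hC
  obtain ⟨e', g', h1', h2', h3', h4', h5'⟩ := hD
  have hadj : ∀ v w, C.1.graph.Adj v w ↔ A (e.symm v) (e.symm w) := by
    intro v w
    rw [← h1, e.apply_symm_apply, e.apply_symm_apply]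
  refine iso_of_marked (e.symm.trans e') (fun v => (g' (e.symm v))⁻¹ * g (e.symm v)) ?_ ?_ ?_ ?_ ?_
  · intro v w
    simp only [Equiv.trans_apply]
    rw [h1', hadj]
  · intro v w hvw
    have := h5 _ _ ((hadj v w).1 hvw)
    rw [e.apply_symm_apply, e.apply_symm_apply] at this
    rw [mul_smul, this, eq_inv_smul_iff]
    exact h5' _ _ ((hadj v w).1 hvw)
  · intro v
    have := h2 (e.symm v)
    rw [e.apply_symm_apply] at this
    simp only [Equiv.trans_apply]
    rw [h2', this]
  · intro i
    simp only [Equiv.trans_apply]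
    rw [h3', h3, e.symm_apply_apply]
  · intro i
    rw [h3, e.symm_apply_apply, mul_smul, h4, eq_inv_smul_iff, h4']

/-- A component on which all marked points are seen at distinct positions is the only one. -/
theorem Marking.eq_of_seen_injective {T : RealTree} {K L : Type} (μ : Marking T K L) {v : Fin T.n}
    (h : Function.Injective (μ.seen v)) (u : Fin T.n) : u = v := by
  have hadj : ∀ w, ¬ T.graph.Adj v w := by
    intro w hw
    obtain ⟨i, j, hij, hi, hj⟩ := μ.exists_two_marks hw
    exact hij (h (hi.trans hj.symm))
  exact RealTree.forall_of_adj (P := fun a => a = v) rfl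
    (fun a b ha hab => absurd (ha ▸ hab) (hadj b)) u

/-- All curves with one real point and one conjugate pair are isomorphic. -/
theorem iso_of_three_marks {K L : Type} [Unique K] [Unique L] (C D : Curve K L) : Iso C D := by
  have key : ∀ C : Curve K L, NormalForm (k := 1) (fun _ _ => False) (fun _ => 0)
      (fun i => match i with
        | Sum.inl _ => OnePoint.infty
        | Sum.inr (_, true) => ((0 : ℂ) : P1)
        | Sum.inr (_, false) => ((1 : ℂ) : P1)) (fun _ => OnePoint.infty) C := by
    rintro ⟨T, μ⟩
    obtain ⟨v, hv⟩ := μ.exists_separates (i := Sum.inr (default, true))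
      (j := Sum.inr (default, false)) (k := Sum.inl default) (by simp) (by simp) (by simp)
    obtain ⟨g, h0, h1, h2⟩ := hv.exists_smul
    obtain ⟨n1, n2, n3⟩ := hv
    have hinj : Function.Injective (μ.seen v) := by
      rintro (i | ⟨i, _ | _⟩) (j | ⟨j, _ | _⟩) e <;>
        rw [Unique.eq_default i, Unique.eq_default j] at e ⊢ <;>
        first
        | exact absurd e n1
        | exact absurd e.symm n1
        | exact absurd e n2
        | exact absurd e.symm n2
        | exact absurd e n3
        | exact absurd e.symm n3
    have huniq := μ.eq_of_seen_injective hinj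
    have hpos : ∀ i, μ.seen v i = μ.pos i := fun i => μ.seen_of_comp_eq (huniq _)
    let e : Fin 1 ≃ Fin T.n := ⟨fun _ => v, fun _ => 0, fun _ => Subsingleton.elim _ _,
      fun u => (huniq u).symm⟩
    refine ⟨e, fun _ => g, fun a b => ⟨fun h => h.ne rfl, False.elim⟩, fun _ => huniq _,
      fun i => huniq _, ?_, fun _ _ h => h.elim⟩
    rintro (i | ⟨i, _ | _⟩) <;> rw [Unique.eq_default i, ← hpos]
    · exact h2
    · exact h1
    · exact h0
  exact (key C).iso (key D)

theorem RealTree.eq_or_eq_of_adj {T : RealTree} {v w : Fin T.n}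
    (hv : ∀ u, T.graph.Adj v u → u = w) (hw : ∀ u, T.graph.Adj w u → u = v) (u : Fin T.n) :
    u = v ∨ u = w := by
  refine RealTree.forall_of_adj (P := fun a => a = v ∨ a = w) (Or.inl rfl) ?_ u
  rintro a b (rfl | rfl) hab
  · exact Or.inr (hv b hab)
  · exact Or.inl (hw b hab)

/-- The curve with coordinate `1 / 2` is unique. -/
theorem HasCoord.eq_of_half {m m' : Moduli (Fin 1) (Fin 2)} (h : HasCoord m (1 / 2))
    (h' : HasCoord m' (1 / 2)) : m = m' := by
  have key : ∀ (T : RealTree) (μ : Marking T (Fin 1) (Fin 2)),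
      HasCoord (Moduli.mk T μ) (1 / 2) → NormalForm (k := 2) (fun a b => a ≠ b)
        (fun i => match i with
          | Sum.inl _ => 0
          | Sum.inr (j, _) => j)
        (fun i => match i with
          | Sum.inl _ => OnePoint.infty
          | Sum.inr (_, true) => ((0 : ℂ) : P1)
          | Sum.inr (_, false) => ((1 : ℂ) : P1))
        (fun a => if a = 0 then ((1 / 2 : ℂ) : P1) else OnePoint.infty) ⟨T, μ⟩ := by
    intro T μ hμ
    obtain ⟨v, g, hinv, hg⟩ := exists_position μ hμ
    have hx : g • μ.seen v (Sum.inl 0) = OnePoint.infty := by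
      rw [hg]; simp [position, pt]
    have hz : g • μ.seen v (Sum.inr (0, true)) = ((0 : ℂ) : P1) := by
      rw [hg]; simp [position, pt]
    have hz' : g • μ.seen v (Sum.inr (0, false)) = ((1 : ℂ) : P1) := by
      rw [hg]; simp [position, pt]
    have hy : g • μ.seen v (Sum.inr (1, true)) = ((1 / 2 : ℂ) : P1) := by
      rw [hg]; simp [position, pt]
    have hy' : g • μ.seen v (Sum.inr (1, false)) = ((1 / 2 : ℂ) : P1) := by
      rw [hg]
      simp only [position, pt, map_div₀, map_one, map_ofNat]
      norm_num
    have ne_iff : ∀ i j, μ.seen v i ≠ μ.seen v j ↔ g • μ.seen v i ≠ g • μ.seen v j :=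
      fun i j => (MulAction.injective g).ne_iff.symm
    have h12 : (2 : ℂ)⁻¹ ≠ 0 := by norm_num
    have h12' : (2 : ℂ)⁻¹ ≠ 1 := by norm_num
    -- The points $x_1,z_1^\pm$ are each seen alone, so they lie on `v`. The points $z_2^\pm$ are
    -- both seen at $1/2$, so they lie beyond one node, and stability leaves exactly one component
    -- there.
    have cx : μ.comp (Sum.inl 0) = v := by
      refine μ.comp_eq_of_seen_ne fun j hj => ?_
      rw [ne_iff, hx]
      rcases j with j | ⟨j, _ | _⟩
      · exact absurd (congrArg Sum.inl (Subsingleton.elim j 0)) hj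
      · fin_cases j <;> simp [hz', hy']
      · fin_cases j <;> simp [hz, hy]
    have cz : μ.comp (Sum.inr (0, true)) = v := by
      refine μ.comp_eq_of_seen_ne fun j hj => ?_
      rw [ne_iff, hz]
      rcases j with j | ⟨j, _ | _⟩
      · rw [Subsingleton.elim j 0, hx]
        simp
      · fin_cases j <;> simp [hz', hy']
      · fin_cases j
        · exact absurd rfl hj
        · simp [hy]
    have cz' : μ.comp (Sum.inr (0, false)) = v := by
      rw [← hinv, ← cz, ← μ.comp_conj]
      rfl
    obtain ⟨w, hw, hyw⟩ := μ.exists_adj_of_seen_eq (v := v) (i := Sum.inr (1, true))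
      (j := Sum.inr (1, false)) (by simp) ((MulAction.injective g) (hy.trans hy'.symm))
    have hyw' : μ.seen v (Sum.inr (1, false)) = T.dir v w := by
      rw [← hyw]; exact (MulAction.injective g) (hy'.trans hy.symm)
    have cy := μ.comp_ne_of_seen_eq_dir hw hyw
    have cy' := μ.comp_ne_of_seen_eq_dir hw hyw'
    have only : ∀ i, μ.comp i ≠ v → i = Sum.inr (1, true) ∨ i = Sum.inr (1, false) := by
      rintro (j | ⟨j, _ | _⟩) hi
      · exact absurd (Subsingleton.elim j 0 ▸ cx) hi
      · fin_cases j
        · exact absurd cz' hi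
        · exact Or.inr rfl
      · fin_cases j
        · exact absurd cz hi
        · exact Or.inl rfl
    have hnw : ∀ u, T.graph.Adj w u → u = v := fun u hu =>
      μ.eq_of_adj_of_two_marks hw (fun i hi => only i (μ.comp_ne_of_seen_eq_dir hw hi)) hu
    have hnv : ∀ u, T.graph.Adj v u → u = w := by
      intro u hu
      obtain ⟨i, -, -, hi, -⟩ := μ.exists_two_marks hu
      refine T.dir_inj v u w hu hw (hi.symm.trans ?_)
      rcases only i (μ.comp_ne_of_seen_eq_dir hu hi) with rfl | rfl
      · exact hyw
      · exact hyw'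
    have hall := RealTree.eq_or_eq_of_adj hnv hnw
    have cy2 := (hall _).resolve_left cy
    have cy2' := (hall _).resolve_left cy'
    have hinvw : T.inv w = w := by
      refine (hall _).resolve_left fun h => hw.ne' ?_
      rw [← T.inv_inv w, h, hinv]
    have nd : ∀ i, μ.comp i = w → μ.pos i ≠ T.dir w v := by
      rintro i rfl
      exact μ.pos_ne_node i v hw.symm
    -- The second component carries only $z_2^+$, $z_2^-$ and the node, so normalizing these leaves
    -- no parameter.
    obtain ⟨k, k0, k1, k2⟩ := exists_gl_zero_one_infty
      (a := μ.pos (Sum.inr (1, true))) (b := μ.pos (Sum.inr (1, false))) (c := T.dir w v)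
      (fun e => by simpa using μ.pos_inj _ _ (cy2.trans cy2'.symm) e) (nd _ cy2) (nd _ cy2')
    have hb : Function.Bijective (![v, w] : Fin 2 → Fin T.n) := by
      constructor
      · intro a b hab
        fin_cases a <;> fin_cases b <;> simp [hw.ne, hw.ne'] at hab ⊢
      · intro u
        rcases hall u with rfl | rfl
        · exact ⟨0, rfl⟩
        · exact ⟨1, rfl⟩
    rw [μ.seen_of_comp_eq cx] at hx
    rw [μ.seen_of_comp_eq cz] at hz
    rw [μ.seen_of_comp_eq cz'] at hz'
    rw [hyw] at hy
    refine ⟨Equiv.ofBijective _ hb, ![g, k], ?_, ?_, ?_, ?_, ?_⟩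
    · intro a b
      fin_cases a <;> fin_cases b <;> simp [hw, hw.symm]
    · intro a
      fin_cases a
      · exact hinv
      · exact hinvw
    · rintro (j | ⟨j, b⟩)
      · rw [Subsingleton.elim j 0, cx]; rfl
      · fin_cases j <;> cases b
        · exact cz'
        · exact cz
        · exact cy2'
        · exact cy2
    · rintro (j | ⟨j, b⟩)
      · rw [Subsingleton.elim j 0]; exact hx
      · fin_cases j <;> cases b
        · exact hz'
        · exact hz
        · exact k1
        · exact k0
    · intro a b hab
      fin_cases a <;> fin_cases b
      · exact absurd rfl hab
      · simpa using hy
      · simpa using k2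
      · exact absurd rfl hab
  obtain ⟨T, μ, rfl⟩ := m.exists_mk
  obtain ⟨T', μ', rfl⟩ := m'.exists_mk
  exact Quotient.sound ((key T μ h).iso (key T' μ' h'))

/-! ### The moduli space of curves with two conjugate pairs -/

/-- A real component carries a fixed point of the involution. -/
theorem RealTree.exists_fixed {T : RealTree} {v : Fin T.n} (hv : T.inv v = v) :
    ∃ z, T.sig v z = z := by
  rcases T.fixed with ⟨u, z, hu, hz⟩ | ⟨a, b, hab, h⟩
  · by_cases huv : u = v
    · subst huv
      exact ⟨z, hz⟩
    · refine ⟨T.dir v u, ?_⟩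
      rw [RealTree.sig_dir_of_ne huv, hv, hu]
  · have ha : a ≠ v := by
      rintro rfl
      exact hab.ne (hv.symm.trans h)
    have hb : b ≠ v := by
      rintro rfl
      apply ha
      rw [← T.inv_inv a, h, hv]
    refine ⟨T.dir v a, ?_⟩
    rw [RealTree.sig_dir_of_ne ha, hv, h]
    exact (T.dir_branch _ _ _ hab ha hb).symm

/-- One point of each conjugate pair is seen from `v` towards its conjugate component, and the other
two are separate. Both branches being that small, the curve has just two components, which the
involution exchanges. -/
theorem mem_boundary_of_inv_ne {K : Type} [IsEmpty K] {T : RealTree} (μ : Marking T K (Fin 2))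
    {v : Fin T.n} (hs : μ.Separates v (Sum.inr (0, true)) (Sum.inr (1, true)) (Sum.inr (0, false)))
    (hv : T.inv v ≠ v) (u : Fin T.n) : T.inv u ≠ u := by
  obtain ⟨n1, n2, n3⟩ := hs
  have key : ∀ i, μ.seen v i = T.dir v (T.inv v) ∨
      μ.seen v (Mark.conj i) = T.dir v (T.inv v) := by
    intro i
    by_contra! h
    obtain ⟨h1, h2⟩ := h
    have e := μ.seen_of_seen_ne hv.symm h2
    have e' := μ.seen_conj v i
    rw [e] at e'
    refine h1 (Marking.sig_injective v ?_)
    rw [← e', RealTree.sig_dir_of_ne hv, T.inv_inv]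
  have h0 := key (Sum.inr (0, true))
  have h1 := key (Sum.inr (1, true))
  simp only [Mark.conj, Bool.not_true] at h0 h1
  obtain ⟨w, hw, hd⟩ := RealTree.exists_adj_dir hv
  rw [hd] at h0 h1
  have hy : μ.seen v (Sum.inr (1, false)) = T.dir v w := by grind
  have hy' : μ.seen v (Sum.inr (1, true)) ≠ T.dir v w := by grind
  have hex : ∃ c, μ.seen v (Sum.inr (0, c)) = T.dir v w ∧
      μ.seen v (Sum.inr (0, !c)) ≠ T.dir v w ∧
      μ.seen v (Sum.inr (0, !c)) ≠ μ.seen v (Sum.inr (1, true)) := by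
    rcases h0 with h0 | h0
    · exact ⟨true, h0, fun e => n2 (h0.trans e.symm), n3.symm⟩
    · exact ⟨false, h0, fun e => n2 (e.trans h0.symm), n1⟩
  obtain ⟨c, hc, hc', hc''⟩ := hex
  have marks : ∀ i : Mark K (Fin 2), i = Sum.inr (0, c) ∨ i = Sum.inr (0, !c) ∨
      i = Sum.inr (1, true) ∨ i = Sum.inr (1, false) := by
    rintro (i | ⟨j, d⟩)
    · exact isEmptyElim i
    · fin_cases j <;> cases c <;> cases d <;> simp
  have hnw : ∀ x, T.graph.Adj w x → x = v := fun x hx =>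
    μ.eq_of_adj_of_two_marks hw (a := Sum.inr (0, c)) (b := Sum.inr (1, false)) (fun i hi => by
      rcases marks i with rfl | rfl | rfl | rfl
      · exact Or.inl rfl
      · exact absurd hi hc'
      · exact absurd hi hy'
      · exact Or.inr rfl) hx
  have hnv : ∀ x, T.graph.Adj v x → x = w := by
    intro x hx
    by_contra hxw
    have hne := RealTree.dir_ne_of_adj hx hw hxw
    obtain ⟨i, j, hij, hi, hj⟩ := μ.exists_two_marks hx
    have two : ∀ i, μ.seen v i = T.dir v x → i = Sum.inr (0, !c) ∨ i = Sum.inr (1, true) := by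
      intro i hi
      rcases marks i with rfl | rfl | rfl | rfl
      · exact absurd (hi.symm.trans hc) hne
      · exact Or.inl rfl
      · exact Or.inr rfl
      · exact absurd (hi.symm.trans hy) hne
    rcases two i hi with rfl | rfl <;> rcases two j hj with rfl | rfl
    · exact hij rfl
    · exact hc'' (hi.trans hj.symm)
    · exact hc'' (hj.trans hi.symm)
    · exact hij rfl
  have hall := RealTree.eq_or_eq_of_adj hnv hnw
  have hvw : T.inv v = w := (hall _).resolve_left hv
  rcases hall u with rfl | rfl
  · exact hv
  · rw [← hvw, T.inv_inv]
    exact hv.symm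

/-- A curve with two conjugate pairs which does not lie on the boundary can be put into normalized
position with a real coordinate between `0` and `1`. -/
theorem exists_position_of_notMem_boundary {K : Type} [IsEmpty K] {T : RealTree}
    (μ : Marking T K (Fin 2)) (h : Moduli.mk T μ ∉ boundary K (Fin 2)) :
    ∃ t : ℝ, 0 < t ∧ t < 1 ∧ ∃ (v : Fin T.n) (g : GL (Fin 2) ℂ),
      ∀ i, g • μ.seen v i = pt (position t i) := by
  obtain ⟨v, hs⟩ := μ.exists_separates (i := Sum.inr (0, true)) (j := Sum.inr (1, true))
    (k := Sum.inr (0, false)) (by simp) (by simp) (by simp)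
  have hv : T.inv v = v := by
    by_contra hv
    exact h ⟨T, μ, rfl, mem_boundary_of_inv_ne μ hs hv⟩
  obtain ⟨g, h0, h1, h2⟩ := hs.exists_smul
  have sc : ∀ i, μ.seen v (Mark.conj i) = T.sig v (μ.seen v i) := by
    intro i
    have := μ.seen_conj v i
    rwa [hv] at this
  have hA := (T.isAnti_sig v).smul g g⁻¹
  have hAi : ∀ i, g • T.sig v (g⁻¹ • g • μ.seen v i) = g • μ.seen v (Mark.conj i) := by
    intro i
    rw [inv_smul_smul, sc]
  have a0 := hAi (Sum.inr (0, true))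
  have a1 := hAi (Sum.inr (1, true))
  have a2 := hAi (Sum.inr (0, false))
  simp only [Mark.conj, Bool.not_true, Bool.not_false] at a0 a1 a2
  rw [h0, h2] at a0
  rw [h1] at a1
  rw [h2, h0] at a2
  have inj : Function.Injective fun z => g • T.sig v (g⁻¹ • z) :=
    (MulAction.injective g).comp ((Marking.sig_injective v).comp (MulAction.injective g⁻¹))
  have hr1 : g • μ.seen v (Sum.inr (1, false)) ≠ OnePoint.infty := by
    intro e
    have := inj (a1.trans (e.trans a0.symm))
    simp at this
  have hr2 : g • μ.seen v (Sum.inr (1, false)) ≠ ((0 : ℂ) : P1) := by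
    intro e
    have := inj (a1.trans (e.trans a2.symm))
    simp at this
  obtain ⟨r, hr⟩ := OnePoint.ne_infty_iff_exists.1 hr1
  have hr0 : r ≠ 0 := by
    rintro rfl
    exact hr2 hr.symm
  -- The involution exchanges $0$ and $\infty$ and sends $1$ to $r$, so it is $z\mapsto r/\bar z$.
  obtain ⟨k, hk⟩ := exists_anti_div hr0
  have hkey : ∀ z, g • T.sig v (g⁻¹ • z) = k • P1.conj z := by
    refine hA.eq_of_three (t := fun z => k • P1.conj z) ⟨k, fun _ => rfl⟩
      (a := ((0 : ℂ) : P1)) (b := ((1 : ℂ) : P1)) (c := OnePoint.infty)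
      (by simp) (OnePoint.coe_ne_infty _) (OnePoint.coe_ne_infty _) ?_ ?_ ?_
    · have := hk (0, 1) (by simp)
      rw [pt_coe] at this
      rw [a0, this]
      simp [pt]
    · have := hk (1, 1) (by simp)
      rw [pt_coe] at this
      rw [a1, this, ← hr]
      simp [pt]
    · have := hk (1, 0) (by simp)
      rw [pt_infty] at this
      rw [a2, this]
      simp [pt]
  obtain ⟨z, hz⟩ := RealTree.exists_fixed hv
  obtain ⟨p, hp, hpz⟩ := exists_pt (g • z)
  have hfix := hkey (g • z)
  rw [inv_smul_smul, hz, ← hpz, hk p hp, eq_comm, pt_eq_iff _ hp] at hfix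
  swap
  · intro e
    rw [Prod.mk_eq_zero, mul_eq_zero, map_eq_zero, map_eq_zero] at e
    exact hp (Prod.ext e.2 (e.1.resolve_left hr0))
  -- The fixed point makes $r$ a positive real number. This is where the non-empty fixed locus
  -- enters: for $r<0$ there is no fixed point.
  have hfix' : r * (Complex.normSq p.2 : ℝ) = (Complex.normSq p.1 : ℝ) := by
    rw [← Complex.mul_conj, ← Complex.mul_conj]
    simp only [det2] at hfix
    linear_combination hfix
  have hp2 : Complex.normSq p.2 ≠ 0 := by
    intro e
    rw [e, Complex.ofReal_zero, mul_zero, eq_comm, Complex.ofReal_eq_zero] at hfix'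
    exact hp (Prod.ext (Complex.normSq_eq_zero.1 hfix') (Complex.normSq_eq_zero.1 e))
  set s : ℝ := Complex.normSq p.1 / Complex.normSq p.2 with hs_def
  have hrs : r = (s : ℂ) := by
    rw [hs_def, Complex.ofReal_div, eq_div_iff (by exact_mod_cast hp2), hfix']
  have hs0 : 0 < s := by
    refine lt_of_le_of_ne (div_nonneg (Complex.normSq_nonneg _) (Complex.normSq_nonneg _)) ?_
    intro e
    rw [← e] at hrs
    exact hr0 (by simpa using hrs)
  set β : ℝ := Real.sqrt s with hβ_def
  have hβ : 0 < β := Real.sqrt_pos.2 hs0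
  have hβs : β ^ 2 = s := Real.sq_sqrt hs0.le
  have hβc : (β : ℂ) ≠ 0 := by exact_mod_cast hβ.ne'
  have hβ1 : (1 + β : ℂ) ≠ 0 := by exact_mod_cast (by positivity : (1 + β : ℝ) ≠ 0)
  -- The map $z\mapsto z/(z+\beta)$ sends the point $-\beta$ of the fixed circle to $\infty$, and
  -- $0,\infty,1,\beta^2$ to $0,1,1/(1+\beta),\beta/(1+\beta)$. Using $-\beta$ rather than $\beta$
  -- puts the coordinate between $0$ and $1$.
  obtain ⟨G, hG⟩ := exists_gl_of_det_ne_zero (a := 1) (b := 0) (c := 1) (d := (β : ℂ))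
    (by simpa using hβ.ne')
  refine ⟨1 / (1 + β), by positivity, ?_, v, G * g, ?_⟩
  · rw [div_lt_one (by positivity)]
    linarith
  · rintro (i | ⟨j, c⟩)
    · exact isEmptyElim i
    · rw [mul_smul]
      fin_cases j <;> cases c
      · change G • g • μ.seen v (Sum.inr (0, false)) = pt (1, 1)
        rw [h2, ← pt_infty 1, hG _ (by simp)]
        simp
      · change G • g • μ.seen v (Sum.inr (0, true)) = pt (0, 1)
        rw [h0, ← pt_coe, hG _ (by simp)]
        simp [pt, hβc]
      · change G • g • μ.seen v (Sum.inr (1, false)) = pt (1 - starRingEnd ℂ ((1 / (1 + β) : ℝ) : ℂ), 1)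
        rw [← hr, hrs, ← pt_coe, hG _ (by simp), Complex.conj_ofReal, pt_eq_iff _ (by simp)]
        · simp only [det2]
          rw [← hβs]
          push_cast
          field_simp
          ring
        · intro e
          have := congrArg Prod.fst e
          simp at this
          exact hs0.ne' this
      · change G • g • μ.seen v (Sum.inr (1, true)) = pt (((1 / (1 + β) : ℝ) : ℂ), 1)
        rw [h1, ← pt_coe, hG _ (by simp), pt_eq_iff _ (by simp)]
        · simp only [det2]
          push_cast
          field_simp
          ring
        · simp

/-! ### The forgetful morphism -/

instance : IsEmpty {j : Fin 1 // j ≠ 0} := ⟨fun j => j.2 (Subsingleton.elim _ _)⟩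

theorem chartCr_lift (w : ℂ) (q : Fin 4 ↪ Mark {j : Fin 1 // j ≠ 0} (Fin 2)) :
    chartCr w (q.trans (Mark.lift 0)) = chartCr w q := by
  have : ∀ i : Mark {j : Fin 1 // j ≠ 0} (Fin 2),
      position w (Mark.lift 0 i) = position w i := by
    rintro (i | i) <;> rfl
  simp [chartCr, this]

theorem isForget_of_position {m : Moduli (Fin 1) (Fin 2)} {w : ℂ} (hm : HasCoord m w)
    {T : RealTree} (μ : Marking T {j : Fin 1 // j ≠ 0} (Fin 2)) {v : Fin T.n} {g : GL (Fin 2) ℂ}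
    (h : ∀ i, g • μ.seen v i = pt (position w i)) : IsForget 0 m (Moduli.mk T μ) := by
  intro q
  rw [crossRatio_of_position μ h, hm.crossRatio, chartCr_lift]

/-- The marked points `z_1⁺`, `z_2⁺`, `z_1⁻`, `z_2⁻`. -/
def pairMarks (K : Type) : Fin 4 ↪ Mark K (Fin 2) :=
  ⟨![Sum.inr (0, true), Sum.inr (1, true), Sum.inr (0, false), Sum.inr (1, false)], by
    intro i j h
    fin_cases i <;> fin_cases j <;> simp at h ⊢⟩

/-- The cross-ratio of $z_1^+,z_2^+,z_1^-,z_2^-$ at $0,t,1,1-t$ is $((1-t)/t)^2$, and nonnegativity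
of $t$ and $1-t$ permits taking square roots. -/
theorem coord_unique_of_isForget {m m' : Moduli (Fin 1) (Fin 2)}
    {y : Moduli {j : Fin 1 // j ≠ 0} (Fin 2)} {t t' : ℝ} (hm : HasCoord m t)
    (hm' : HasCoord m' t') (ht : t ∈ Set.Icc (0 : ℝ) 1) (ht' : t' ∈ Set.Icc (0 : ℝ) 1)
    (h : IsForget 0 m y) (h' : IsForget 0 m' y) : t = t' := by
  have e := (h (pairMarks _)).symm.trans (h' (pairMarks _))
  rw [hm.crossRatio, hm'.crossRatio, chartCr_lift, chartCr_lift,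
    pt_eq_iff (chartCr_ne_zero _ _) (chartCr_ne_zero _ _)] at e
  have key : ∀ t : ℝ, chartCr t (pairMarks {j : Fin 1 // j ≠ 0}) =
      (((-(1 - t) ^ 2 : ℝ) : ℂ), ((-t ^ 2 : ℝ) : ℂ)) := by
    intro t
    have e0 : position (K := {j : Fin 1 // j ≠ 0}) t (pairMarks _ 0) = (0, 1) := rfl
    have e1 : position (K := {j : Fin 1 // j ≠ 0}) t (pairMarks _ 1) = ((t : ℂ), 1) := rfl
    have e2 : position (K := {j : Fin 1 // j ≠ 0}) t (pairMarks _ 2) = (1, 1) := rfl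
    have e3 : position (K := {j : Fin 1 // j ≠ 0}) t (pairMarks _ 3) =
        (1 - starRingEnd ℂ (t : ℂ), 1) := rfl
    rw [chartCr, e0, e1, e2, e3, Complex.conj_ofReal]
    ext <;> simp only [cr, det2] <;> push_cast <;> ring
  rw [key, key] at e
  simp only [det2] at e
  have e' : -(1 - t) ^ 2 * -t' ^ 2 - -t ^ 2 * -(1 - t') ^ 2 = 0 := by exact_mod_cast e
  have e2 : ((1 - t) * t') ^ 2 = (t * (1 - t')) ^ 2 := by linear_combination e'
  have h1 : 0 ≤ (1 - t) * t' := mul_nonneg (by linarith [ht.2]) ht'.1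
  have h2 : 0 ≤ t * (1 - t') := mul_nonneg ht.1 (by linarith [ht'.2])
  have e3 := (pow_left_inj₀ h1 h2 (by norm_num)).1 e2
  linarith

/-- The cross-ratio of four points among which two given ones coincide. -/
theorem pt_cr_eq_of_pair {p p' : Fin 4 → ℂ × ℂ}
    (h3 : ∀ i j k : Fin 4, i ≠ j → i ≠ k → j ≠ k → det2 (p i) (p j) = 0 → det2 (p i) (p k) ≠ 0)
    (h3' : ∀ i j k : Fin 4, i ≠ j → i ≠ k → j ≠ k → det2 (p' i) (p' j) = 0 →
      det2 (p' i) (p' k) ≠ 0) {k l : Fin 4} (hkl : k ≠ l)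
    (h : det2 (p k) (p l) = 0) (h' : det2 (p' k) (p' l) = 0) :
    pt (cr (p 0) (p 1) (p 2) (p 3)) = pt (cr (p' 0) (p' 1) (p' 2) (p' 3)) := by
  have hne := cr_ne_zero h3
  have hne' := cr_ne_zero h3'
  rw [pt_eq_iff hne hne']
  -- By this Plücker relation, the three ways to split four points into pairs correspond to the
  -- cross-ratio values $\infty$, $0$ and $1$, whichever pair of the splitting collides.
  have hN : ∀ p : Fin 4 → ℂ × ℂ, det2 (p 0) (p 2) * det2 (p 1) (p 3) =
      (cr (p 0) (p 1) (p 2) (p 3)).2 - (cr (p 0) (p 1) (p 2) (p 3)).1 := by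
    intro p
    simp only [cr, det2]
    ring
  have D0 : ∀ p : Fin 4 → ℂ × ℂ, det2 (p 0) (p 1) = 0 ∨ det2 (p 2) (p 3) = 0 →
      (cr (p 0) (p 1) (p 2) (p 3)).2 = 0 := by
    rintro p (h | h) <;> simp [cr, det2_swap_eq_zero.1 h]
  have N0 : ∀ p : Fin 4 → ℂ × ℂ, det2 (p 0) (p 3) = 0 ∨ det2 (p 1) (p 2) = 0 →
      (cr (p 0) (p 1) (p 2) (p 3)).1 = 0 := by
    rintro p (h | h)
    · simp [cr, det2_swap_eq_zero.1 h]
    · simp [cr, h]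
  have E0 : ∀ p : Fin 4 → ℂ × ℂ, det2 (p 0) (p 2) = 0 ∨ det2 (p 1) (p 3) = 0 →
      (cr (p 0) (p 1) (p 2) (p 3)).2 = (cr (p 0) (p 1) (p 2) (p 3)).1 := by
    rintro p (h | h)
    · rw [← sub_eq_zero, ← hN, h, zero_mul]
    · rw [← sub_eq_zero, ← hN, h, mul_zero]
  wlog hlt : k < l generalizing k l
  · exact this hkl.symm (det2_swap_eq_zero.1 h) (det2_swap_eq_zero.1 h')
      (lt_of_le_of_ne (not_lt.1 hlt) hkl.symm)
  have hD : ∀ u u' : ℂ × ℂ, u.2 = 0 → u'.2 = 0 → det2 u u' = 0 := by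
    intro u u' e e'
    simp [det2, e, e']
  have hNn : ∀ u u' : ℂ × ℂ, u.1 = 0 → u'.1 = 0 → det2 u u' = 0 := by
    intro u u' e e'
    simp [det2, e, e']
  have hE : ∀ u u' : ℂ × ℂ, u.2 = u.1 → u'.2 = u'.1 → det2 u u' = 0 := by
    intro u u' e e'
    simp [det2, e, e']
  fin_cases k <;> fin_cases l <;> first
    | exact absurd hlt (by decide)
    | exact hD _ _ (D0 p (Or.inl h)) (D0 p' (Or.inl h'))
    | exact hD _ _ (D0 p (Or.inr h)) (D0 p' (Or.inr h'))
    | exact hNn _ _ (N0 p (Or.inl h)) (N0 p' (Or.inl h'))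
    | exact hNn _ _ (N0 p (Or.inr h)) (N0 p' (Or.inr h'))
    | exact hE _ _ (E0 p (Or.inl h)) (E0 p' (Or.inl h'))
    | exact hE _ _ (E0 p (Or.inr h)) (E0 p' (Or.inr h'))

theorem conj_mem_boundary (K : Type) [IsEmpty K] (b : Bool) :
    Moduli.mk conjTree (conjMarking K b) ∈ boundary K (Fin 2) := by
  refine ⟨_, _, rfl, ?_⟩
  change ∀ v : Fin 2, Fin.rev v ≠ v
  decide

/-- Only four marked points remain, so every cross-ratio involves all of them. On both curves
$z_1^-$ coincides, as seen from a suitable component, with the same point of the second pair, and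
this determines the cross-ratio. -/
theorem isForget_three (b : Bool) : IsForget 0 (Moduli.mk threeTree (threeMarking b))
    (Moduli.mk conjTree (conjMarking {j : Fin 1 // j ≠ 0} b)) := by
  intro q
  rw [(hasCoord_three b).crossRatio, chartCr_lift]
  set w : ℂ := if b then 0 else 1 with hw
  let P : Mark {j : Fin 1 // j ≠ 0} (Fin 2) → ℂ × ℂ := fun i => match i with
    | Sum.inl _ => (1, 0)
    | Sum.inr (j, c) => if side b j c then (if j = 0 then (0, 1) else (1, 1)) else (1, 0)
  have hP0 : ∀ i, P i ≠ 0 := by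
    rintro (i | ⟨j, c⟩)
    · simp [P]
    · simp only [P]
      split_ifs <;> simp
  have hseen : ∀ i, (1 : GL (Fin 2) ℂ) • (conjMarking {j : Fin 1 // j ≠ 0} b).seen (0 : Fin 2) i =
      pt (P i) := by
    rintro (i | ⟨j, c⟩)
    · exact isEmptyElim i
    · rw [one_smul]
      by_cases h : side b j c
      · refine (Marking.seen_of_comp_eq (conjMarking _ b) (v := (0 : Fin 2))
          (i := Sum.inr (j, c)) (if_pos h)).trans ?_
        change (if j = 0 then pt (0, 1) else pt (1, 1)) = _
        simp only [P, h, if_true]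
        split_ifs <;> rfl
      · have hne : (conjMarking {j : Fin 1 // j ≠ 0} b).comp (Sum.inr (j, c)) ≠ (0 : Fin 2) := by
          change (if side b j c then (0 : Fin 2) else 1) ≠ 0
          rw [if_neg h]
          decide
        refine (Marking.seen_of_comp_ne (conjMarking _ b) (v := (0 : Fin 2))
          (i := Sum.inr (j, c)) hne).trans ?_
        simp only [P, h]
        rfl
  have hP3 : ∀ i j k, i ≠ j → i ≠ k → j ≠ k → det2 (P i) (P j) = 0 → det2 (P i) (P k) ≠ 0 := by
    rintro (i | ⟨i, c⟩) (j | ⟨j, d⟩) (k | ⟨k, e⟩) hij hik hjk h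
    all_goals try exact isEmptyElim i
    all_goals try exact isEmptyElim j
    all_goals try exact isEmptyElim k
    simp only [P] at h ⊢
    fin_cases i <;> fin_cases j <;> fin_cases k <;> cases b <;> cases c <;> cases d <;> cases e <;>
      simp [side, det2] at hij hik hjk h ⊢
  have hsurj : Function.Surjective q := by
    refine (Function.Injective.bijective_of_nat_card_le q.injective ?_).2
    rw [Nat.card_sum, Nat.card_prod]
    simp
  obtain ⟨k, hk⟩ := hsurj (Sum.inr (0, false))
  obtain ⟨l, hl⟩ := hsurj (Sum.inr (1, !b))
  rw [Marking.crossRatio_eq_pt (conjMarking {j : Fin 1 // j ≠ 0} b) (v := (0 : Fin 2)) (g := 1)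
    (p := fun k => P (q k)) (fun k => hP0 _) (fun k => hseen _) (fun i j k hij hik hjk =>
      hP3 _ _ _ (q.injective.ne hij) (q.injective.ne hik) (q.injective.ne hjk))]
  refine pt_cr_eq_of_pair (p := fun k => P (q k)) (p' := fun k => position w (q k))
    (fun i j k hij hik hjk =>
      hP3 _ _ _ (q.injective.ne hij) (q.injective.ne hik) (q.injective.ne hjk))
    (fun i j k hij hik hjk => det2_position_ne_zero w (q.injective.ne hij) (q.injective.ne hik)
      (q.injective.ne hjk)) (k := k) (l := l) ?_ ?_ ?_
  · rintro rfl
    rw [hk] at hl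
    simp at hl
  · simp only [hk, hl, P]
    cases b <;> simp [side, det2]
  · simp only [hk, hl, position, hw]
    cases b <;> simp [det2]

/-! ### The chart is onto -/

/-- Set $\zeta=w/(w-1)$. The curve is smooth unless $\zeta$ is $0$, $\infty$ (three components) or
lies on the unit circle (then $z_2^\pm$ bubble off). -/
theorem exists_hasCoord (w : ℂ) : ∃ m, HasCoord m w := by
  by_cases w0 : w = 0
  · exact ⟨_, w0 ▸ hasCoord_three true⟩
  by_cases w1 : w = 1
  · exact ⟨_, w1 ▸ hasCoord_three false⟩
  have hw1 : w - 1 ≠ 0 := sub_ne_zero.2 w1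
  have hζ0 : w / (w - 1) ≠ 0 := div_ne_zero w0 hw1
  have hζ1 : w / (w - 1) ≠ 1 := by
    rw [Ne, div_eq_one_iff_eq hw1]
    intro h
    simpa using sub_eq_zero.2 h
  have e : w / (w - 1) - 1 = 1 / (w - 1) := by
    field_simp
    ring
  have e' : w / (w - 1) / (w / (w - 1) - 1) = w := by
    rw [e]
    field_simp
  by_cases h : ‖w / (w - 1)‖ = 1
  · have := hasCoord_two h norm_one hζ1
    rw [e'] at this
    exact ⟨_, this⟩
  · have := (isSmoothing_smooth hζ0 h).hasCoord hζ0 hζ1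
    rw [if_pos rfl, e'] at this
    exact ⟨_, this⟩

theorem mem_tangentSpace_univ {p : Moduli (Fin 1) (Fin 2)} {w : ℂ} (hp : HasCoord p w) (z : ℂ) :
    dchart w z ∈ tangentSpace Set.univ p := by
  choose m hm using exists_hasCoord
  have h0 : tangentSpace Set.univ p = tangentSpace Set.univ (m (w + ((0 : ℝ) : ℂ) * z)) := by
    rw [tangentSpace, tangentSpace, hp.emb_eq, (hm _).emb_eq]
    simp
  rw [h0]
  refine mem_tangentSpace_of_curve (γ := fun r : ℝ => m (w + r * z)) (s := Set.univ) (t := 0) ?_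
    (uniqueDiffWithinAt_univ (𝕜 := ℝ)).accPt fun _ _ => trivial
  have h1 : HasDerivAt (fun r : ℝ => w + r * z) z 0 := by
    simpa using ((hasDerivAt_id (0 : ℝ)).ofReal_comp.mul_const z).const_add w
  have h2 : HasDerivAt (chart ∘ fun r : ℝ => w + r * z) (dchart w z) 0 := by
    refine HasFDerivAt.comp_hasDerivAt (0 : ℝ) ?_ h1
    simpa using hasFDerivAt_chart w
  rw [hasDerivWithinAt_univ]
  exact h2.congr_of_eventuallyEq (Filter.Eventually.of_forall fun r => (hm _).emb_eq)

/-! ### The path -/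

/-- The representatives are chosen together with a rotation of $x_1$ for $0<t<1$, which provides
both the vertical vector and the fact that $x_1$ and $z_1^+$ share a component. At $t=1/2$ one has
$t/(t-1)=-1$ on the unit circle, whence the two-component curve. -/
theorem exists_path_point (t : ℝ) : ∃ p, HasCoord p t ∧
    (t = 0 → p = Moduli.mk threeTree (threeMarking true)) ∧
    (t = 1 → p = Moduli.mk threeTree (threeMarking false)) ∧
    (0 < t → t < 1 → ∃ m, IsRotation 0 0 m ∧ m 0 = p) := by
  by_cases t0 : t = 0
  · subst t0
    exact ⟨_, by simpa using hasCoord_three true, fun _ => rfl, fun h => by norm_num at h,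
      fun h => absurd h (lt_irrefl _)⟩
  by_cases t1 : t = 1
  · subst t1
    exact ⟨_, by simpa using hasCoord_three false, fun h => by norm_num at h, fun _ => rfl,
      fun _ h => absurd h (lt_irrefl _)⟩
  have ht1 : (t : ℂ) - 1 ≠ 0 := by
    rw [sub_ne_zero]
    exact_mod_cast t1
  by_cases th : t = 1 / 2
  · obtain ⟨m, hm, hc⟩ := exists_rotation_two
    refine ⟨m 0, ?_, fun h => absurd h t0, fun h => absurd h t1, fun _ _ => ⟨m, hm, rfl⟩⟩
    rw [th]
    simpa using hc
  · have hn : ‖(t : ℂ) / (t - 1)‖ ≠ 1 := by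
      have e : (t : ℂ) / (t - 1) = ((t / (t - 1) : ℝ) : ℂ) := by push_cast; rfl
      have ht1' : t - 1 ≠ 0 := sub_ne_zero.2 t1
      rw [e, Complex.norm_real, Real.norm_eq_abs, Ne, abs_eq zero_le_one, div_eq_iff ht1',
        div_eq_iff ht1']
      rintro (h | h)
      · linarith
      · exact th (by linarith)
    obtain ⟨m, hm, hc⟩ := exists_rotation_smooth
      (div_ne_zero (by exact_mod_cast t0) ht1) hn
    refine ⟨m 0, ?_, fun h => absurd h t0, fun h => absurd h t1, fun _ _ => ⟨m, hm, rfl⟩⟩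
    have e' : (t : ℂ) / (t - 1) / ((t : ℂ) / (t - 1) - 1) = t := by
      have : (t : ℂ) / (t - 1) - 1 = 1 / (t - 1) := by
        field_simp
        ring
      rw [this]
      field_simp
    rwa [e'] at hc

/-- The curve with real coordinate `t`. -/
def realPoint (t : ℝ) : Moduli (Fin 1) (Fin 2) := (exists_path_point t).choose

theorem hasCoord_realPoint (t : ℝ) : HasCoord (realPoint t) t :=
  (exists_path_point t).choose_spec.1

theorem realPoint_zero : realPoint 0 = Moduli.mk threeTree (threeMarking true) :=
  (exists_path_point 0).choose_spec.2.1 rfl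

theorem realPoint_one : realPoint 1 = Moduli.mk threeTree (threeMarking false) :=
  (exists_path_point 1).choose_spec.2.2.1 rfl

theorem exists_rotation_realPoint {t : ℝ} (h0 : 0 < t) (h1 : t < 1) :
    ∃ m, IsRotation 0 0 m ∧ m 0 = realPoint t :=
  (exists_path_point t).choose_spec.2.2.2 h0 h1

theorem emb_realPoint : (fun t => emb (realPoint t)) = fun t : ℝ => chart t :=
  funext fun t => (hasCoord_realPoint t).emb_eq

theorem hasDerivAt_emb_realPoint (t : ℝ) :
    HasDerivAt (fun t => emb (realPoint t)) (dchart t 1) t := by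
  rw [emb_realPoint]
  exact (hasFDerivAt_chart t).comp_hasDerivAt t (hasDerivAt_id t).ofReal_comp

theorem derivWithin_emb_realPoint {t : ℝ} (ht : t ∈ Set.Icc (0 : ℝ) 1) :
    derivWithin (fun t => emb (realPoint t)) (Set.Icc 0 1) t = dchart t 1 :=
  (hasDerivAt_emb_realPoint t).hasDerivWithinAt.derivWithin (uniqueDiffOn_Icc_zero_one t ht)

/-- The path from `P⁺` to `P⁻` along which the coordinate goes from `0` to `1`. -/
def realPath : EmbeddedPath (Fin 1) (Fin 2) where
  path := realPoint
  smooth := by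
    rw [emb_realPoint]
    exact (contDiff_chart.comp Complex.ofRealCLM.contDiff).contDiffOn
  injOn := by
    rw [emb_realPoint]
    exact (chart_injective.comp Complex.ofReal_injective).injOn
  immersion t ht := by
    rw [derivWithin_emb_realPoint ht]
    intro h
    exact one_ne_zero (dchart_injective t (h.trans (map_zero _).symm))

theorem exists_real_coord : ∀ m ∈ realPath.carrier, ∃ t : ℝ, HasCoord m t := by
  rintro _ ⟨t, -, rfl⟩
  exact ⟨t, hasCoord_realPoint t⟩

theorem ends_realPath : ends realPath.carrier = ∅ := by
  have hc : IsClosed (emb '' realPath.carrier) := by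
    have : emb '' realPath.carrier = (fun t : ℝ => chart t) '' Set.Icc 0 1 := by
      rw [← emb_realPoint, EmbeddedPath.carrier, Set.image_image]
      rfl
    rw [this]
    exact (isCompact_Icc.image
      (contDiff_chart.continuous.comp Complex.continuous_ofReal)).isClosed
  simp only [ends, hc.closure_eq, Set.sdiff_self, Set.mem_empty_iff_false, Set.ofPred_false]

theorem mem_tangentSpace_carrier {t : ℝ} (ht : t ∈ Set.Icc (0 : ℝ) 1) :
    dchart t 1 ∈ tangentSpace realPath.carrier (realPoint t) :=
  mem_tangentSpace_of_curve (hasDerivAt_emb_realPoint t).hasDerivWithinAt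
    (uniqueDiffOn_Icc_zero_one t ht).accPt fun r hr => ⟨r, hr, rfl⟩

theorem notMem_tangentSpace_carrier (t : ℝ) {z : ℂ} (hz : z.im ≠ 0) :
    dchart t z ∉ tangentSpace realPath.carrier (realPoint t) := fun h =>
  hz (im_eq_zero_of_mem_tangentSpace (hasCoord_realPoint t) (Complex.ofReal_im t)
    exists_real_coord h)

/-- The co-orientation of the path by the direction `-𝕚` of the coordinate. -/
def realCoOrientation : CoOrientation realPath.carrier where
  -- At both endpoints the outer normal followed by $-i$ is a positive complex frame; $+i$ would
  -- reverse both orientations and both degrees.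
  normal p := dchart (coord (emb p)) (-Complex.I)
  continuousOn := by
    rintro _ ⟨t, -, rfl⟩
    refine ContinuousAt.continuousWithinAt ?_
    have h1 : ContinuousAt (fun p : Moduli (Fin 1) (Fin 2) => coord (emb p)) (realPoint t) := by
      refine ContinuousAt.comp (g := coord) ?_ continuous_induced_dom.continuousAt
      rw [(hasCoord_realPoint t).emb_eq]
      exact (differentiableAt_coord t).continuousAt
    exact (continuous_dchart.continuousAt.comp h1).clm_apply continuousAt_const
  mem_tangent := by
    rintro _ ⟨t, -, rfl⟩
    have h := hasCoord_realPoint t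
    rw [show coord (emb (realPath.path t)) = t from h.emb_eq ▸ coord_chart t]
    exact mem_tangentSpace_univ h _
  notMem_tangent := by
    rintro _ ⟨t, -, rfl⟩
    have h := hasCoord_realPoint t
    rw [show coord (emb (realPath.path t)) = t from h.emb_eq ▸ coord_chart t]
    exact notMem_tangentSpace_carrier t (by simp)

theorem normal_realPoint (t : ℝ) :
    realCoOrientation.normal (realPoint t) = dchart t (-Complex.I) := by
  change dchart (coord (emb (realPoint t))) (-Complex.I) = _
  rw [(hasCoord_realPoint t).emb_eq, coord_chart]

/-! ### Strata -/

theorem continuous_emb_apply {K L : Type} (q : Fin 4 ↪ Mark K L) :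
    Continuous fun m : Moduli K L => emb m q :=
  (continuous_apply q).comp (continuous_induced_dom (f := emb))

theorem seen_eq_of_comp_ne {K L : Type} {T : RealTree} {μ : Marking T K L} (hn : T.n = 2)
    {v : Fin T.n} {i j : Mark K L} (hi : μ.comp i ≠ v) (hj : μ.comp j ≠ v) :
    μ.seen v i = μ.seen v j := by
  have : μ.comp i = μ.comp j := by omega
  rw [μ.seen_of_comp_ne hi, μ.seen_of_comp_ne hj, this]

/-- On $S_1$ the component with $z_1^\pm$ sees $z_2^+$ and $x_1$ at the same node, so $w=\infty$, a
closed condition. -/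
theorem snd_eq_one_of_mem_closure_stratum {m : Moduli (Fin 1) (Fin 2)}
    (h : m ∈ closure (stratum ∅ {0})) : (emb m (chartMarks true)).2 = 1 := by
  have hcl : IsClosed {m : Moduli (Fin 1) (Fin 2) | (emb m (chartMarks true)).2 = 1} :=
    isClosed_eq (continuous_snd.comp (continuous_emb_apply _)) continuous_const
  refine closure_minimal ?_ hcl h
  rintro _ ⟨T, μ, rfl, hn, -, v, hA, hB⟩
  rw [Set.mem_ofPred_eq, emb, sphere_snd_eq_one_iff, Marking.crossRatio_mk_iff]
  have hz : ∀ b, μ.comp (Sum.inr (0, b)) = v := fun b => (hB 0 b).2 rfl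
  have hx : μ.comp (Sum.inl 0) ≠ v := fun e => (hA 0).1 e
  have hy : μ.comp (Sum.inr (1, true)) ≠ v := fun e => by simpa using (hB 1 true).1 e
  have hs : μ.Separates v (Sum.inr (0, true)) (Sum.inr (0, false)) (Sum.inl 0) :=
    ⟨μ.seen_ne_of_comp_eq (hz true) (by simp), μ.seen_ne_of_comp_eq (hz true) (by simp),
      μ.seen_ne_of_comp_eq (hz false) (by simp)⟩
  obtain ⟨g, h0, h1, h2⟩ := hs.exists_smul
  refine ⟨v, g, h0, h1, h2, ?_⟩
  rw [chartMarks_three, seen_eq_of_comp_ne hn hy hx, h2]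

/-- On $S_2$ the points $z_2^+$ and $z_2^-$ are seen at the same node, a closed condition on
cross-ratios, which in the chart reads $w=1-\bar w$. -/
theorem emb_eq_of_mem_closure_stratum {m : Moduli (Fin 1) (Fin 2)}
    (h : m ∈ closure (stratum Set.univ {0})) :
    emb m (chartMarks true) = emb m (chartMarks false) := by
  have hcl : IsClosed {m : Moduli (Fin 1) (Fin 2) |
      emb m (chartMarks true) = emb m (chartMarks false)} :=
    isClosed_eq (continuous_emb_apply _) (continuous_emb_apply _)
  refine closure_minimal ?_ hcl h
  rintro _ ⟨T, μ, rfl, hn, -, v, hA, hB⟩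
  have hz : ∀ b, μ.comp (Sum.inr (0, b)) = v := fun b => (hB 0 b).2 rfl
  have hy : ∀ b, μ.comp (Sum.inr (1, b)) ≠ v := fun b e => by simpa using (hB 1 b).1 e
  have hs : μ.Separates v (Sum.inr (0, true)) (Sum.inr (0, false)) (Sum.inl 0) :=
    ⟨μ.seen_ne_of_comp_eq (hz true) (by simp), μ.seen_ne_of_comp_eq (hz true) (by simp),
      μ.seen_ne_of_comp_eq (hz false) (by simp)⟩
  obtain ⟨g, h0, h1, h2⟩ := hs.exists_smul
  refine congrArg sphere (μ.crossRatio_mk_iff.2 ⟨v, g, h0, h1, h2, ?_⟩)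
  rw [chartMarks_three, seen_eq_of_comp_ne hn (hy true) (hy false)]
  have : (Moduli.mk T μ).crossRatio (chartMarks false) = g • μ.seen v (Sum.inr (1, false)) :=
    μ.crossRatio_mk_iff.2 ⟨v, g, h0, h1, h2, rfl⟩
  exact this.symm

theorem disjoint_carrier : Disjoint realPath.carrier (closure (stratum ∅ {0})) := by
  rw [Set.disjoint_left]
  rintro _ ⟨t, -, rfl⟩ h
  have h1 := snd_eq_one_of_mem_closure_stratum h
  rw [show emb (realPath.path t) = chart t from (hasCoord_realPoint t).emb_eq] at h1
  exact chart_snd_ne_one t h1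

theorem eq_half_of_mem_closure_stratum {t : ℝ}
    (h : realPoint t ∈ closure (stratum Set.univ {0})) : t = 1 / 2 := by
  have hc := hasCoord_realPoint t
  have h1 : (realPoint t).crossRatio (chartMarks true) =
      (realPoint t).crossRatio (chartMarks false) :=
    sphere_injective (emb_eq_of_mem_closure_stratum h)
  rw [hc.crossRatio_false, show (realPoint t).crossRatio (chartMarks true) = _ from hc,
    Complex.conj_ofReal] at h1
  have h2 : t = 1 - t := by exact_mod_cast OnePoint.coe_injective h1
  linarith

theorem hasCoord_half : HasCoord (realPoint (1 / 2)) (1 / 2) := by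
  simpa using hasCoord_realPoint (1 / 2)

theorem half_mem : (1 / 2 : ℝ) ∈ Set.Icc (0 : ℝ) 1 := by constructor <;> norm_num

/-- The positive rotation of the node of the point of the path in the second stratum. -/
theorem exists_rotation_half :
    ∃ (m₁ : ℝ → Moduli (Option (Set.univ : Set (Fin 1))) ({0} : Set (Fin 2)))
    (m : ℝ → Moduli (Fin 1) (Fin 2)), IsRotation ⟨0, rfl⟩ none m₁ ∧
    (∀ᶠ θ in nhds (0 : ℝ), Glue Set.univ {0} (m₁ θ)
      (Moduli.mk sphereTree (circleMarking circleData_second)) (m θ)) ∧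
    (∀ θ, m θ ∈ stratum Set.univ {0}) ∧ m 0 = realPoint (1 / 2) ∧
    HasDerivAt (fun θ => emb (m θ)) (dchart (1 / 2) (Complex.I / 4)) 0 := by
  obtain ⟨m₁, m, h1, h2, h3, h4⟩ := exists_rotation_node
  refine ⟨m₁, m, h1, h2, h3, h4.eq_of_half hasCoord_half, ?_⟩
  convert hasDerivAt_emb_of_rotation_node h1 h2 h4 using 2
  ring

theorem half_mem_stratum : realPoint (1 / 2) ∈ stratum Set.univ {0} := by
  obtain ⟨-, m, -, -, h, h0, -⟩ := exists_rotation_half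
  exact h0 ▸ h 0

theorem carrier_inter_closure_stratum :
    realPath.carrier ∩ closure (stratum Set.univ {0}) = {realPoint (1 / 2)} := by
  ext u
  constructor
  · rintro ⟨⟨t, -, rfl⟩, h⟩
    rw [Set.mem_singleton_iff, ← eq_half_of_mem_closure_stratum h]
    rfl
  · rintro rfl
    exact ⟨⟨_, half_mem, rfl⟩, subset_closure half_mem_stratum⟩

theorem bd_inter_closure_stratum :
    realPath.bd ∩ closure (stratum Set.univ {0}) = ∅ := by
  rw [Set.eq_empty_iff_forall_notMem]
  rintro u ⟨rfl | rfl, h⟩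
  · have := eq_half_of_mem_closure_stratum h
    norm_num at this
  · have := eq_half_of_mem_closure_stratum h
    norm_num at this

/-- The value $1/2$ differs from $0,1,\infty$, so all four marked points are seen apart from one
component and hence lie on it. -/
theorem mem_star_of_crossRatio_nodeMarks
    {m₁ : Moduli (Option (Set.univ : Set (Fin 1))) ({0} : Set (Fin 2))}
    (h : m₁.crossRatio nodeMarks = ((1 / 2 : ℂ) : P1)) (o : ({0} : Set (Fin 2))) :
    m₁ ∈ star o none := by
  obtain rfl : o = ⟨0, rfl⟩ := Subsingleton.elim _ _
  obtain ⟨T, μ, rfl⟩ := m₁.exists_mk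
  obtain ⟨v, g, h0, h1, h2, h3⟩ := μ.crossRatio_mk_iff.1 h
  have hinj : Function.Injective fun k => μ.seen v (nodeMarks k) := by
    intro i j e
    have e' : g • μ.seen v (nodeMarks i) = g • μ.seen v (nodeMarks j) := congrArg _ e
    have n1 : (2 : ℂ)⁻¹ ≠ 0 := by norm_num
    have n2 : (2 : ℂ)⁻¹ ≠ 1 := by norm_num
    fin_cases i <;> fin_cases j <;> simp only [Fin.zero_eta, Fin.mk_one, Fin.reduceFinMk,
      h0, h1, h2, h3] at e' ⊢ <;> simp [n1, n1.symm, n2, n2.symm] at e'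
  have hsurj : Function.Surjective nodeMarks := by
    rintro ((_ | i) | ⟨j, _ | _⟩)
    · exact ⟨3, rfl⟩
    · exact ⟨2, by rw [Subsingleton.elim i ⟨0, trivial⟩]; rfl⟩
    · exact ⟨1, by rw [Subsingleton.elim j ⟨0, rfl⟩]; rfl⟩
    · exact ⟨0, by rw [Subsingleton.elim j ⟨0, rfl⟩]; rfl⟩
  have hall : ∀ k, μ.comp (nodeMarks k) = v := by
    intro k
    refine μ.comp_eq_of_seen_ne fun j hj => ?_
    obtain ⟨l, rfl⟩ := hsurj j
    exact fun e => hj (congrArg nodeMarks (hinj e))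
  exact ⟨T, μ, rfl, (hall 3).trans (hall 0).symm⟩

/-! ### Regularity -/

theorem regularStratum_first : RegularStratum 0 ∅ {0} realPath.carrier realPath.bd := by
  have h1 : realPath.carrier ∩ closure (stratum ∅ {0}) = ∅ :=
    Set.disjoint_iff_inter_eq_empty.1 disjoint_carrier
  have hsub : realPath.bd ⊆ realPath.carrier := by
    rintro _ (rfl | rfl)
    · exact ⟨0, by simp, rfl⟩
    · exact ⟨1, by simp, rfl⟩
  have h2 : realPath.bd ∩ closure (stratum ∅ {0}) = ∅ :=
    Set.disjoint_iff_inter_eq_empty.1 (disjoint_carrier.mono_left hsub)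
  refine ⟨?_, ?_, ⟨∅, fun _ => Set.empty_subset _, ?_⟩, fun h => absurd ⟨rfl, rfl⟩ h⟩
  · rw [h1]
    exact fun u hu => hu.elim
  · rw [h2]
    exact fun u hu => hu.elim
  · rw [h1]
    simp

/-- Transversality at $w=1/2$ holds because the path has tangent $1$ and the rotating node provides
the tangent $i/4$ of the stratum. The factor `Y₁` consists of the first curves whose cross-ratio is
$1/2$. -/
theorem regularStratum_second :
    RegularStratum 0 Set.univ {0} realPath.carrier realPath.bd := by
  refine ⟨?_, ?_, ⟨{m₁ | m₁.crossRatio nodeMarks = ((1 / 2 : ℂ) : P1)},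
    fun h m₁ hm₁ => mem_star_of_crossRatio_nodeMarks hm₁ _, ?_⟩, fun _ => ⟨?_, ?_⟩⟩
  · rw [carrier_inter_closure_stratum]
    rintro _ rfl
    refine le_antisymm (sup_le (tangentSpace_mono (Set.subset_univ _) _)
      (tangentSpace_mono (Set.subset_univ _) _)) ?_
    refine (tangentSpace_le_range hasCoord_half).trans ?_
    rintro _ ⟨z, rfl⟩
    have h1 := mem_tangentSpace_carrier half_mem
    have h2 : dchart (1 / 2) (Complex.I / 4) ∈
        tangentSpace (closure (stratum Set.univ {0})) (realPoint (1 / 2)) := by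
      obtain ⟨-, m, -, -, h, h0, hd⟩ := exists_rotation_half
      rw [← h0]
      exact mem_tangentSpace_of_curve (s := Set.univ) hd.hasDerivWithinAt
        (uniqueDiffWithinAt_univ (𝕜 := ℝ)).accPt fun r _ => subset_closure (h r)
    have e : z = z.re • (1 : ℂ) + (4 * z.im) • (Complex.I / 4) := by
      apply Complex.ext <;> simp
      ring
    have h1' : dchart (1 / 2) 1 ∈ tangentSpace realPath.carrier (realPoint (1 / 2)) := by
      simpa using h1
    rw [e, map_add, map_smul, map_smul]
    exact Submodule.add_mem_sup (Submodule.smul_mem _ _ h1') (Submodule.smul_mem _ _ h2)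
  · rw [bd_inter_closure_stratum]
    exact fun u hu => hu.elim
  · rw [carrier_inter_closure_stratum]
    ext u
    constructor
    · rintro rfl
      obtain ⟨m₁, m, -, hg, -, h0, -⟩ := exists_rotation_half
      have hg0 := hg.self_of_nhds
      rw [h0] at hg0
      exact ⟨m₁ 0, hg0.crossRatio.symm.trans hasCoord_half, _, hg0⟩
    · rintro ⟨m₁, h1, m₂, hg⟩
      exact HasCoord.eq_of_half (hg.crossRatio.trans h1) hasCoord_half
  · rw [ends_realPath, Set.empty_inter]
    exact fun u hu => hu.elim
  · rw [bd_inter_closure_stratum]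
    exact fun u hu => hu.elim

theorem regular_realPath : Regular 0 realPath.carrier realPath.bd := by
  refine ⟨by rw [ends_realPath]; exact Set.empty_subset _, ?_, ?_⟩
  · intro i
    rw [Subsingleton.elim i 0]
    refine ⟨?_, by rw [ends_realPath]; exact fun u hu => hu.elim, ?_⟩
    · rintro _ ⟨⟨t, ht, rfl⟩, hb⟩
      have h0 : t ≠ 0 := by
        rintro rfl
        exact hb (Or.inl rfl)
      have h1 : t ≠ 1 := by
        rintro rfl
        exact hb (Or.inr rfl)
      obtain ⟨m, ⟨T, μ, v, g, h⟩, hm⟩ :=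
        exists_rotation_realPoint (lt_of_le_of_ne ht.1 h0.symm) (lt_of_le_of_ne ht.2 h1)
      obtain ⟨e, -, -, hx, hz, -⟩ := h.self_of_nhds
      exact ⟨T, μ 0, e.symm.trans hm, hx.trans hz.symm⟩
    · rintro _ (rfl | rfl)
      · refine ⟨_, ?_, Or.inl (conj_mem_boundary _ true)⟩
        rw [show realPath.path 0 = _ from realPoint_zero]
        exact isForget_three true
      · refine ⟨_, ?_, Or.inl (conj_mem_boundary _ false)⟩
        rw [show realPath.path 1 = _ from realPoint_one]
        exact isForget_three false
  · rintro A B ⟨h0, -, h2⟩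
    -- If both pairs lay on the first component, the second one would have at most one real point
    -- besides the node. Only the types of $S_1$ and $S_2$ remain.
    have hB : B = {0} := by
      have : (1 : Fin 2) ∉ B := by
        intro h1
        have hB : Bᶜ = ∅ := by
          ext j
          fin_cases j <;> simp [h0, h1]
        have hA : Aᶜ.ncard ≤ 1 := Set.ncard_le_one_of_subsingleton _
        rw [hB, Set.ncard_empty] at h2
        omega
      ext j
      fin_cases j <;> simp [h0, this]
    subst hB
    by_cases hA : (0 : Fin 1) ∈ A
    · obtain rfl : A = Set.univ := by
        ext i
        simpa [Subsingleton.elim i 0] using hA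
      exact regularStratum_second
    · obtain rfl : A = ∅ := by
        ext i
        simpa [Subsingleton.elim i 0] using hA
      exact regularStratum_first

/-! ### Degrees -/

theorem mk_sphereTree_notMem_boundary {K L : Type} (μ : Marking sphereTree K L) :
    Moduli.mk sphereTree μ ∉ boundary K L := by
  rintro ⟨T, μ', h, hT⟩
  obtain ⟨f, g, -, -, h3, -⟩ : Iso _ _ := Quotient.exact h.symm
  exact hT (f (0 : Fin 1)) (h3 (0 : Fin 1))

theorem exists_isForget_iff {y : Moduli {j : Fin 1 // j ≠ 0} (Fin 2)} (hy : y ∉ boundary _ _) :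
    ∃ t : ℝ, 0 < t ∧ t < 1 ∧ ∀ s ∈ Set.Icc (0 : ℝ) 1, IsForget 0 (realPoint s) y ↔ s = t := by
  obtain ⟨T, μ, rfl⟩ := y.exists_mk
  obtain ⟨t, t0, t1, v, g, h⟩ := exists_position_of_notMem_boundary μ hy
  have ht := isForget_of_position (hasCoord_realPoint t) μ h
  refine ⟨t, t0, t1, fun s hs => ⟨fun hf => ?_, fun e => e ▸ ht⟩⟩
  exact coord_unique_of_isForget (hasCoord_realPoint s) (hasCoord_realPoint t) hs ⟨t0.le, t1.le⟩
    hf ht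

theorem hasDegreeForget_realPath : HasDegreeForget 0 0 realCoOrientation realPath.bd 1 := by
  -- Any smooth curve is a regular value; $2$ is merely a nonzero number off the unit circle.
  refine ⟨⟨Moduli.mk sphereTree (circleMarking (circleData_smooth (ξ := 1) (ζ := 2)
    (by simp) (by simp) (by simp))), mk_sphereTree_notMem_boundary _, ?_, ?_⟩, ?_⟩
  · obtain ⟨t, t0, t1, ht⟩ := exists_isForget_iff (mk_sphereTree_notMem_boundary
      (circleMarking (circleData_smooth (K := {j : Fin 1 // j ≠ 0}) (ξ := 1) (ζ := 2)
        (by simp) (by simp) (by simp))))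
    rw [ends_realPath, Set.union_empty]
    rintro _ (rfl | rfl) h
    · exact t0.ne ((ht 0 (by simp)).1 h)
    · exact t1.ne' ((ht 1 (by simp)).1 h)
  · obtain ⟨t, t0, t1, ht⟩ := exists_isForget_iff (mk_sphereTree_notMem_boundary
      (circleMarking (circleData_smooth (K := {j : Fin 1 // j ≠ 0}) (ξ := 1) (ζ := 2)
        (by simp) (by simp) (by simp))))
    rintro _ ⟨s, hs, rfl⟩ h w ⟨m, hm, hm0, hd⟩
    obtain rfl := (ht s hs).1 h
    have hc : HasCoord (m 0) s := hm0 ▸ hasCoord_realPoint s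
    rw [hd.unique (hm.hasDerivAt_emb hc)]
    refine notMem_tangentSpace_carrier s ?_
    have : (Complex.I * (s * (s - 1))).im = s * (s - 1) := by simp
    rw [this]
    exact mul_ne_zero t0.ne' (sub_ne_zero.2 t1.ne)
  · rintro y ⟨hy, -, -⟩
    obtain ⟨t, t0, t1, ht⟩ := exists_isForget_iff hy
    have hset : {u ∈ realPath.carrier | IsForget 0 u y} = {realPoint t} := by
      ext u
      constructor
      · rintro ⟨⟨s, hs, rfl⟩, h⟩
        rw [Set.mem_singleton_iff, ← (ht s hs).1 h]
        rfl
      · rintro rfl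
        exact ⟨⟨t, ⟨t0.le, t1.le⟩, rfl⟩, (ht t ⟨t0.le, t1.le⟩).2 rfl⟩
    rw [hset]
    refine ⟨Set.finite_singleton _, fun _ => 1, ?_, finsum_mem_singleton⟩
    intro u hu h
    obtain rfl : u = realPoint t := by
      have : u ∈ {u ∈ realPath.carrier | IsForget 0 u y} := ⟨hu, h⟩
      rwa [hset] at this
    obtain ⟨m, hm, hm0⟩ := exists_rotation_realPoint t0 t1
    -- The vertical vector $i\,t(t-1)$ equals $t(1-t)$ times the co-orientation $-i$.
    refine ⟨_, ⟨m, hm, hm0, hm.hasDerivAt_emb (hm0 ▸ hasCoord_realPoint t)⟩, t * (1 - t), ?_,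
      Or.inl ⟨mul_pos t0 (sub_pos.2 t1), rfl⟩⟩
    rw [normal_realPoint, ← map_smul, ← map_sub]
    have : Complex.I * (t * (t - 1)) - (t * (1 - t)) • -Complex.I = 0 := by
      rw [Complex.real_smul]
      push_cast
      ring
    rw [this, map_zero]
    exact zero_mem _

theorem circleData_three {K L : Type} [Unique K] [Unique L] :
    CircleData (fun _ : K => (1 : ℂ)) (fun _ : L => 0) where
  norm_x := by simp
  inj_x := Function.injective_of_subsingleton _
  inj_z := Function.injective_of_subsingleton _
  mul_conj_ne := by simp
  card := by
    rw [Nat.card_sum, Nat.card_prod]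
    simp

instance : Unique {j : Option (Set.univ : Set (Fin 1)) // j ≠ none} where
  default := ⟨some ⟨0, trivial⟩, by simp⟩
  uniq := by
    rintro ⟨_ | i, h⟩
    · exact absurd rfl h
    · exact Subtype.ext (congrArg some (Subsingleton.elim _ _))

instance : Unique (Option ↥((Set.univ : Set (Fin 1))ᶜ)) where
  default := none
  uniq := by
    rintro (_ | i)
    · rfl
    · exact absurd trivial i.2

instance : Unique ↥(({0} : Set (Fin 2))ᶜ) where
  default := ⟨1, by simp⟩
  uniq := by
    rintro ⟨i, hi⟩
    have : i ≠ 0 := hi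
    exact Subtype.ext (by change i = 1; omega)

/-- Both factors of the target are moduli of three-pointed curves. For the second this is
`iso_of_three_marks`; on the first, the condition is vacuous, as there are no four distinct marked
points. -/
theorem isForgetNode_half (y : StratumTarget (Set.univ : Set (Fin 1)) ({0} : Set (Fin 2))) :
    IsForgetNode Set.univ {0} (realPoint (1 / 2)) y := by
  obtain ⟨m₁, m, -, hg, -, h0, -⟩ := exists_rotation_half
  have hg0 := hg.self_of_nhds
  rw [h0] at hg0
  have e : y.2 = Moduli.mk sphereTree (circleMarking circleData_second) := by
    obtain ⟨T, μ, h⟩ := y.2.exists_mk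
    rw [← h]
    exact Quotient.sound (iso_of_three_marks _ _)
  refine ⟨m₁ 0, e ▸ hg0, fun q => ?_⟩
  have := Nat.card_le_card_of_injective q q.injective
  rw [Nat.card_sum, Nat.card_prod] at this
  simp at this

theorem hasDegreeStratum_realPath :
    HasDegreeStratum 0 Set.univ {0} realCoOrientation realPath.bd (-1) := by
  have hset : ∀ y : StratumTarget (Set.univ : Set (Fin 1)) ({0} : Set (Fin 2)),
      {u ∈ realPath.carrier | u ∈ closure (stratum Set.univ {0}) ∧
        IsForgetNode Set.univ {0} u y} = {realPoint (1 / 2)} := by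
    intro y
    rw [← carrier_inter_closure_stratum]
    ext u
    refine ⟨fun h => ⟨h.1, h.2.1⟩, fun h => ⟨h.1, h.2, ?_⟩⟩
    rw [carrier_inter_closure_stratum] at h
    rw [Set.mem_singleton_iff.1 h]
    exact isForgetNode_half y
  refine ⟨⟨(Moduli.mk sphereTree (circleMarking circleData_three),
    Moduli.mk sphereTree (circleMarking circleData_three)), ?_, ?_, ?_⟩, ?_⟩
  · rintro (h | h)
    · exact mk_sphereTree_notMem_boundary _ h
    · exact mk_sphereTree_notMem_boundary _ h
  · rw [ends_realPath, Set.union_empty]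
    rintro u hu ⟨h, -⟩
    have : u ∈ realPath.bd ∩ closure (stratum Set.univ {0}) := ⟨hu, h⟩
    rw [bd_inter_closure_stratum] at this
    exact this
  · rintro u hu h w ⟨h0, m₁, m₂, m, hm₁, hg, hm0, hd⟩
    obtain rfl : u = realPoint (1 / 2) := by
      exact (hset _).subset ⟨hu, h⟩
    have hc : HasCoord (m 0) (1 / 2) := hm0 ▸ hasCoord_half
    rw [hd.unique (hasDerivAt_emb_of_rotation_node hm₁ hg hc)]
    have := notMem_tangentSpace_carrier (1 / 2) (z := Complex.I / 4) (by simp)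
    convert this using 2
    push_cast
    congr 1
    ring
  · intro y _
    rw [hset]
    refine ⟨Set.finite_singleton _, fun _ => -1, ?_, finsum_mem_singleton⟩
    rintro u hu h
    obtain rfl : u = realPoint (1 / 2) := by
      exact (hset y).subset ⟨hu, h⟩
    obtain ⟨m₁, m, h1, hg, -, hm0, hd⟩ := exists_rotation_half
    -- The vertical vector is $i/4=-\tfrac14\cdot(-i)$, whence the sign $-1$.
    refine ⟨_, ⟨rfl, m₁, _, m, h1, hg, hm0, hd⟩, -(1 / 4), ?_, Or.inr ⟨by norm_num, rfl⟩⟩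
    have hn : realCoOrientation.normal (realPoint (1 / 2)) = dchart (1 / 2) (-Complex.I) := by
      simpa using normal_realPoint (1 / 2)
    rw [hn, ← map_smul, ← map_sub]
    have : Complex.I / 4 - (-(1 / 4) : ℝ) • -Complex.I = 0 := by
      rw [Complex.real_smul]
      push_cast
      ring
    rw [this, map_zero]
    exact zero_mem _

/-! ### Endpoints -/

/-- The coordinate of the smoothing with parameter `ζ`. -/
def smoothingCoord (b : Bool) (ζ : ℂ) : ℂ :=
  if b then ζ / (ζ - 1) else (1 - starRingEnd ℂ ζ)⁻¹

/-- Since the smoothing family is $\zeta\mapsto$ `chart (smoothingCoord b ζ)` near $0$, its frame is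
read off the derivative of an explicit function of $\zeta$. -/
theorem isComplexFrame_three (b : Bool) {F : ℂ →L[ℝ] ℂ}
    (hF : HasFDerivAt (smoothingCoord b) F 0) (hinj : Function.Injective F) :
    IsComplexFrame b (Moduli.mk threeTree (threeMarking b))
      (dchart (if b then 0 else 1) (F 1)) (dchart (if b then 0 else 1) (F Complex.I)) := by
  classical
  have hδ : ∀ ζ : ℂ, ∃ m, (ζ = 0 → m = Moduli.mk threeTree (threeMarking b)) ∧
      (ζ ≠ 0 → ‖ζ‖ ≠ 1 → IsSmoothing b ζ m) := by
    intro ζ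
    by_cases h0 : ζ = 0
    · exact ⟨_, fun _ => rfl, fun h => absurd h0 h⟩
    by_cases h1 : ‖ζ‖ = 1
    · exact ⟨Moduli.mk threeTree (threeMarking b), fun _ => rfl, fun _ h => absurd h1 h⟩
    · obtain ⟨m, hm⟩ := exists_isSmoothing b h0 h1
      exact ⟨m, fun h => absurd h h0, fun _ _ => hm⟩
  choose δ hδ0 hδ1 using hδ
  have hnorm : ∀ᶠ ζ : ℂ in nhds 0, ‖ζ‖ ≠ 1 :=
    continuous_norm.continuousAt.eventually_ne (by simp)
  have hs0 : smoothingCoord b 0 = if b then 0 else 1 := by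
    cases b <;> simp [smoothingCoord]
  refine ⟨δ, (dchart (if b then 0 else 1)).comp F, hδ0 0 rfl, ?_, ?_, ?_, rfl, rfl⟩
  · filter_upwards [self_mem_nhdsWithin, hnorm.filter_mono nhdsWithin_le_nhds] with ζ h0 h1
    exact hδ1 ζ h0 h1
  · have h1 : HasFDerivAt (chart ∘ smoothingCoord b) ((dchart (if b then 0 else 1)).comp F) 0 := by
      refine HasFDerivAt.comp _ ?_ hF
      rw [hs0]
      exact hasFDerivAt_chart _
    refine h1.congr_of_eventuallyEq ?_
    filter_upwards [hnorm] with ζ hζ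
    by_cases h0 : ζ = 0
    · subst h0
      rw [hδ0 0 rfl, Function.comp_apply, hs0]
      exact (hasCoord_three b).emb_eq
    · exact ((hδ1 ζ h0 hζ).hasCoord h0 (by rintro rfl; simp at hζ)).emb_eq
  · rw [LinearIndependent.pair_iff]
    intro s t h
    rw [← map_smul, ← map_smul, ← map_add] at h
    have hi : Function.Injective ((dchart (if b then 0 else 1)).comp F) :=
      (dchart_injective _).comp hinj
    have h' := hi (h.trans (map_zero _).symm)
    have hre := congrArg Complex.re h'
    have him := congrArg Complex.im h'
    simp at hre him
    exact ⟨hre, him⟩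

/-- The derivative of $\zeta/(\zeta-1)$ at $0$ is $-1$, so the frame is $(-1,-i)$: the outer normal
at the initial point and the co-orientation. -/
theorem boundaryAgrees_true :
    BoundaryAgrees realPath realCoOrientation true (realPoint 0) := by
  have hF : HasFDerivAt (smoothingCoord true) (-ContinuousLinearMap.id ℝ ℂ) 0 := by
    have h1 : HasDerivAt (fun ζ : ℂ => ζ / (ζ - 1)) (-1) 0 := by
      have := (hasDerivAt_id (0 : ℂ)).div ((hasDerivAt_id (0 : ℂ)).sub_const 1) (by simp)
      exact this.congr_deriv (by simp)
    have h2 := h1.hasFDerivAt.restrictScalars ℝ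
    have e : smoothingCoord true = fun ζ : ℂ => ζ / (ζ - 1) := by
      funext ζ
      simp [smoothingCoord]
    rw [e]
    exact h2.congr_fderiv (by ext; simp)
  have hinj : Function.Injective (-ContinuousLinearMap.id ℝ ℂ) := fun z w h => by simpa using h
  have hfr := isComplexFrame_three true hF hinj
  refine ⟨-dchart 0 1, _, _, Or.inl ⟨rfl, ?_⟩, realPoint_zero ▸ hfr, 1, 0, 0, 1, ?_, ?_, by norm_num⟩
  · have := derivWithin_emb_realPoint (t := 0) (by simp)
    rw [show realPath.path = realPoint from rfl, this, Complex.ofReal_zero]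
  · simp
  · have := normal_realPoint 0
    rw [this]
    simp

/-- The derivative of $1/(1-\bar\zeta)$ at $0$ is complex conjugation, so the frame is $(1,-i)$. The
conjugation is why the same $-i$ works at both ends although the outer normals are opposite. -/
theorem boundaryAgrees_false :
    BoundaryAgrees realPath realCoOrientation false (realPoint 1) := by
  have hF : HasFDerivAt (smoothingCoord false) (Complex.conjCLE : ℂ →L[ℝ] ℂ) 0 := by
    have h1 : HasDerivAt (fun ζ : ℂ => (1 - ζ)⁻¹) 1 (starRingEnd ℂ 0) := by
      have := ((hasDerivAt_id (starRingEnd ℂ (0 : ℂ))).const_sub 1).inv (by simp)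
      exact this.congr_deriv (by simp)
    have h2 := (h1.hasFDerivAt.restrictScalars ℝ).comp (0 : ℂ)
      (Complex.conjCLE : ℂ →L[ℝ] ℂ).hasFDerivAt
    have e : smoothingCoord false = fun ζ : ℂ => (1 - starRingEnd ℂ ζ)⁻¹ := by
      funext ζ
      simp [smoothingCoord]
    rw [e]
    exact h2.congr_fderiv (by ext; simp)
  have hinj : Function.Injective (Complex.conjCLE : ℂ →L[ℝ] ℂ) := Complex.conjCLE.injective
  have hfr := isComplexFrame_three false hF hinj
  refine ⟨dchart 1 1, _, _, Or.inr ⟨rfl, ?_⟩, realPoint_one ▸ hfr, 1, 0, 0, 1, ?_, ?_, by norm_num⟩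
  · have := derivWithin_emb_realPoint (t := 1) (by simp)
    rw [show realPath.path = realPoint from rfl, this, Complex.ofReal_one]
  · simp
  · have := normal_realPoint 1
    rw [this]
    simp

end RealDM

end

theorem lemma3p8 :
    ∃ (Y : EmbeddedPath (Fin 1) (Fin 2)) (ν : CoOrientation Y.carrier)
      (Pp Pm : Moduli (Fin 1) (Fin 2)),
      IsP true Pp ∧ IsP false Pm ∧
      Regular 0 Y.carrier Y.bd ∧
      Disjoint Y.carrier (closure (stratum ∅ {0})) ∧
      Y.bd = {Pp, Pm} ∧ BoundaryAgrees Y ν true Pp ∧ BoundaryAgrees Y ν false Pm ∧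
      HasDegreeForget 0 0 ν Y.bd 1 ∧
      HasDegreeStratum 0 Set.univ {0} ν Y.bd (-1) := by
  exact ⟨realPath, realCoOrientation, realPoint 0, realPoint 1, realPoint_zero ▸ isP_three true,
    realPoint_one ▸ isP_three false, regular_realPath, disjoint_carrier, rfl, boundaryAgrees_true,
    boundaryAgrees_false, hasDegreeForget_realPath, hasDegreeStratum_realPath⟩
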